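/- **Setting.** For $0\le c<1$ and $v\in\mathbb{R}_+^N$ sorted as $v_{(1)}\ge\dots\ge v_{(N)}$, let $\mathrm{ERM}^c(v)=v_{(i^*)}$, where $i^*$ maximizes $i\cdot v_{(i)}$ over all integers $i$ with $cN<i\le N$, the largest maximizing index being taken in case of ties. Let $I\subseteq\{1,\dots,N\}$ with $|I|=m$, and let $(b_I,v_{-I})$ denote the profile whose coordinates in $I$ are given by $b_I$ and the others by $v_{-I}$. For $P=\mathrm{ERM}^c$ put $$\delta_I(v_I,v_{-I})=1-\frac{\inf_{b_I\in\mathbb{R}_+^m}P(b_I,v_{-I})}{P(v_I,v_{-I})},\qquad \delta^{\mathrm{worst}}_m(v_{-I})=\sup_{v_I\in\mathbb{R}_+^m}\delta_I(v_I,v_{-I}),\qquad \Delta^{\mathrm{worst}}_{N,m}=\mathbb{E}_{v_{-I}}\big[\delta^{\mathrm{worst}}_m(v_{-I})\big],$$ where the $N-m$ coordinates of $v_{-I}$ are i.i.d. with law $F$. (As $P$ is symmetric, the choice of $I$ is immaterial.) A distribution on $[0,\infty)$ with CDF $F$ is MHR if it has a density $f$ for which the hazard rate $f/(1-F)$ is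 non-decreasing on $\{F<1\}$, i.e. its support is an interval and the hazard rate is non-decreasing on it. **Theorem.** There is a constant $C>0$ such that, for every sequence $m=m(N)$ of non-negative integers with $m=o(\sqrt N)$, there is an $N_0$ such that the following hold for all $N\ge N_0$. 1. For every MHR distribution $F$ and every $c$ with $\frac mN\le c\le\frac1{4e}$, $$\Delta^{\mathrm{worst}}_{N,m}\le C\,m\,\frac{\log^3N}{\sqrt N}.$$ 2. For every real $D\ge1$, every distribution $F$ (continuous or not) with support included in $[1,D]$ and every $c$ with $\frac mN\le c\le\frac1{2D}$, $$\Delta^{\mathrm{worst}}_{N,m}\le C\,D^{8/3}m^{2/3}\,\frac{\log^2N}{N^{1/3}}.$$ In particular $C$ and $N_0$ do not depend on $F$, $c$ or $D$. -/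

import Mathlib

open MeasureTheory ProbabilityTheory Filter Asymptotics
open scoped NNReal

namespace IncentiveAwareness

/-- The samples sorted non-increasingly: `sortedDesc v 0 ≥ sortedDesc v 1 ≥ ⋯`. The
`i`-th largest sample (`1 ≤ i ≤ N`) is `sortedDesc v ⟨i - 1, _⟩`. -/
noncomputable def sortedDesc {N : ℕ} (v : Fin N → ℝ) (i : Fin N) : ℝ :=
  v (Tuple.sort v i.rev)

/-- The (zero-based) positions `i` with `c N < i + 1` at which `(i + 1) * sortedDesc v i` is
maximal among all positions `j` with `c N < j + 1`. -/
noncomputable def ermArgmax {N : ℕ} (c : ℝ) (v : Fin N → ℝ) : Finset (Fin N) :=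
  Finset.univ.filter fun i =>
    c * N < (i : ℝ) + 1 ∧
      ∀ j : Fin N, c * N < (j : ℝ) + 1 →
        ((j : ℝ) + 1) * sortedDesc v j ≤ ((i : ℝ) + 1) * sortedDesc v i

/-- `c`-guarded empirical revenue maximization; ties are broken towards the larger index, i.e. the
smaller sample. The default value `0` only occurs when no position is admissible, which is
impossible for `N ≥ 1` and `c < 1`. -/
noncomputable def erm {N : ℕ} (c : ℝ) (v : Fin N → ℝ) : ℝ :=
  if h : (ermArgmax c v).Nonempty then sortedDesc v ((ermArgmax c v).max' h) else 0

/-- The profile `(b_I, w_{-I})`: the coordinates in `I` are taken from `b`, the others from `w`. -/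
def profile {N : ℕ} (I : Finset (Fin N)) (b : {j // j ∈ I} → ℝ≥0) (w : {j // j ∉ I} → ℝ) :
    Fin N → ℝ :=
  fun j => if h : j ∈ I then (b ⟨j, h⟩ : ℝ) else w ⟨j, h⟩

/-- The incentive-awareness measure `δ_I(v_I, v_{-I})` of a price learning function `P`. -/
noncomputable def delta {N : ℕ} (P : (Fin N → ℝ) → ℝ) (I : Finset (Fin N))
    (vI : {j // j ∈ I} → ℝ≥0) (w : {j // j ∉ I} → ℝ) : ℝ :=
  1 - (⨅ b : {j // j ∈ I} → ℝ≥0, P (profile I b w)) / P (profile I vI w)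

/-- `δ^worst(v_{-I}) = sup_{v_I} δ_I(v_I, v_{-I})`. -/
noncomputable def deltaWorst {N : ℕ} (P : (Fin N → ℝ) → ℝ) (I : Finset (Fin N))
    (w : {j // j ∉ I} → ℝ) : ℝ :=
  ⨆ vI : {j // j ∈ I} → ℝ≥0, delta P I vI w

/-- The law of `v_{-I}`: the values outside `I` are i.i.d. with law `F`. -/
noncomputable def lawOutside {N : ℕ} (F : Measure ℝ) (I : Finset (Fin N)) :
    Measure ({j // j ∉ I} → ℝ) :=
  Measure.pi fun _ => F

/-- `Δ^worst = E_{v_{-I} ∼ F} [δ^worst(v_{-I})]`. -/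
noncomputable def DeltaWorst {N : ℕ} (P : (Fin N → ℝ) → ℝ) (F : Measure ℝ)
    (I : Finset (Fin N)) : ℝ :=
  ∫ w, deltaWorst P I w ∂(lawOutside F I)

/-- `F` is a monotone hazard rate distribution on `[0, ∞)`: it has a density `f` for which
`f / (1 - F)` is non-decreasing wherever the denominator is positive. Below the support the hazard
rate is `0`, so this is monotonicity of the hazard rate on the support, which is an interval. -/
structure IsMHR (F : Measure ℝ) : Prop where
  nonneg : ∀ᵐ x ∂F, 0 ≤ x
  hazard : ∃ f : ℝ → ℝ, Measurable f ∧ (∀ x, 0 ≤ f x) ∧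
    F = volume.withDensity (fun x => ENNReal.ofReal (f x)) ∧
    MonotoneOn (fun x => f x / (1 - cdf F x)) {x | cdf F x < 1}

/-- The support of `F` is included in `[1, D]`. -/
def IsBoundedDist (D : ℝ) (F : Measure ℝ) : Prop :=
  ∀ᵐ x ∂F, x ∈ Set.Icc 1 D

end IncentiveAwareness

/-! ### Counting functions and a characterization of the price chosen by `erm` -/

namespace IncentiveAwareness

/-! Both bounds follow from one estimate, `DeltaWorst_le`. Write n = N - m. Call the outside samples
typical if the best revenue is at least v₀ n and every nearly optimal sample value is at most D v₀.
Up to the probability of the atypical samples, the expected worst-case discount is O(m D² log² n /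
√n).

Deterministic part. Bids in `I` change each sales count by at most m, and the guard cN ≥ m keeps
every price tied to a genuine sample. So any price that can be forced is optimal for the outside
samples up to the revenue of m extra sales (`Regular.near_erm`). If all such nearly optimal prices
have counts within d of the best count k, they agree up to a factor 1 - (2d + m)/k
(`Regular.deltaWorst_le_of_near`), and k ≥ n/D for typical samples. What remains is to show that
nearly optimal samples are rarely far apart in rank (the event `spread`).

Probabilistic part. Write the samples as V(Q i) with uniform quantiles Q i and cut (0, 1) into K
blocks, so that far apart in rank means in non-adjacent blocks. Draw every sample as a pair together
with a fair coin that selects one component. Look at the pairs with first component in block j - 1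
and second in block j + 1; about n/K² of them exist. Switching on such a coin raises every rank in
block j by one and leaves all non-adjacent blocks alone (`rk_sel_shift`), so the lead of block j
grows by at least a fixed amount. A near tie therefore confines the number of such coins to a window
of length O(mD) just above the threshold at which block j takes the lead (`card_nearlyTied_le`).

The window is compared with the whole upper binomial tail above the threshold, not with 1
(`sum_choose_window_le`, `card_coins_le`). The tail is the event that block j leads, and for j of
one parity these events are disjoint; summing over all blocks thus costs a factor 2 instead of K.
This gives P(spread) = O(m D K √(log n) / √n) at rank distance 9n/K (`real_spread_le`). The discount
at resolution K is O(D/K), so every dyadic K contributes the same amount, and there are at most log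
n of them.

For MHR laws, let v be the point with survival probability 1/e. Then 1 - F(tv) ≤ exp(-t) for t ≥ 1,
and samples are typical with v₀ = 0.3 v, D = 10 outside an event of probability O(1/√n). For support
in [1, D], samples are almost surely typical with v₀ = 1. Since m ≤ √N, the rate m/√N obtained in
the second case is at most m^(2/3) / N^(1/3). -/

/-- The number of coordinates of `v` that are at least `t`. -/
noncomputable def cnt {ι : Type*} [Fintype ι] (v : ι → ℝ) (t : ℝ) : ℕ :=
  (Finset.univ.filter fun j => t ≤ v j).card

section cnt
variable {ι : Type*} [Fintype ι]

lemma cnt_anti (v : ι → ℝ) {s t : ℝ} (h : s ≤ t) : cnt v t ≤ cnt v s := by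
  refine Finset.card_le_card fun j hj => ?_
  simp only [Finset.mem_filter, Finset.mem_univ, true_and] at hj ⊢
  exact h.trans hj

lemma cnt_le_card (v : ι → ℝ) (t : ℝ) : cnt v t ≤ Fintype.card ι :=
  Finset.card_le_univ _

lemma cnt_pos_iff (v : ι → ℝ) (t : ℝ) : 1 ≤ cnt v t ↔ ∃ j, t ≤ v j := by
  rw [cnt, Nat.one_le_iff_ne_zero, ← Nat.pos_iff_ne_zero, Finset.card_pos]
  simp [Finset.Nonempty]

end cnt

/-- The Galois connection between order statistics and counts. It removes the sorting permutation
from the rest of the argument. -/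
lemma le_sortedDesc_iff {N : ℕ} (v : Fin N → ℝ) (i : Fin N) (t : ℝ) :
    t ≤ sortedDesc v i ↔ (i : ℕ) + 1 ≤ cnt v t := by
  have hmono : Monotone (v ∘ Tuple.sort v) := Tuple.monotone_sort v
  have hc : cnt v t = (Finset.univ.filter fun j => t ≤ v (Tuple.sort v j)).card := by
    rw [cnt]
    symm
    refine Finset.card_bij (fun j _ => Tuple.sort v j) ?_ ?_ ?_
    · intro a ha; simpa using ha
    · intro a _ b _ h; exact (Tuple.sort v).injective h
    · intro b hb
      exact ⟨(Tuple.sort v).symm b, by simpa using hb, by simp⟩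
  rw [hc, sortedDesc]
  constructor
  · intro h
    have : (Finset.Ici i.rev) ⊆ Finset.univ.filter fun j => t ≤ v (Tuple.sort v j) := by
      intro j hj
      simp only [Finset.mem_Ici] at hj
      simp only [Finset.mem_filter, Finset.mem_univ, true_and]
      exact h.trans (hmono hj)
    have h2 := Finset.card_le_card this
    rw [Fin.card_Ici, Fin.val_rev] at h2
    omega
  · intro h
    by_contra hlt
    push Not at hlt
    have : (Finset.univ.filter fun j => t ≤ v (Tuple.sort v j)) ⊆ Finset.Ioi i.rev := by
      intro j hj
      simp only [Finset.mem_filter, Finset.mem_univ, true_and] at hj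
      simp only [Finset.mem_Ioi]
      by_contra hji
      push Not at hji
      exact absurd (hj.trans (hmono hji)) (not_le.2 hlt)
    have h2 := Finset.card_le_card this
    rw [Fin.card_Ioi, Fin.val_rev] at h2
    omega

lemma ermArgmax_nonempty {N : ℕ} {c : ℝ} (hN : 0 < N) (hc : c < 1) (v : Fin N → ℝ) :
    (ermArgmax c v).Nonempty := by
  have hNr : (0 : ℝ) < N := by exact_mod_cast hN
  obtain ⟨i, hi, hmax⟩ := Finset.exists_max_image
    (Finset.univ.filter fun i : Fin N => c * N < (i : ℝ) + 1)
    (fun i => ((i : ℝ) + 1) * sortedDesc v i) ⟨⟨N - 1, by omega⟩, by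
      simp only [Finset.mem_filter, Finset.mem_univ, true_and]
      have : ((N - 1 : ℕ) : ℝ) = N - 1 := by
        rw [Nat.cast_sub (by omega)]; simp
      rw [this]; nlinarith⟩
  refine ⟨i, ?_⟩
  simp only [Finset.mem_filter, Finset.mem_univ, true_and] at hi hmax
  simp only [ermArgmax, Finset.mem_filter, Finset.mem_univ, true_and]
  exact ⟨hi, hmax⟩

/-- The three properties that characterize the price chosen by `erm`. -/
structure IsErm {N : ℕ} (c : ℝ) (v : Fin N → ℝ) (P : ℝ) : Prop where
  guard : c * N < cnt v P
  max : ∀ p, c * N < cnt v p → p * cnt v p ≤ P * cnt v P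
  strict : ∀ p, p < P → p * cnt v p < P * cnt v P

/-- Of two candidates the smaller one would be strictly worse by `strict` and at least as good by
`max`. Hence exhibiting a price with the three properties computes `erm`. -/
lemma IsErm.unique {N : ℕ} {c : ℝ} {v : Fin N → ℝ} {P P' : ℝ} (h : IsErm c v P)
    (h' : IsErm c v P') : P = P' := by
  rcases lt_trichotomy P P' with hl | he | hl
  · exact absurd (h'.strict P hl) (not_lt.2 (h.max P' h'.guard))
  · exact he
  · exact absurd (h.strict P' hl) (not_lt.2 (h'.max P h.guard))

/-- A price `p` sells to the first `cnt v p` positions, so it is dominated by the sample at the last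
of these positions. Breaking ties towards the larger index becomes strict optimality against all
smaller prices. -/
lemma isErm_erm {N : ℕ} {c : ℝ} (hN : 0 < N) (hc0 : 0 ≤ c) (hc : c < 1) {v : Fin N → ℝ}
    (hv : ∀ j, 0 ≤ v j) : IsErm c v (erm c v) ∧ 0 ≤ erm c v ∧ ∃ j, erm c v = v j := by
  have hne := ermArgmax_nonempty hN hc v
  have hval : erm c v = sortedDesc v ((ermArgmax c v).max' hne) := by
    rw [erm, dif_pos hne]
  set i := (ermArgmax c v).max' hne with hi
  have hmem : i ∈ ermArgmax c v := Finset.max'_mem _ _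
  have hlast : ∀ j ∈ ermArgmax c v, j ≤ i := fun j hj => Finset.le_max' _ _ hj
  simp only [ermArgmax, Finset.mem_filter, Finset.mem_univ, true_and] at hmem
  obtain ⟨hg, hm⟩ := hmem
  have hP0 : 0 ≤ erm c v := by rw [hval]; exact hv _
  have hcnt : (i : ℕ) + 1 ≤ cnt v (erm c v) := (le_sortedDesc_iff v i _).1 hval.le
  have hcntr : (i : ℝ) + 1 ≤ cnt v (erm c v) := by exact_mod_cast hcnt
  have hcN : 0 ≤ c * N := by positivity
  have key : ∀ p, c * N < cnt v p → ∃ j : Fin N, (j : ℕ) + 1 = cnt v p ∧ p ≤ sortedDesc v j := by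
    intro p hp
    have h1 : 1 ≤ cnt v p := by
      have : (0 : ℝ) < cnt v p := lt_of_le_of_lt hcN hp
      exact_mod_cast this
    have h2 : cnt v p ≤ N := by simpa using cnt_le_card v p
    refine ⟨⟨cnt v p - 1, by omega⟩, by simp; omega, ?_⟩
    rw [le_sortedDesc_iff]
    simp; omega
  have hPi : erm c v * ((i : ℝ) + 1) ≤ erm c v * cnt v (erm c v) :=
    mul_le_mul_of_nonneg_left hcntr hP0
  refine ⟨⟨lt_of_lt_of_le hg hcntr, ?_, ?_⟩, hP0, ⟨_, hval⟩⟩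
  · intro p hp
    obtain ⟨j, hj, hpj⟩ := key p hp
    have hjr : (j : ℝ) + 1 = cnt v p := by exact_mod_cast hj
    have := hm j (by rw [hjr]; exact hp)
    rw [← hval] at this
    rw [← hjr]
    nlinarith [mul_le_mul_of_nonneg_right hpj (by positivity : (0 : ℝ) ≤ (j : ℝ) + 1)]
  · intro p hp
    have hle : cnt v (erm c v) ≤ cnt v p := cnt_anti v hp.le
    have hler : (cnt v (erm c v) : ℝ) ≤ cnt v p := by exact_mod_cast hle
    obtain ⟨j, hj, hpj⟩ := key p (by linarith)
    have hjr : (j : ℝ) + 1 = cnt v p := by exact_mod_cast hj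
    have hmj := hm j (by rw [hjr]; linarith)
    rcases Nat.lt_or_ge (i : ℕ) (j : ℕ) with hij | hij
    · have hnot : j ∉ ermArgmax c v := fun hmem => absurd (hlast j hmem) (not_le.2 hij)
      simp only [ermArgmax, Finset.mem_filter, Finset.mem_univ, true_and, not_and, not_forall,
        not_le] at hnot
      obtain ⟨l, hl, hlt⟩ := hnot (by rw [hjr]; linarith)
      have := hm l hl
      rw [← hval] at this
      rw [← hjr]
      nlinarith [mul_le_mul_of_nonneg_right hpj (by positivity : (0 : ℝ) ≤ (j : ℝ) + 1)]
    -- Here `p` sells exactly as many units as the chosen price, so being smaller it earns strictly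
    -- less.
    · have : cnt v p = cnt v (erm c v) := by omega
      rw [this]
      have : (0 : ℝ) < cnt v (erm c v) := by linarith [Nat.cast_nonneg (α := ℝ) (i : ℕ)]
      exact mul_lt_mul_of_pos_right hp this

/-! ### Measurability of the chosen price -/

section measurability

lemma measurable_cnt {ι : Type*} [Fintype ι] (t : ℝ) :
    Measurable fun v : ι → ℝ => cnt v t := by
  have : (fun v : ι → ℝ => cnt v t) =
      fun v => ∑ j, if t ≤ v j then 1 else 0 := by
    funext v; rw [cnt, Finset.card_filter]
  rw [this]
  refine Finset.measurable_sum _ fun j _ => ?_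
  exact Measurable.ite (measurableSet_le measurable_const (measurable_pi_apply j))
    measurable_const measurable_const

lemma measurable_sortedDesc {N : ℕ} (i : Fin N) :
    Measurable fun v : Fin N → ℝ => sortedDesc v i := by
  refine measurable_of_Ici fun t => ?_
  have : (fun v : Fin N → ℝ => sortedDesc v i) ⁻¹' Set.Ici t =
      {v | (i : ℕ) + 1 ≤ cnt v t} := by
    ext v; simp [le_sortedDesc_iff]
  rw [this]
  exact measurableSet_le measurable_const (measurable_cnt t)

lemma measurable_erm {N : ℕ} (c : ℝ) : Measurable (erm c : (Fin N → ℝ) → ℝ) := by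
  have hA : ∀ i : Fin N, MeasurableSet {v : Fin N → ℝ | i ∈ ermArgmax c v} := by
    intro i
    simp only [ermArgmax, Finset.mem_filter, Finset.mem_univ, true_and]
    refine MeasurableSet.inter (MeasurableSet.const _) ?_
    have : {v : Fin N → ℝ | ∀ j : Fin N, c * N < (j : ℝ) + 1 →
        ((j : ℝ) + 1) * sortedDesc v j ≤ ((i : ℝ) + 1) * sortedDesc v i} =
        ⋂ j : Fin N, ⋂ _ : c * N < (j : ℝ) + 1,
          {v | ((j : ℝ) + 1) * sortedDesc v j ≤ ((i : ℝ) + 1) * sortedDesc v i} := by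
      ext v; simp
    change MeasurableSet {v : Fin N → ℝ | _}
    rw [this]
    exact MeasurableSet.iInter fun j => MeasurableSet.iInter fun _ =>
      measurableSet_le ((measurable_sortedDesc j).const_mul _)
        ((measurable_sortedDesc i).const_mul _)
  have hB : ∀ i : Fin N, MeasurableSet
      {v : Fin N → ℝ | i ∈ ermArgmax c v ∧ ∀ j, i < j → j ∉ ermArgmax c v} := by
    intro i
    have : {v : Fin N → ℝ | i ∈ ermArgmax c v ∧ ∀ j, i < j → j ∉ ermArgmax c v} =
        {v | i ∈ ermArgmax c v} ∩ ⋂ j, ⋂ _ : i < j, {v | j ∈ ermArgmax c v}ᶜ := by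
      ext v; simp
    rw [this]
    exact (hA i).inter (MeasurableSet.iInter fun j => MeasurableSet.iInter fun _ => (hA j).compl)
  classical
  have hsum : (erm c : (Fin N → ℝ) → ℝ) = fun v => ∑ i : Fin N,
      Set.indicator {v : Fin N → ℝ | i ∈ ermArgmax c v ∧ ∀ j, i < j → j ∉ ermArgmax c v}
        (fun v => sortedDesc v i) v := by
    funext v
    rw [erm]
    split_ifs with h
    · rw [Finset.sum_eq_single ((ermArgmax c v).max' h)]
      · rw [Set.indicator_of_mem]
        exact ⟨Finset.max'_mem _ _, fun j hj hm => absurd (Finset.le_max' _ j hm) (not_le.2 hj)⟩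
      · intro i _ hi
        refine Set.indicator_of_notMem ?_ _
        rintro ⟨hm, hl⟩
        have h1 := Finset.le_max' _ i hm
        rcases h1.lt_or_eq with h2 | h2
        · exact hl _ h2 (Finset.max'_mem _ _)
        · exact hi h2
      · simp
    · symm
      refine Finset.sum_eq_zero fun i _ => Set.indicator_of_notMem ?_ _
      rintro ⟨hm, -⟩
      exact h ⟨i, hm⟩
  rw [hsum]
  exact Finset.measurable_sum _ fun i _ => (measurable_sortedDesc i).indicator (hB i)

end measurability

end IncentiveAwareness

namespace IncentiveAwareness

/-! ### Prices that bids in `I` can force, and the deterministic bound on `deltaWorst` -/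

section profile
variable {N : ℕ} {I : Finset (Fin N)}

lemma cnt_profile (b : {j // j ∈ I} → ℝ≥0) (w : {j // j ∉ I} → ℝ) (p : ℝ) :
    cnt (profile I b w) p = cnt (fun j => (b j : ℝ)) p + cnt w p := by
  simp only [cnt, Finset.card_filter]
  rw [← Fintype.sum_subtype_add_sum_subtype (fun j => j ∈ I)
    (fun j => if p ≤ profile I b w j then 1 else 0)]
  congr 1
  · refine Finset.sum_congr (by ext; simp) fun j _ => ?_
    simp [profile, j.2]
  · refine Finset.sum_congr (by ext; simp) fun j _ => ?_
    simp [profile, j.2]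

lemma cnt_bids_le (b : {j // j ∈ I} → ℝ≥0) (p : ℝ) :
    cnt (fun j => (b j : ℝ)) p ≤ I.card := by
  simpa using cnt_le_card (fun j => (b j : ℝ)) p

lemma cnt_const_of_le {q : ℝ≥0} {p : ℝ} (h : p ≤ q) :
    cnt (fun _ : {j // j ∈ I} => (q : ℝ)) p = I.card := by
  simp [cnt, h]

lemma cnt_const_of_lt {q : ℝ≥0} {p : ℝ} (h : (q : ℝ) < p) :
    cnt (fun _ : {j // j ∈ I} => (q : ℝ)) p = 0 := by
  simp [cnt, not_le.2 h]

lemma profile_nonneg {w : {j // j ∉ I} → ℝ} (hw : ∀ j, 0 ≤ w j) (b : {j // j ∈ I} → ℝ≥0)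
    (j : Fin N) : 0 ≤ profile I b w j := by
  unfold profile; split_ifs <;> simp [hw]

/-- Moving all bids to `P` adds at least as much revenue at `P` as at any smaller price, and adds no
sales above `P`. So every price that can be forced at all can be forced by constant bids. -/
lemma isErm_const_self {c : ℝ} {w : {j // j ∉ I} → ℝ} {b : {j // j ∈ I} → ℝ≥0} {P : ℝ≥0}
    (h : IsErm c (profile I b w) P) : IsErm c (profile I (fun _ => P) w) P := by
  have hb := fun p => cnt_bids_le b p
  have hbr : ∀ p, (cnt (fun j => (b j : ℝ)) p : ℝ) ≤ I.card := fun p => by exact_mod_cast hb p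
  have hP0 : (0 : ℝ) ≤ P := P.2
  obtain ⟨hg, hm, hs⟩ := h
  simp only [cnt_profile, Nat.cast_add] at hg hm hs
  refine ⟨?_, ?_, ?_⟩
  · simp only [cnt_profile, Nat.cast_add, cnt_const_of_le le_rfl]
    linarith [hbr P]
  · intro p hp
    simp only [cnt_profile, Nat.cast_add, cnt_const_of_le le_rfl] at hp ⊢
    rcases le_or_gt p P with hle | hlt
    · rw [cnt_const_of_le hle]
      rcases hle.lt_or_eq with hlt | rfl
      · have h1 := hs p hlt
        have hcb : (cnt (fun j => (b j : ℝ)) (P : ℝ) : ℝ) ≤ cnt (fun j => (b j : ℝ)) p := by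
          exact_mod_cast cnt_anti _ hlt.le
        nlinarith [hbr p, hbr P, mul_le_mul_of_nonneg_right hlt.le (sub_nonneg.2 (hbr p)),
          mul_le_mul_of_nonneg_left hcb hP0]
      · exact le_rfl
    · rw [cnt_const_of_lt hlt] at hp ⊢
      have h1 := hm p (by
        have : (0 : ℝ) ≤ cnt (fun j => (b j : ℝ)) p := Nat.cast_nonneg _
        simp only [Nat.cast_zero, zero_add] at hp; linarith)
      have h2 : (0 : ℝ) ≤ p * cnt (fun j => (b j : ℝ)) p :=
        mul_nonneg (hP0.trans hlt.le) (Nat.cast_nonneg _)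
      have h3 := mul_le_mul_of_nonneg_left (hbr P) hP0
      simp only [Nat.cast_zero, zero_add]
      nlinarith
  · intro p hlt
    simp only [cnt_profile, Nat.cast_add, cnt_const_of_le le_rfl, cnt_const_of_le hlt.le]
    have h1 := hs p hlt
    have hcb : (cnt (fun j => (b j : ℝ)) (P : ℝ) : ℝ) ≤ cnt (fun j => (b j : ℝ)) p := by
      exact_mod_cast cnt_anti _ hlt.le
    nlinarith [hbr p, hbr P, mul_le_mul_of_nonneg_right hlt.le (sub_nonneg.2 (hbr p)),
      mul_le_mul_of_nonneg_left hcb hP0]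

/-- With no outside sample in [t, q], raising the common bid from `t` to `q` keeps the count and
only raises the revenue of the chosen price. This allows a forced price that is not a sample to be
replaced by a nearby rational one. -/
lemma isErm_const_of_gap {c : ℝ} {w : {j // j ∉ I} → ℝ} {t q : ℝ≥0} (hc : 0 ≤ c)
    (h : IsErm c (profile I (fun _ => t) w) t) (htq : t < q)
    (hgap : ∀ j, w j < t ∨ (q : ℝ) < w j) : IsErm c (profile I (fun _ => q) w) q := by
  have htq' : (t : ℝ) < q := by exact_mod_cast htq
  have hcnt : ∀ p : ℝ, (t : ℝ) ≤ p → p ≤ q → cnt w p = cnt w t := by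
    intro p h1 h2
    unfold cnt
    congr 1
    ext j
    simp only [Finset.mem_filter, Finset.mem_univ, true_and]
    rcases hgap j with h3 | h3
    · constructor <;> intro h4 <;> linarith
    · constructor <;> intro h4 <;> linarith
  have ht0 : (0 : ℝ) ≤ t := t.2
  obtain ⟨hg, hm, hs⟩ := h
  simp only [cnt_profile, Nat.cast_add, cnt_const_of_le le_rfl] at hg hm hs
  have hpos : (0 : ℝ) < (I.card : ℝ) + cnt w t := lt_of_le_of_lt (by positivity) hg
  have hlt : (t : ℝ) * (I.card + cnt w t) < q * (I.card + cnt w t) :=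
    mul_lt_mul_of_pos_right htq' hpos
  have key : ∀ p : ℝ, p < q → p * (I.card + cnt w p : ℝ) < q * (I.card + cnt w t) := by
    intro p hp
    rcases lt_trichotomy p t with h1 | h1 | h1
    · have := hs p h1
      rw [cnt_const_of_le h1.le] at this
      linarith
    · rw [h1]; exact hlt
    · rw [hcnt p h1.le hp.le]
      exact mul_lt_mul_of_pos_right hp hpos
  refine ⟨?_, ?_, ?_⟩
  · simp only [cnt_profile, Nat.cast_add, cnt_const_of_le le_rfl]
    rw [hcnt q htq'.le le_rfl]; exact hg
  · intro p hp
    simp only [cnt_profile, Nat.cast_add, cnt_const_of_le le_rfl] at hp ⊢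
    rw [hcnt q htq'.le le_rfl]
    rcases lt_trichotomy p q with h1 | h1 | h1
    · rw [cnt_const_of_le h1.le]
      exact (key p h1).le
    · rw [h1, cnt_const_of_le le_rfl, hcnt q htq'.le le_rfl]
    · rw [cnt_const_of_lt h1] at hp ⊢
      have := hm p (by rw [cnt_const_of_lt (htq'.trans h1)]; exact hp)
      rw [cnt_const_of_lt (htq'.trans h1)] at this
      linarith
  · intro p hp
    simp only [cnt_profile, Nat.cast_add, cnt_const_of_le le_rfl, cnt_const_of_le hp.le]
    rw [hcnt q htq'.le le_rfl]
    exact key p hp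

/-- High constant bids give the highest price: passing from `b` to `q` adds to the revenue of `P` at
least what it adds to that of a smaller price, so a smaller price cannot overtake `P`. -/
lemma IsErm.le_of_const {c : ℝ} {w : {j // j ∉ I} → ℝ} {b : {j // j ∈ I} → ℝ≥0} {P P' : ℝ}
    {q : ℝ≥0} (h : IsErm c (profile I b w) P) (h' : IsErm c (profile I (fun _ => q) w) P')
    (hP : P ≤ q) (hP0 : 0 ≤ P') : P ≤ P' := by
  by_contra hlt
  push Not at hlt
  have hbr : ∀ p, (cnt (fun j => (b j : ℝ)) p : ℝ) ≤ I.card := fun p => by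
    exact_mod_cast cnt_bids_le b p
  have h1 := h.strict P' hlt
  have h2 := h'.max P (by
    have := h.guard
    simp only [cnt_profile, Nat.cast_add, cnt_const_of_le hP] at this ⊢
    linarith [hbr P])
  simp only [cnt_profile, Nat.cast_add, cnt_const_of_le hP, cnt_const_of_le (hlt.le.trans hP)]
    at h1 h2
  have hcb : (cnt (fun j => (b j : ℝ)) P : ℝ) ≤ cnt (fun j => (b j : ℝ)) P' := by
    exact_mod_cast cnt_anti _ hlt.le
  nlinarith [hbr P', hbr P, mul_le_mul_of_nonneg_right hlt.le (sub_nonneg.2 (hbr P)),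
    mul_le_mul_of_nonneg_left hcb hP0]

variable {c : ℝ} {w : {j // j ∉ I} → ℝ}

/-- The standing assumptions under which `erm` is well behaved, whatever the bids in `I` are. -/
structure Regular (c : ℝ) (I : Finset (Fin N)) (w : {j // j ∉ I} → ℝ) : Prop where
  c_nonneg : 0 ≤ c
  card_le : (I.card : ℝ) ≤ c * N
  lt_card : c * N < Fintype.card {j // j ∉ I}
  pos : ∀ j, 0 < w j

lemma card_outside_le : Fintype.card {j // j ∉ I} ≤ N := by
  rw [Fintype.card_subtype_compl]
  simp

lemma card_outside : Fintype.card {j // j ∉ I} = N - I.card := by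
  rw [Fintype.card_subtype_compl]
  simp

namespace Regular

lemma card_pos (h : Regular c I w) : 0 < Fintype.card {j // j ∉ I} := by
  have h1 : (0 : ℝ) < Fintype.card {j // j ∉ I} :=
    lt_of_le_of_lt (mul_nonneg h.c_nonneg (Nat.cast_nonneg _)) h.lt_card
  exact_mod_cast h1

lemma N_pos (h : Regular c I w) : 0 < N := h.card_pos.trans_le card_outside_le

lemma c_lt (h : Regular c I w) : c < 1 := by
  have h1 : (Fintype.card {j // j ∉ I} : ℝ) ≤ N := by
    exact_mod_cast card_outside_le (I := I)
  have h2 : (0 : ℝ) < N := by exact_mod_cast h.N_pos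
  have h3 := h.lt_card
  nlinarith

lemma isErm (h : Regular c I w) (b : {j // j ∈ I} → ℝ≥0) :
    IsErm c (profile I b w) (erm c (profile I b w)) :=
  (isErm_erm h.N_pos h.c_nonneg h.c_lt (profile_nonneg (fun j => (h.pos j).le) b)).1

lemma erm_eq (h : Regular c I w) {b : {j // j ∈ I} → ℝ≥0} {P : ℝ}
    (hP : IsErm c (profile I b w) P) : erm c (profile I b w) = P :=
  (h.isErm b).unique hP

/-- The guard asks for more than `c * N ≥ I.card` sales, so not all of them come from bids in `I`.
This keeps the price below the largest outside sample. -/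
lemma cnt_erm_pos (h : Regular c I w) (b : {j // j ∈ I} → ℝ≥0) :
    1 ≤ cnt w (erm c (profile I b w)) := by
  have h1 := (h.isErm b).guard
  rw [cnt_profile, Nat.cast_add] at h1
  have h2 : (cnt (fun j => (b j : ℝ)) (erm c (profile I b w)) : ℝ) ≤ I.card := by
    exact_mod_cast cnt_bids_le b _
  have h3 : (0 : ℝ) < cnt w (erm c (profile I b w)) := by linarith [h.card_le]
  exact_mod_cast h3

lemma exists_max (h : Regular c I w) : ∃ j, ∀ i, w i ≤ w j := by
  have : Nonempty {j // j ∉ I} := Fintype.card_pos_iff.1 h.card_pos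
  exact Finite.exists_max w

lemma exists_min (h : Regular c I w) : ∃ j, ∀ i, w j ≤ w i := by
  have : Nonempty {j // j ∉ I} := Fintype.card_pos_iff.1 h.card_pos
  exact Finite.exists_min w

lemma erm_pos (h : Regular c I w) (b : {j // j ∈ I} → ℝ≥0) : 0 < erm c (profile I b w) := by
  obtain ⟨j, hj⟩ := h.exists_min
  have hc : cnt w (w j) = Fintype.card {j // j ∉ I} := by simp [cnt, hj]
  have hle : (Fintype.card {j // j ∉ I} : ℝ) ≤ cnt (profile I b w) (w j) := by
    rw [cnt_profile, hc]; push_cast; linarith [Nat.cast_nonneg (α := ℝ) (cnt (fun j => (b j : ℝ)) (w j))]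
  have h1 := (h.isErm b).max (w j) (h.lt_card.trans_le hle)
  have h2 : (0 : ℝ) < Fintype.card {j // j ∉ I} := by exact_mod_cast h.card_pos
  have h3 : 0 < w j * cnt (profile I b w) (w j) := mul_pos (h.pos j) (by linarith)
  by_contra hn
  push Not at hn
  have := mul_nonpos_of_nonpos_of_nonneg hn
    (Nat.cast_nonneg (α := ℝ) (cnt (profile I b w) (erm c (profile I b w))))
  linarith

lemma erm_le_max (h : Regular c I w) (b : {j // j ∈ I} → ℝ≥0) {j : {j // j ∉ I}}
    (hj : ∀ i, w i ≤ w j) : erm c (profile I b w) ≤ w j := by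
  obtain ⟨i, hi⟩ := (cnt_pos_iff _ _).1 (h.cnt_erm_pos b)
  exact hi.trans (hj i)

lemma erm_le_const_max (h : Regular c I w) (b : {j // j ∈ I} → ℝ≥0) {j : {j // j ∉ I}}
    (hj : ∀ i, w i ≤ w j) :
    erm c (profile I b w) ≤ erm c (profile I (fun _ => (w j).toNNReal) w) := by
  refine (h.isErm b).le_of_const (h.isErm _) ?_ (h.erm_pos _).le
  rw [Real.coe_toNNReal _ (h.pos j).le]
  exact h.erm_le_max b hj

lemma bddBelow_erm (h : Regular c I w) :
    BddBelow (Set.range fun b : {j // j ∈ I} → ℝ≥0 => erm c (profile I b w)) :=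
  ⟨0, by rintro _ ⟨b, rfl⟩; exact (h.erm_pos b).le⟩

lemma delta_le_one (h : Regular c I w) (b : {j // j ∈ I} → ℝ≥0) : delta (erm c) I b w ≤ 1 := by
  have h1 : 0 ≤ ⨅ b : {j // j ∈ I} → ℝ≥0, erm c (profile I b w) :=
    le_ciInf fun b => (h.erm_pos b).le
  have := div_nonneg h1 (h.erm_pos b).le
  unfold delta; linarith

lemma bddAbove_delta (h : Regular c I w) :
    BddAbove (Set.range fun b => delta (erm c) I b w) :=
  ⟨1, by rintro _ ⟨b, rfl⟩; exact h.delta_le_one b⟩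

lemma deltaWorst_le_one (h : Regular c I w) : deltaWorst (erm c) I w ≤ 1 :=
  ciSup_le fun b => h.delta_le_one b

lemma deltaWorst_nonneg (h : Regular c I w) : 0 ≤ deltaWorst (erm c) I w := by
  refine le_trans ?_ (le_ciSup h.bddAbove_delta (fun _ => 0))
  have h1 : (⨅ b : {j // j ∈ I} → ℝ≥0, erm c (profile I b w)) ≤ erm c (profile I (fun _ => 0) w) :=
    ciInf_le h.bddBelow_erm _
  have := div_le_one_of_le₀ h1 (h.erm_pos _).le
  simp only [delta]; linarith

lemma deltaWorst_le {η : ℝ} (h : Regular c I w)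
    (hη : ∀ b b', (1 - η) * erm c (profile I b w) ≤ erm c (profile I b' w)) :
    deltaWorst (erm c) I w ≤ η := by
  refine ciSup_le fun b => ?_
  have h1 : (1 - η) * erm c (profile I b w) ≤ ⨅ b' : {j // j ∈ I} → ℝ≥0, erm c (profile I b' w) :=
    le_ciInf fun b' => hη b b'
  have := (le_div_iff₀ (h.erm_pos b)).2 h1
  unfold delta; linarith

lemma deltaWorst_eq_zero (h : Regular c I w) (hI : I.card = 0) : deltaWorst (erm c) I w = 0 := by
  refine le_antisymm (h.deltaWorst_le fun b b' => ?_) h.deltaWorst_nonneg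
  have : IsEmpty {j // j ∈ I} := by
    rw [Finset.card_eq_zero] at hI; subst hI; exact ⟨fun j => Finset.notMem_empty _ j.2⟩
  rw [Subsingleton.elim b b']; simp

end Regular

/-- Countably many measurable bids that suffice to compute `deltaWorst`. -/
noncomputable def testBid (w : {j // j ∉ I} → ℝ) : {j // j ∉ I} ⊕ ℚ → ℝ≥0
  | Sum.inl j => (w j).toNNReal
  | Sum.inr q => (q : ℝ).toNNReal

lemma measurable_erm_testBid (c : ℝ) (β : {j // j ∉ I} ⊕ ℚ) :
    Measurable fun w : {j // j ∉ I} → ℝ => erm c (profile I (fun _ => testBid w β) w) := by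
  refine (measurable_erm c).comp (measurable_pi_lambda _ fun j => ?_)
  unfold profile
  split_ifs with h
  · cases β with
    | inl i => exact (measurable_pi_apply i).real_toNNReal.coe_nnreal_real
    | inr q => exact measurable_const
  · exact measurable_pi_apply _

namespace Regular

/-- Replace the bids by constant bids at the forced price. If this is an outside sample it is a test
bid; otherwise it can be pushed up to a rational below `s` and below the next outside sample. -/
lemma exists_testBid_lt (h : Regular c I w) (b : {j // j ∈ I} → ℝ≥0) {s : ℝ}
    (hs : erm c (profile I b w) < s) :
    ∃ β, erm c (profile I (fun _ => testBid w β) w) < s := by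
  have h1 := h.isErm b
  have hP0 := h.erm_pos b
  generalize erm c (profile I b w) = P at hs h1 hP0
  lift P to ℝ≥0 using hP0.le
  have h2 := isErm_const_self h1
  by_cases hex : ∃ j, w j = P
  · obtain ⟨j, hj⟩ := hex
    refine ⟨Sum.inl j, ?_⟩
    have : testBid w (Sum.inl j) = P := by simp [testBid, hj]
    rw [this, h.erm_eq h2]; exact hs
  · push Not at hex
    -- `u` is the smaller of `s` and the first outside sample above `P`.
    have hfin : ∃ u : ℝ, (P : ℝ) < u ∧ u ≤ s ∧ ∀ j, w j < P ∨ u ≤ w j := by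
      obtain ⟨u, hu, hmin⟩ := Finset.exists_min_image
        (insert s ((Finset.univ.image w).filter fun x => (P : ℝ) < x)) id ⟨s, by simp⟩
      refine ⟨u, ?_, hmin s (by simp), fun j => ?_⟩
      · simp only [Finset.mem_insert, Finset.mem_filter] at hu
        rcases hu with rfl | hu
        · exact hs
        · exact hu.2
      · rcases lt_or_gt_of_ne (hex j) with h3 | h3
        · exact Or.inl h3
        · exact Or.inr (hmin (w j) (by simp [h3]))
    obtain ⟨u, hu1, hu2, hu3⟩ := hfin
    obtain ⟨q, hq1, hq2⟩ := exists_rat_btwn hu1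
    have hq0 : (0 : ℝ) ≤ q := hP0.le.trans hq1.le
    refine ⟨Sum.inr q, ?_⟩
    have hq : ((testBid w (Sum.inr q) : ℝ≥0) : ℝ) = q := by simp [testBid, hq0]
    rw [h.erm_eq (isErm_const_of_gap (q := testBid w (Sum.inr q)) h.c_nonneg h2 ?_ ?_), hq]
    · linarith
    · rw [← NNReal.coe_lt_coe, hq]; exact hq1
    · intro j
      rw [hq]
      exact (hu3 j).imp id fun h4 => hq2.trans_le h4

/-- The supremum over `v_I` only concerns the denominator, which is largest when everyone in `I`
bids the maximal outside sample. Both extrema then run over a countable family of measurable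
functions of `w`, which is what makes `deltaWorst` almost everywhere measurable. -/
lemma deltaWorst_eq (h : Regular c I w) : deltaWorst (erm c) I w =
    1 - (⨅ β, erm c (profile I (fun _ => testBid w β) w)) /
      (⨆ β, erm c (profile I (fun _ => testBid w β) w)) := by
  obtain ⟨j, hj⟩ := h.exists_max
  have hbdd : BddAbove (Set.range fun β => erm c (profile I (fun _ => testBid w β) w)) :=
    ⟨w j, by rintro _ ⟨β, rfl⟩; exact h.erm_le_max _ hj⟩
  have hbelow : BddBelow (Set.range fun β => erm c (profile I (fun _ => testBid w β) w)) :=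
    ⟨0, by rintro _ ⟨β, rfl⟩; exact (h.erm_pos _).le⟩
  have hne : Nonempty ({j // j ∉ I} ⊕ ℚ) := ⟨Sum.inr 0⟩
  have hsup : (⨆ β, erm c (profile I (fun _ => testBid w β) w)) =
      erm c (profile I (fun _ => (w j).toNNReal) w) :=
    le_antisymm (ciSup_le fun β => h.erm_le_const_max _ hj) (le_ciSup hbdd (Sum.inl j))
  have hinf : (⨅ b : {j // j ∈ I} → ℝ≥0, erm c (profile I b w)) =
      ⨅ β, erm c (profile I (fun _ => testBid w β) w) := by
    refine le_antisymm (le_ciInf fun β => ciInf_le h.bddBelow_erm _) (le_ciInf fun b => ?_)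
    refine le_of_forall_gt fun s hs => ?_
    obtain ⟨β, hβ⟩ := h.exists_testBid_lt b hs
    exact lt_of_le_of_lt (ciInf_le hbelow β) hβ
  rw [hsup, ← hinf]
  refine le_antisymm (ciSup_le fun b => ?_) (le_ciSup h.bddAbove_delta (fun _ => (w j).toNNReal))
  unfold delta
  have h1 : 0 ≤ ⨅ b : {j // j ∈ I} → ℝ≥0, erm c (profile I b w) :=
    le_ciInf fun b => (h.erm_pos b).le
  have := div_le_div_of_nonneg_left h1 (h.erm_pos b) (h.erm_le_const_max b hj)
  linarith

end Regular

lemma integrable_deltaWorst (F : Measure ℝ) [IsProbabilityMeasure F]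
    (h : ∀ᵐ w ∂(lawOutside F I), Regular c I w) :
    Integrable (deltaWorst (erm c) I) (lawOutside F I) := by
  have hp : IsProbabilityMeasure (lawOutside F I) := by unfold lawOutside; infer_instance
  have hm : AEStronglyMeasurable (deltaWorst (erm c) I) (lawOutside F I) := by
    refine AEMeasurable.aestronglyMeasurable ⟨_, ?_, h.mono fun w hw => hw.deltaWorst_eq⟩
    exact measurable_const.sub ((Measurable.iInf fun β => measurable_erm_testBid c β).div
      (Measurable.iSup fun β => measurable_erm_testBid c β))
  refine Integrable.of_bound hm 1 (h.mono fun w hw => ?_)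
  rw [Real.norm_of_nonneg hw.deltaWorst_nonneg]
  exact hw.deltaWorst_le_one

namespace Regular

/-- The price `pr` stays admissible whatever is bid in `I`, so the chosen price must earn at least
as much, and bids in `I` add at most `I.card` sales to it. -/
lemma near_erm (h : Regular c I w) {pr : ℝ} (hM : ∀ p, p * cnt w p ≤ pr * cnt w pr)
    (hg : c * N < cnt w pr) (b : {j // j ∈ I} → ℝ≥0) :
    pr * cnt w pr ≤ erm c (profile I b w) * (cnt w (erm c (profile I b w)) + I.card) := by
  have hP0 := h.erm_pos b
  have hb : ∀ p, (cnt (fun j => (b j : ℝ)) p : ℝ) ≤ I.card := fun p => by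
    exact_mod_cast cnt_bids_le b p
  have h1 := (h.isErm b).max pr (by
    rw [cnt_profile, Nat.cast_add]
    linarith [Nat.cast_nonneg (α := ℝ) (cnt (fun j => (b j : ℝ)) pr)])
  have hcpos : 0 ≤ c * N := mul_nonneg h.c_nonneg (Nat.cast_nonneg _)
  have hpr : 0 ≤ pr := by
    have h2 := hM (erm c (profile I b w))
    have h3 : 0 ≤ erm c (profile I b w) * cnt w (erm c (profile I b w)) := by positivity
    by_contra hn
    push Not at hn
    have := mul_neg_of_neg_of_pos hn (hcpos.trans_lt hg)
    linarith
  rw [cnt_profile, cnt_profile, Nat.cast_add, Nat.cast_add] at h1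
  have h2 := mul_le_mul_of_nonneg_left (hb (erm c (profile I b w))) hP0.le
  have h3 := mul_nonneg hpr (Nat.cast_nonneg (α := ℝ) (cnt (fun j => (b j : ℝ)) pr))
  nlinarith

/-- With best count k and m = `I.card`, two forced prices P, P' satisfy P (k - d) ≤ M ≤ P' (k + d +
m) for the optimal revenue M, and (k - d)/(k + d + m) ≥ 1 - (2d + m)/k. -/
lemma deltaWorst_le_of_near (h : Regular c I w) {pr d : ℝ}
    (hM : ∀ p, p * cnt w p ≤ pr * cnt w pr) (hg : c * N < cnt w pr)
    (hd : ∀ p, 1 ≤ cnt w p → pr * cnt w pr ≤ p * (cnt w p + I.card) →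
      |(cnt w p : ℝ) - cnt w pr| ≤ d) :
    deltaWorst (erm c) I w ≤ (2 * d + I.card) / cnt w pr := by
  have hk0 : (0 : ℝ) < cnt w pr :=
    lt_of_le_of_lt (mul_nonneg h.c_nonneg (Nat.cast_nonneg _)) hg
  refine h.deltaWorst_le fun b b' => ?_
  have hP := h.erm_pos b
  have hP' := h.erm_pos b'
  have e1 := hM (erm c (profile I b w))
  have e2 := h.near_erm hM hg b
  have e2' := h.near_erm hM hg b'
  have e3 := hd _ (h.cnt_erm_pos b) e2
  have e3' := hd _ (h.cnt_erm_pos b') e2'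
  generalize erm c (profile I b w) = P at *
  generalize erm c (profile I b' w) = P' at *
  have hm : (0 : ℝ) ≤ I.card := Nat.cast_nonneg _
  generalize (I.card : ℝ) = m at *
  generalize (cnt w pr : ℝ) = k at *
  generalize (cnt w P : ℝ) = kP at *
  generalize (cnt w P' : ℝ) = kP' at *
  obtain ⟨e4, e5⟩ := abs_le.1 e3
  obtain ⟨e4', e5'⟩ := abs_le.1 e3'
  have hd0 : 0 ≤ d := by linarith
  have e6 : P * (k - d) ≤ P' * (k + d + m) := by nlinarith
  have e7 : (1 - (2 * d + m) / k) * P = (k - 2 * d - m) * P / k := by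
    field_simp; ring
  rw [e7, div_le_iff₀ hk0]
  rcases le_or_gt (k - 2 * d - m) 0 with h0 | h0
  · nlinarith [mul_nonneg (neg_nonneg.2 h0) hP.le, mul_pos hP' hk0]
  · have hkd : 0 < k - d := by linarith
    have e8 : (k - 2 * d - m) * (k + d + m) ≤ k * (k - d) := by
      nlinarith [mul_nonneg hd0 hd0, mul_nonneg hd0 hm, mul_nonneg hm hm]
    have e9 : (k - 2 * d - m) * P * (k - d) ≤ P' * k * (k - d) := by
      calc (k - 2 * d - m) * P * (k - d) = (k - 2 * d - m) * (P * (k - d)) := by ring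
        _ ≤ (k - 2 * d - m) * (P' * (k + d + m)) := mul_le_mul_of_nonneg_left e6 h0.le
        _ = P' * ((k - 2 * d - m) * (k + d + m)) := by ring
        _ ≤ P' * (k * (k - d)) := mul_le_mul_of_nonneg_left e8 hP'.le
        _ = P' * k * (k - d) := by ring
    exact le_of_mul_le_mul_right e9 hkd

end Regular

end profile

end IncentiveAwareness

namespace IncentiveAwareness

/-! ### Binomial coefficients: a window against the upper tail -/

section binomial

/-- The Chernoff bound for fair coins, from the moment generating function and cosh s ≤ exp(s²/2).
-/
lemma sum_choose_tail_le {L : ℕ} (hL : 0 < L) (l : ℝ) (hl : 0 ≤ l) :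
    ∑ k ∈ (Finset.range (L + 1)).filter (fun k : ℕ => (L : ℝ) / 2 + l * √L ≤ k),
      (L.choose k : ℝ) ≤ 2 ^ L * Real.exp (-2 * l ^ 2) := by
  have hLr : (0 : ℝ) < L := by exact_mod_cast hL
  have hsq : √(L : ℝ) ^ 2 = L := Real.sq_sqrt hLr.le
  have hs0 : 0 < √(L : ℝ) := Real.sqrt_pos.2 hLr
  -- The optimal exponent: the moment costs exp(2l²), while each term of the tail is weighted by at
  -- least exp(4l²).
  set s : ℝ := 2 * l / √L with hs
  have hsn : 0 ≤ s := by positivity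
  have h1 : ∑ k ∈ Finset.range (L + 1), (L.choose k : ℝ) * Real.exp (s * (2 * k - L)) =
      (2 * Real.cosh s) ^ L := by
    rw [Real.cosh_eq, mul_div_cancel₀ _ (two_ne_zero), add_pow]
    refine Finset.sum_congr rfl fun k hk => ?_
    have hk' : k ≤ L := by simpa [Nat.lt_succ_iff] using hk
    rw [← Real.exp_nat_mul, ← Real.exp_nat_mul, ← Real.exp_add, mul_comm]
    congr 2
    rw [Nat.cast_sub hk']; ring
  have h2 : (2 * Real.cosh s) ^ L ≤ 2 ^ L * Real.exp (2 * l ^ 2) := by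
    rw [mul_pow]
    refine mul_le_mul_of_nonneg_left ?_ (by positivity)
    calc Real.cosh s ^ L ≤ (Real.exp (s ^ 2 / 2)) ^ L :=
          pow_le_pow_left₀ (Real.cosh_pos s).le (Real.cosh_le_exp_half_sq s) L
      _ = Real.exp (2 * l ^ 2) := by
          rw [← Real.exp_nat_mul]; congr 1; rw [hs, div_pow, hsq]; field_simp
  have h3 : (∑ k ∈ (Finset.range (L + 1)).filter (fun k : ℕ => (L : ℝ) / 2 + l * √L ≤ k),
      (L.choose k : ℝ)) * Real.exp (4 * l ^ 2) ≤
      ∑ k ∈ Finset.range (L + 1), (L.choose k : ℝ) * Real.exp (s * (2 * k - L)) := by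
    rw [Finset.sum_mul]
    refine le_trans (Finset.sum_le_sum fun k hk => ?_)
      (Finset.sum_le_sum_of_subset_of_nonneg (Finset.filter_subset _ _) fun _ _ _ => by positivity)
    simp only [Finset.mem_filter] at hk
    refine mul_le_mul_of_nonneg_left (Real.exp_le_exp.2 ?_) (by positivity)
    calc 4 * l ^ 2 = s * (2 * (l * √L)) := by rw [hs]; field_simp; ring
      _ ≤ s * (2 * k - L) := mul_le_mul_of_nonneg_left (by linarith [hk.2]) hsn
  have h4 : 2 ^ L * Real.exp (-2 * l ^ 2) * Real.exp (4 * l ^ 2) =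
      2 ^ L * Real.exp (2 * l ^ 2) := by
    rw [mul_assoc, ← Real.exp_add]; congr 2; ring
  refine le_of_mul_le_mul_right ?_ (Real.exp_pos (4 * l ^ 2))
  rw [h4]
  linarith

lemma choose_step {L k : ℕ} {r : ℝ} (h : (1 - r) * (k + 1) ≤ (L : ℝ) - k) :
    (1 - r) * (L.choose k : ℝ) ≤ L.choose (k + 1) := by
  rcases le_or_gt k L with hk | hk
  · have h1 := Nat.choose_succ_right_eq L k
    have h2 : (L.choose (k + 1) : ℝ) * (k + 1) = L.choose k * (L - k) := by
      rw [← Nat.cast_sub hk]; exact_mod_cast h1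
    have h3 : (0 : ℝ) < k + 1 := by positivity
    refine le_of_mul_le_mul_right ?_ h3
    rw [h2]
    nlinarith [Nat.cast_nonneg (α := ℝ) (L.choose k)]
  · rw [Nat.choose_eq_zero_of_lt hk]; simp

/-- Within O(l √L) above the middle, consecutive coefficients shrink by a factor no worse than 1 -
8l/√L. So about √L/(18 l) coefficients after the k-th are at least half of it, and all of them
belong to the tail. -/
lemma choose_le_tail {L : ℕ} (hL : 0 < L) {l : ℝ} (hl : 1 ≤ l) {k : ℕ}
    (hk : (k : ℝ) ≤ L / 2 + l * √L) :
    √L * (L.choose k : ℝ) ≤ 36 * l * ∑ i ∈ Finset.Icc k L, (L.choose i : ℝ) := by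
  have hLr : (0 : ℝ) < L := by exact_mod_cast hL
  have hsq : √(L : ℝ) ^ 2 = L := Real.sq_sqrt hLr.le
  have hs0 : 0 < √(L : ℝ) := Real.sqrt_pos.2 hLr
  rcases le_or_gt k L with hkL | hkL
  swap
  · rw [Nat.choose_eq_zero_of_lt hkL]
    simp only [Nat.cast_zero, mul_zero]
    positivity
  have hself : (L.choose k : ℝ) ≤ ∑ i ∈ Finset.Icc k L, (L.choose i : ℝ) :=
    Finset.single_le_sum (f := fun i => (L.choose i : ℝ)) (fun _ _ => by positivity)
      (by simp [hkL])
  have hC : (0 : ℝ) ≤ L.choose k := by positivity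
  rcases le_or_gt (√(L : ℝ)) (36 * l) with hsmall | hbig
  · calc √L * (L.choose k : ℝ) ≤ 36 * l * L.choose k := mul_le_mul_of_nonneg_right hsmall hC
      _ ≤ _ := mul_le_mul_of_nonneg_left hself (by linarith)
  · set S := √(L : ℝ) with hS
    -- The run length: after `a` steps the accumulated loss is at most 8/18 < 1/2.
    set a : ℕ := ⌊S / (18 * l)⌋₊ with ha
    have hl0 : 0 < l := by linarith
    have ha1 : (a : ℝ) ≤ S / (18 * l) := Nat.floor_le (by positivity)
    have ha2 : S / (18 * l) < a + 1 := Nat.lt_floor_add_one _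
    have ha3 : (a : ℝ) * (18 * l) ≤ S := (le_div_iff₀ (by positivity)).1 ha1
    have ha4 : (a : ℝ) ≤ S / 18 := by
      have : (0 : ℝ) ≤ a := Nat.cast_nonneg _
      nlinarith
    have step : ∀ i : ℕ, i ≤ a → (1 - i * (8 * l / S)) * (L.choose k : ℝ) ≤ L.choose (k + i) := by
      intro i
      induction i with
      | zero => intro _; simp
      | succ i ih =>
        intro hi
        have hir : (i : ℝ) + 1 ≤ a := by exact_mod_cast hi
        have h1 := ih (by omega)
        have h2 : (1 - 8 * l / S) * (L.choose (k + i) : ℝ) ≤ L.choose (k + i + 1) := by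
          refine choose_step ?_
          push_cast
          have h3 : (k : ℝ) + i + 1 ≤ L / 2 + 2 * l * S := by nlinarith
          have h4 : 0 ≤ 1 - 8 * l / S := by
            rw [sub_nonneg, div_le_one hs0]; linarith
          have h5 : (1 - 8 * l / S) * (k + i + 1) ≤ (1 - 8 * l / S) * (L / 2 + 2 * l * S) :=
            mul_le_mul_of_nonneg_left h3 h4
          have h6 : (1 - 8 * l / S) * (L / 2 + 2 * l * S) = L / 2 - 2 * l * S - 16 * l ^ 2 := by
            rw [← hsq]; field_simp; ring
          nlinarith [sq_nonneg l]
        have h4 : 0 ≤ 1 - 8 * l / S := by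
          rw [sub_nonneg, div_le_one hs0]; linarith
        have h7 : (1 - ((i + 1 : ℕ) : ℝ) * (8 * l / S)) ≤
            (1 - 8 * l / S) * (1 - i * (8 * l / S)) := by
          push_cast
          have : 0 ≤ (i : ℝ) * (8 * l / S) ^ 2 := by positivity
          nlinarith
        calc (1 - ((i + 1 : ℕ) : ℝ) * (8 * l / S)) * (L.choose k : ℝ)
            ≤ (1 - 8 * l / S) * (1 - i * (8 * l / S)) * L.choose k :=
              mul_le_mul_of_nonneg_right h7 hC
          _ = (1 - 8 * l / S) * ((1 - i * (8 * l / S)) * L.choose k) := by ring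
          _ ≤ (1 - 8 * l / S) * L.choose (k + i) := mul_le_mul_of_nonneg_left h1 h4
          _ ≤ _ := h2
    have half : ∀ i : ℕ, i ≤ a → (1 / 2) * (L.choose k : ℝ) ≤ L.choose (k + i) := by
      intro i hi
      refine le_trans (mul_le_mul_of_nonneg_right ?_ hC) (step i hi)
      have hir : (i : ℝ) ≤ a := by exact_mod_cast hi
      have : (i : ℝ) * (8 * l / S) ≤ 1 / 2 := by
        rw [← mul_div_assoc, div_le_iff₀ hs0]
        nlinarith
      linarith
    have hsum : ((a : ℝ) + 1) * ((1 / 2) * (L.choose k : ℝ)) ≤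
        ∑ i ∈ Finset.Icc k L, (L.choose i : ℝ) := by
      calc ((a : ℝ) + 1) * ((1 / 2) * (L.choose k : ℝ))
          = ∑ i ∈ Finset.range (a + 1), (1 / 2) * (L.choose k : ℝ) := by simp
        _ ≤ ∑ i ∈ Finset.range (a + 1), (L.choose (k + i) : ℝ) :=
            Finset.sum_le_sum fun i hi => half i (by simpa [Nat.lt_succ_iff] using hi)
        _ = ∑ i ∈ Finset.Ico k (k + (a + 1)), (L.choose i : ℝ) := by
            rw [Finset.sum_Ico_eq_sum_range]; simp
        _ ≤ ∑ i ∈ Finset.Icc k L, (L.choose i : ℝ) := by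
            rw [← Finset.sum_filter_add_sum_filter_not (Finset.Ico k (k + (a + 1)))
              (fun i => i ≤ L)]
            rw [Finset.sum_eq_zero (s := (Finset.Ico k (k + (a + 1))).filter fun i => ¬ i ≤ L),
              add_zero]
            · refine Finset.sum_le_sum_of_subset_of_nonneg ?_ fun _ _ _ => by positivity
              intro i hi
              simp only [Finset.mem_filter, Finset.mem_Ico, Finset.mem_Icc] at hi ⊢
              omega
            · intro i hi
              simp only [Finset.mem_filter, not_le] at hi
              rw [Nat.choose_eq_zero_of_lt hi.2]; simp
    have h8 : S ≤ ((a : ℝ) + 1) * (18 * l) := ((div_lt_iff₀ (by positivity)).1 ha2).le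
    calc S * (L.choose k : ℝ) ≤ ((a : ℝ) + 1) * (18 * l) * L.choose k :=
          mul_le_mul_of_nonneg_right h8 hC
      _ = 36 * l * (((a : ℝ) + 1) * ((1 / 2) * (L.choose k : ℝ))) := by ring
      _ ≤ _ := mul_le_mul_of_nonneg_left hsum (by linarith)

/-- A window of `t + 1` consecutive binomial coefficients starting at `κ` is small compared with
the whole upper tail starting at `κ`. -/
lemma sum_choose_window_le {L : ℕ} (hL : 0 < L) {l : ℝ} (hl : 1 ≤ l) (κ t : ℕ) :
    ∑ k ∈ (Finset.Icc κ L).filter (· ≤ κ + t), (L.choose k : ℝ) ≤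
      (t + 1) * (36 * l / √L) * ∑ i ∈ Finset.Icc κ L, (L.choose i : ℝ) +
        2 ^ L * Real.exp (-2 * l ^ 2) := by
  have hLr : (0 : ℝ) < L := by exact_mod_cast hL
  have hs0 : 0 < √(L : ℝ) := Real.sqrt_pos.2 hLr
  rw [← Finset.sum_filter_add_sum_filter_not _ (fun k : ℕ => (k : ℝ) ≤ L / 2 + l * √L)]
  refine add_le_add ?_ ?_
  · have hcard : ((((Finset.Icc κ L).filter (· ≤ κ + t)).filter
        (fun k : ℕ => (k : ℝ) ≤ L / 2 + l * √L)).card : ℝ) ≤ t + 1 := by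
      have : (((Finset.Icc κ L).filter (· ≤ κ + t)).filter
        (fun k : ℕ => (k : ℝ) ≤ L / 2 + l * √L)) ⊆ Finset.Icc κ (κ + t) := by
        intro i hi
        simp only [Finset.mem_filter, Finset.mem_Icc] at hi ⊢
        omega
      have h2 := Finset.card_le_card this
      rw [Nat.card_Icc] at h2
      have h3 : κ + t + 1 - κ = t + 1 := by omega
      rw [h3] at h2
      exact_mod_cast h2
    refine (Finset.sum_le_card_nsmul _ _
      (36 * l / √L * ∑ i ∈ Finset.Icc κ L, (L.choose i : ℝ)) ?_).trans ?_
    · intro k hk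
      simp only [Finset.mem_filter, Finset.mem_Icc] at hk
      have h1 := choose_le_tail hL hl hk.2
      have h2 : ∑ i ∈ Finset.Icc k L, (L.choose i : ℝ) ≤
          ∑ i ∈ Finset.Icc κ L, (L.choose i : ℝ) :=
        Finset.sum_le_sum_of_subset_of_nonneg (Finset.Icc_subset_Icc_left hk.1.1.1)
          fun _ _ _ => by positivity
      rw [div_mul_eq_mul_div, le_div_iff₀ hs0, mul_comm]
      exact h1.trans (mul_le_mul_of_nonneg_left h2 (by linarith))
    · rw [nsmul_eq_mul, mul_assoc]
      exact mul_le_mul_of_nonneg_right hcard (by positivity)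
  · refine le_trans ?_ (sum_choose_tail_le hL l (by linarith))
    refine Finset.sum_le_sum_of_subset_of_nonneg ?_ fun _ _ _ => by positivity
    intro k hk
    simp only [Finset.mem_filter, Finset.mem_Icc, not_le, Finset.mem_range] at hk ⊢
    exact ⟨by omega, hk.2.le⟩

end binomial

/-! ### Anti-concentration for monotone events in fair coins -/

section coins
lemma card_powerset_filter_card {ι : Type*} (J : Finset ι) (p : ℕ → Prop) [DecidablePred p] :
    ((J.powerset.filter fun b => p b.card).card : ℝ) =
      ∑ k ∈ (Finset.range (J.card + 1)).filter p, (J.card.choose k : ℝ) := by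
  rw [Finset.card_eq_sum_card_fiberwise (f := Finset.card)
    (t := (Finset.range (J.card + 1)).filter p)]
  · push_cast
    refine Finset.sum_congr rfl fun k hk => ?_
    congr 1
    rw [← Finset.card_powersetCard]
    congr 1
    ext b
    simp only [Finset.mem_filter, Finset.mem_powerset, Finset.mem_powersetCard] at hk ⊢
    constructor
    · rintro ⟨⟨h1, -⟩, h3⟩; exact ⟨h1, h3⟩
    · rintro ⟨h1, h2⟩; exact ⟨⟨h1, h2 ▸ hk.2⟩, h2⟩
  · intro b hb
    simp only [Finset.coe_filter, Finset.mem_powerset, Set.mem_ofPred_eq, Finset.mem_range] at hb ⊢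
    exact ⟨Nat.lt_succ_of_le (Finset.card_le_card hb.1), hb.2⟩

variable {ι : Type*} [Fintype ι] [DecidableEq ι]

/-- Anti-concentration for fair coins: if `R` only gets easier as more coins of `J` show up, and
`T` forces the number of such coins to be within `t` of the threshold of `R`, then `T` is much
rarer than `R`. -/
lemma card_coins_le (J : Finset ι) (hJ : J.Nonempty) {l : ℝ} (hl : 1 ≤ l) (t : ℕ)
    (R T : Finset ι → Prop) [DecidablePred R] [DecidablePred T] (hTR : ∀ s, T s → R s)
    (hup : ∀ s s', s \ J = s' \ J → (s ∩ J).card ≤ (s' ∩ J).card → R s → R s')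
    (hwin : ∀ s s', s \ J = s' \ J → (s ∩ J).card ≤ (s' ∩ J).card → R s → T s' →
      (s' ∩ J).card ≤ (s ∩ J).card + t) :
    ((Finset.univ.filter T).card : ℝ) ≤
      (t + 1) * (36 * l / √J.card) * (Finset.univ.filter R).card +
        2 ^ (Fintype.card ι) * Real.exp (-2 * l ^ 2) := by
  have hL : 0 < J.card := hJ.card_pos
  have fib : ∀ (Q : Finset ι → Prop) [DecidablePred Q], ((Finset.univ.filter Q).card : ℝ) =
      ∑ a ∈ Jᶜ.powerset, ((J.powerset.filter fun b => Q (a ∪ b)).card : ℝ) := by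
    intro Q _
    rw [Finset.card_eq_sum_card_fiberwise (f := fun s => s \ J) (t := Jᶜ.powerset)]
    · push_cast
      refine Finset.sum_congr rfl fun a ha => ?_
      congr 1
      rw [Finset.mem_powerset] at ha
      have hdisj : Disjoint a J := by
        rw [Finset.disjoint_left]; intro x hx hxJ
        exact (Finset.mem_compl.1 (ha hx)) hxJ
      refine Finset.card_bij (fun s _ => s ∩ J) ?_ ?_ ?_
      · intro s hs
        simp only [Finset.mem_filter, Finset.mem_univ, true_and, Finset.mem_powerset] at hs ⊢
        refine ⟨Finset.inter_subset_right, ?_⟩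
        rw [← hs.2, Finset.sdiff_union_inter]; exact hs.1
      · intro s hs s' hs' he
        simp only [Finset.mem_filter, Finset.mem_univ, true_and] at hs hs'
        rw [← Finset.sdiff_union_inter s J, ← Finset.sdiff_union_inter s' J, hs.2, hs'.2, he]
      · intro b hb
        simp only [Finset.mem_filter, Finset.mem_powerset] at hb
        refine ⟨a ∪ b, ?_, ?_⟩
        · simp only [Finset.mem_filter, Finset.mem_univ, true_and]
          refine ⟨hb.2, ?_⟩
          rw [Finset.union_sdiff_distrib, Finset.sdiff_eq_self_of_disjoint hdisj,
            Finset.sdiff_eq_empty_iff_subset.2 hb.1, Finset.union_empty]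
        · rw [Finset.union_inter_distrib_right, Finset.disjoint_iff_inter_eq_empty.1 hdisj,
            Finset.inter_eq_left.2 hb.1, Finset.empty_union]
    · intro s _
      simp only [Finset.coe_powerset, Set.mem_preimage, Set.mem_powerset_iff, Finset.coe_subset]
      intro x hx
      simp only [Finset.mem_sdiff] at hx
      simpa using hx.2
  rw [fib T, fib R]
  have hpow : (2 : ℝ) ^ (Fintype.card ι) = ∑ a ∈ Jᶜ.powerset, (2 : ℝ) ^ J.card := by
    rw [Finset.sum_const, nsmul_eq_mul, Finset.card_powerset, Finset.card_compl]
    push_cast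
    rw [← pow_add, Nat.sub_add_cancel (Finset.card_le_univ _)]
  rw [hpow, Finset.mul_sum, Finset.sum_mul, ← Finset.sum_add_distrib]
  refine Finset.sum_le_sum fun a ha => ?_
  rw [Finset.mem_powerset] at ha
  have hdisj : Disjoint a J := by
    rw [Finset.disjoint_left]; intro x hx hxJ
    exact (Finset.mem_compl.1 (ha hx)) hxJ
  have e1 : ∀ b ⊆ J, (a ∪ b) \ J = a := fun b hb => by
    rw [Finset.union_sdiff_distrib, Finset.sdiff_eq_self_of_disjoint hdisj,
      Finset.sdiff_eq_empty_iff_subset.2 hb, Finset.union_empty]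
  have e2 : ∀ b ⊆ J, (a ∪ b) ∩ J = b := fun b hb => by
    rw [Finset.union_inter_distrib_right, Finset.disjoint_iff_inter_eq_empty.1 hdisj,
      Finset.inter_eq_left.2 hb, Finset.empty_union]
  -- With the coins outside `J` frozen as `a`, the event `R` depends only on the number of coins in
  -- `J` and is an upper set in it. A configuration `b0` of least cardinality gives the threshold at
  -- which both the tail and the window start.
  by_cases hne : (J.powerset.filter fun b => R (a ∪ b)).Nonempty
  · obtain ⟨b0, hb0, hmin⟩ := Finset.exists_min_image _ Finset.card hne
    simp only [Finset.mem_filter, Finset.mem_powerset] at hb0 hmin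
    have hIcc : (Finset.range (J.card + 1)).filter (fun k => b0.card ≤ k) =
        Finset.Icc b0.card J.card := by
      ext k; simp only [Finset.mem_filter, Finset.mem_range, Finset.mem_Icc]; omega
    have hIcc' : (Finset.range (J.card + 1)).filter (fun k => b0.card ≤ k ∧ k ≤ b0.card + t) =
        (Finset.Icc b0.card J.card).filter (· ≤ b0.card + t) := by
      ext k; simp only [Finset.mem_filter, Finset.mem_range, Finset.mem_Icc]; omega
    have hR : (J.powerset.filter fun b => b0.card ≤ b.card) ⊆
        (J.powerset.filter fun b => R (a ∪ b)) := by
      intro b hb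
      simp only [Finset.mem_filter, Finset.mem_powerset] at hb ⊢
      refine ⟨hb.1, hup (a ∪ b0) (a ∪ b) ?_ ?_ hb0.2⟩
      · rw [e1 _ hb0.1, e1 _ hb.1]
      · rw [e2 _ hb0.1, e2 _ hb.1]; exact hb.2
    have hT : (J.powerset.filter fun b => T (a ∪ b)) ⊆
        (J.powerset.filter fun b => b0.card ≤ b.card ∧ b.card ≤ b0.card + t) := by
      intro b hb
      simp only [Finset.mem_filter, Finset.mem_powerset] at hb ⊢
      have h1 := hmin b ⟨hb.1, hTR _ hb.2⟩
      refine ⟨hb.1, h1, ?_⟩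
      have h2 := hwin (a ∪ b0) (a ∪ b) (by rw [e1 _ hb0.1, e1 _ hb.1])
        (by rw [e2 _ hb0.1, e2 _ hb.1]; exact h1) hb0.2 hb.2
      rwa [e2 _ hb0.1, e2 _ hb.1] at h2
    have c1 : ((J.powerset.filter fun b => T (a ∪ b)).card : ℝ) ≤
        ∑ k ∈ (Finset.Icc b0.card J.card).filter (· ≤ b0.card + t), (J.card.choose k : ℝ) := by
      rw [← hIcc', ← card_powerset_filter_card J (fun k => b0.card ≤ k ∧ k ≤ b0.card + t)]
      exact_mod_cast Finset.card_le_card hT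
    have c2 : ∑ k ∈ Finset.Icc b0.card J.card, (J.card.choose k : ℝ) ≤
        ((J.powerset.filter fun b => R (a ∪ b)).card : ℝ) := by
      rw [← hIcc, ← card_powerset_filter_card J (fun k => b0.card ≤ k)]
      exact_mod_cast Finset.card_le_card hR
    refine c1.trans ((sum_choose_window_le hL hl b0.card t).trans ?_)
    gcongr
  · have : (J.powerset.filter fun b => T (a ∪ b)) = ∅ := by
      rw [Finset.filter_eq_empty_iff]
      intro b hb hTb
      exact hne ⟨b, by simp only [Finset.mem_filter]; exact ⟨hb, hTR _ hTb⟩⟩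
    rw [this]
    simp only [Finset.card_empty, Nat.cast_zero]
    positivity

end coins

end IncentiveAwareness

namespace IncentiveAwareness

/-! ### Counts of i.i.d. samples, and resampling by pairs and coins -/

section iid
variable {ι α : Type*} [Fintype ι]

open Classical in
/-- The number of coordinates of `z` that lie in `S`. -/
noncomputable def cntIn (S : Set α) (z : ι → α) : ℕ := (Finset.univ.filter fun i => z i ∈ S).card

open Classical in
lemma cntIn_eq_sum (S : Set α) (z : ι → α) : cntIn S z = ∑ i, if z i ∈ S then 1 else 0 := by
  rw [cntIn, Finset.card_filter]

lemma cntIn_eq_zero {S : Set α} {z : ι → α} (h : ∀ i, z i ∉ S) : cntIn S z = 0 := by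
  classical
  simp [cntIn_eq_sum, h]

variable [MeasurableSpace α]

lemma measurable_cntIn {S : Set α} (hS : MeasurableSet S) :
    Measurable fun z : ι → α => cntIn S z := by
  classical
  simp only [cntIn_eq_sum]
  exact Finset.measurable_sum _ fun j _ =>
    Measurable.ite (measurable_pi_apply j hS) measurable_const measurable_const

variable (ν : Measure α) [IsProbabilityMeasure ν]

lemma integral_pow_cntIn {S : Set α} (hS : MeasurableSet S) (r : ℝ) :
    ∫ z : ι → α, r ^ cntIn S z ∂(Measure.pi fun _ => ν) =
      (1 + ν.real S * (r - 1)) ^ Fintype.card ι := by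
  classical
  have h1 : ∀ z : ι → α, r ^ cntIn S z = ∏ i, (1 + S.indicator (fun _ => r - 1) (z i)) := by
    intro z
    rw [cntIn_eq_sum, ← Finset.prod_pow_eq_pow_sum]
    refine Finset.prod_congr rfl fun i _ => ?_
    by_cases h : z i ∈ S <;> simp [h]
  simp only [h1]
  rw [integral_fintype_prod_eq_pow (ι := ι) (fun x => 1 + S.indicator (fun _ => r - 1) x),
    integral_add (integrable_const _) ((integrable_const _).indicator hS),
    integral_indicator_const _ hS]
  simp

lemma integrable_pow_cntIn {S : Set α} (hS : MeasurableSet S) {r : ℝ} (hr : 0 ≤ r) :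
    Integrable (fun z : ι → α => r ^ cntIn S z) (Measure.pi fun _ => ν) := by
  refine Integrable.of_bound (C := (max 1 r) ^ Fintype.card ι) ?_ (ae_of_all _ fun z => ?_)
  · exact (Measurable.of_discrete (f := fun k : ℕ => r ^ k)).comp
      (measurable_cntIn hS) |>.aestronglyMeasurable
  · rw [Real.norm_of_nonneg (by positivity)]
    calc r ^ cntIn S z ≤ (max 1 r) ^ cntIn S z := pow_le_pow_left₀ hr (le_max_right _ _) _
      _ ≤ _ := pow_le_pow_right₀ (le_max_left _ _) (Finset.card_le_univ _)

/-- Markov's inequality for 2 to the power of the count, whose mean is at most exp(np); the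
threshold 2^(3np) exceeds exp(2np) because 3 log 2 > 2. -/
lemma real_cntIn_ge_le {S : Set α} (hS : MeasurableSet S) {p : ℝ} (hp : ν.real S ≤ p) :
    (Measure.pi fun _ : ι => ν).real {z | 3 * (Fintype.card ι * p) ≤ cntIn S z} ≤
      Real.exp (-(Fintype.card ι * p)) := by
  set n : ℝ := (Fintype.card ι : ℝ) with hn
  have hp0 : 0 ≤ p := measureReal_nonneg.trans hp
  have h1 := mul_meas_ge_le_integral_of_nonneg (μ := Measure.pi fun _ : ι => ν)
    (f := fun z : ι → α => (2 : ℝ) ^ cntIn S z) (ae_of_all _ fun z => by positivity)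
    (integrable_pow_cntIn ν hS zero_le_two) ((2 : ℝ) ^ (3 * (n * p)))
  rw [integral_pow_cntIn ν hS] at h1
  have h2 : {z : ι → α | 3 * (n * p) ≤ cntIn S z} =
      {z | (2 : ℝ) ^ (3 * (n * p)) ≤ (2 : ℝ) ^ cntIn S z} := by
    ext z
    simp only [Set.mem_ofPred_eq]
    rw [← Real.rpow_natCast, Real.rpow_le_rpow_left_iff (by norm_num)]
  rw [h2]
  have h3 : (1 + ν.real S * ((2 : ℝ) - 1)) ^ Fintype.card ι ≤ Real.exp (n * p) := by
    calc (1 + ν.real S * ((2 : ℝ) - 1)) ^ Fintype.card ι ≤ (Real.exp p) ^ Fintype.card ι := by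
          refine pow_le_pow_left₀ (by nlinarith [measureReal_nonneg (μ := ν) (s := S)]) ?_ _
          linarith [Real.add_one_le_exp p]
      _ = _ := by rw [← Real.exp_nat_mul]
  have h4 : Real.exp (2 * (n * p)) ≤ (2 : ℝ) ^ (3 * (n * p)) := by
    rw [Real.rpow_def_of_pos (by norm_num)]
    refine Real.exp_le_exp.2 ?_
    have := Real.log_two_gt_d9
    nlinarith [mul_nonneg (Nat.cast_nonneg (α := ℝ) (Fintype.card ι)) hp0]
  have h5 : Real.exp (2 * (n * p)) * (Measure.pi fun _ : ι => ν).real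
      {z | (2 : ℝ) ^ (3 * (n * p)) ≤ (2 : ℝ) ^ cntIn S z} ≤ Real.exp (n * p) :=
    (mul_le_mul_of_nonneg_right h4 measureReal_nonneg).trans (h1.trans h3)
  refine le_of_mul_le_mul_left (h5.trans_eq ?_) (Real.exp_pos (2 * (n * p)))
  rw [← Real.exp_add]; congr 1; ring

/-- The same argument with base 1/2: the mean is at most exp(-np/2), and the threshold 2^(-np/4) is
at least exp(-np/4). -/
lemma real_cntIn_le_le {S : Set α} (hS : MeasurableSet S) {p : ℝ} (hp0 : 0 ≤ p)
    (hp : p ≤ ν.real S) :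
    (Measure.pi fun _ : ι => ν).real {z | (cntIn S z : ℝ) ≤ Fintype.card ι * p / 4} ≤
      Real.exp (-(Fintype.card ι * p / 4)) := by
  set n : ℝ := (Fintype.card ι : ℝ) with hn
  have hS1 : ν.real S ≤ 1 := measureReal_le_one
  have h1 := mul_meas_ge_le_integral_of_nonneg (μ := Measure.pi fun _ : ι => ν)
    (f := fun z : ι → α => (2⁻¹ : ℝ) ^ cntIn S z) (ae_of_all _ fun z => by positivity)
    (integrable_pow_cntIn ν hS (by norm_num)) ((2⁻¹ : ℝ) ^ (n * p / 4))
  rw [integral_pow_cntIn ν hS] at h1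
  have h2 : {z : ι → α | (cntIn S z : ℝ) ≤ n * p / 4} =
      {z | (2⁻¹ : ℝ) ^ (n * p / 4) ≤ (2⁻¹ : ℝ) ^ cntIn S z} := by
    ext z
    simp only [Set.mem_ofPred_eq]
    rw [← Real.rpow_natCast, Real.rpow_le_rpow_left_iff_of_base_lt_one (by norm_num) (by norm_num)]
  rw [h2]
  have h3 : (1 + ν.real S * ((2⁻¹ : ℝ) - 1)) ^ Fintype.card ι ≤ Real.exp (-(n * p / 2)) := by
    calc (1 + ν.real S * ((2⁻¹ : ℝ) - 1)) ^ Fintype.card ι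
        ≤ (Real.exp (-(p / 2))) ^ Fintype.card ι := by
          refine pow_le_pow_left₀ (by linarith) ?_ _
          linarith [Real.add_one_le_exp (-(p / 2))]
      _ = _ := by rw [← Real.exp_nat_mul]; congr 1; ring
  have h4 : Real.exp (-(n * p / 4)) ≤ (2⁻¹ : ℝ) ^ (n * p / 4) := by
    rw [Real.rpow_def_of_pos (by norm_num), Real.log_inv]
    refine Real.exp_le_exp.2 ?_
    have := Real.log_two_lt_d9
    nlinarith [mul_nonneg (Nat.cast_nonneg (α := ℝ) (Fintype.card ι)) hp0]
  have h5 : Real.exp (-(n * p / 4)) * (Measure.pi fun _ : ι => ν).real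
      {z | (2⁻¹ : ℝ) ^ (n * p / 4) ≤ (2⁻¹ : ℝ) ^ cntIn S z} ≤ Real.exp (-(n * p / 2)) :=
    (mul_le_mul_of_nonneg_right h4 measureReal_nonneg).trans (h1.trans h3)
  refine le_of_mul_le_mul_left (h5.trans_eq ?_) (Real.exp_pos (-(n * p / 4)))
  rw [← Real.exp_add]; congr 1; ring

variable [DecidableEq ι]

/-- Select the first components of the pairs with index in `s`, the second components elsewhere. -/
def sel (s : Finset ι) (z : ι → α × α) : ι → α := fun i => if i ∈ s then (z i).1 else (z i).2

/-- For every fixed outcome of the coins the selected sample is again i.i.d. Averaging over all `s`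
therefore turns coin counts, with the pairs held fixed, into probabilities for the original sample.
-/
lemma measurePreserving_sel (s : Finset ι) : MeasurePreserving (sel s)
    (Measure.pi fun _ : ι => ν.prod ν) (Measure.pi fun _ : ι => ν) := by
  have := measurePreserving_pi (fun _ : ι => ν.prod ν) (fun _ : ι => ν)
    (f := fun i x => if i ∈ s then x.1 else x.2) (fun i => by
      by_cases h : i ∈ s
      · simp only [h, if_true]; exact measurePreserving_fst
      · simp only [h, if_false]; exact measurePreserving_snd)
  exact this

open Classical in
lemma integral_card_sel {A : Set (ι → α)} (hA : MeasurableSet A) :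
    Integrable (fun z => ((Finset.univ.filter fun s => sel s z ∈ A).card : ℝ))
      (Measure.pi fun _ : ι => ν.prod ν) ∧
    ∫ z, ((Finset.univ.filter fun s => sel s z ∈ A).card : ℝ)
      ∂(Measure.pi fun _ : ι => ν.prod ν) =
      2 ^ Fintype.card ι * (Measure.pi fun _ : ι => ν).real A := by
  have h1 : ∀ z : ι → α × α, ((Finset.univ.filter fun s => sel s z ∈ A).card : ℝ) =
      ∑ s : Finset ι, (sel s ⁻¹' A).indicator (fun _ => (1 : ℝ)) z := by
    intro z
    rw [Finset.card_filter]
    push_cast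
    refine Finset.sum_congr rfl fun s _ => ?_
    simp [Set.indicator_apply]
  have hms : ∀ s : Finset ι, MeasurableSet (sel s ⁻¹' A : Set (ι → α × α)) := fun s =>
    (measurePreserving_sel ν s).measurable hA
  simp only [h1]
  refine ⟨integrable_finsetSum _ fun s _ => (integrable_const _).indicator (hms s), ?_⟩
  rw [integral_finsetSum _ fun s _ => (integrable_const _).indicator (hms s)]
  simp only [integral_indicator_const _ (hms _), smul_eq_mul, mul_one, measureReal_def,
    (measurePreserving_sel ν _).measure_preimage hA.nullMeasurableSet]
  simp

open Classical in
-- Integrates a coin inequality valid for every pair configuration outside `B`; on `B` the trivial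
-- bound by the number of all coin outcomes is used.
lemma real_le_of_card_sel {T R : Set (ι → α)} (hT : MeasurableSet T) (hR : MeasurableSet R)
    {B : Set (ι → α × α)} (hB : MeasurableSet B) {h e : ℝ} (h0 : 0 ≤ h) (e0 : 0 ≤ e)
    (hz : ∀ z ∉ B, ((Finset.univ.filter fun s => sel s z ∈ T).card : ℝ) ≤
      h * (Finset.univ.filter fun s => sel s z ∈ R).card + 2 ^ Fintype.card ι * e) :
    (Measure.pi fun _ : ι => ν).real T ≤ h * (Measure.pi fun _ : ι => ν).real R + e +
      (Measure.pi fun _ : ι => ν.prod ν).real B := by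
  obtain ⟨iT, eT⟩ := integral_card_sel ν hT
  obtain ⟨iR, eR⟩ := integral_card_sel ν hR
  have hle : ∀ z : ι → α × α, ((Finset.univ.filter fun s => sel s z ∈ T).card : ℝ) ≤
      h * (Finset.univ.filter fun s => sel s z ∈ R).card + 2 ^ Fintype.card ι * e +
        B.indicator (fun _ => (2 : ℝ) ^ Fintype.card ι) z := by
    intro z
    by_cases hzB : z ∈ B
    · rw [Set.indicator_of_mem hzB]
      have h1 : ((Finset.univ.filter fun s => sel s z ∈ T).card : ℝ) ≤ 2 ^ Fintype.card ι := by
        have := Finset.card_le_univ (Finset.univ.filter fun s => sel s z ∈ T)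
        rw [Fintype.card_finset] at this
        exact_mod_cast this
      have h2 : 0 ≤ h * ((Finset.univ.filter fun s => sel s z ∈ R).card : ℝ) +
        2 ^ Fintype.card ι * e := by positivity
      linarith
    · rw [Set.indicator_of_notMem hzB, add_zero]; exact hz z hzB
  have i1 : Integrable (fun z : ι → α × α =>
      h * ((Finset.univ.filter fun s => sel s z ∈ R).card : ℝ) + 2 ^ Fintype.card ι * e)
      (Measure.pi fun _ : ι => ν.prod ν) := (iR.const_mul h).add (integrable_const _)
  have i2 : Integrable (B.indicator fun _ => (2 : ℝ) ^ Fintype.card ι)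
      (Measure.pi fun _ : ι => ν.prod ν) := (integrable_const _).indicator hB
  have hint := integral_mono iT (i1.add i2) hle
  have e1 : ∫ z, ((fun z : ι → α × α =>
      h * ((Finset.univ.filter fun s => sel s z ∈ R).card : ℝ) + 2 ^ Fintype.card ι * e) +
      (B.indicator fun _ => (2 : ℝ) ^ Fintype.card ι)) z ∂(Measure.pi fun _ : ι => ν.prod ν) =
      2 ^ Fintype.card ι * (h * (Measure.pi fun _ : ι => ν).real R + e +
        (Measure.pi fun _ : ι => ν.prod ν).real B) := by
    rw [integral_add' i1 i2, integral_add (iR.const_mul h) (integrable_const _),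
      integral_const_mul, eR, integral_indicator_const _ hB]
    simp only [integral_const, probReal_univ, smul_eq_mul]
    ring
  rw [eT, e1] at hint
  exact le_of_mul_le_mul_left hint (by positivity)

end iid

end IncentiveAwareness

/-! ### Blocks of quantiles, ranks and near ties -/

namespace IncentiveAwareness

/-- The index of the block `[j / K, (j + 1) / K)` that contains `q`. -/
noncomputable def blk (K : ℕ) (q : ℝ) : ℕ := ⌊(K : ℝ) * q⌋₊

lemma blk_mono (K : ℕ) : Monotone (blk K) := fun _ _ h =>
  Nat.floor_mono (mul_le_mul_of_nonneg_left h (Nat.cast_nonneg K))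

lemma lt_of_blk_lt {K : ℕ} {p q : ℝ} (h : blk K p < blk K q) : p < q := by
  by_contra hn
  exact absurd (blk_mono K (not_lt.1 hn)) (not_le.2 h)

lemma measurable_blk (K : ℕ) : Measurable (blk K) :=
  Nat.measurable_floor.comp (measurable_const_mul _)

section ranks
variable {ι : Type*} [Fintype ι]

/-- The rank of the `i`-th coordinate, counted from below. -/
noncomputable def rk (Q : ι → ℝ) (i : ι) : ℕ := (Finset.univ.filter fun i' => Q i' ≤ Q i).card

/-- The revenue of the `i`-th sample, the samples being `V ∘ Q`. -/
noncomputable def rev (V : ℝ → ℝ) (Q : ι → ℝ) (i : ι) : ℝ := V (Q i) * rk Q i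

lemma rk_le_card (Q : ι → ℝ) (i : ι) : rk Q i ≤ Fintype.card ι := Finset.card_le_univ _

lemma rk_pos (Q : ι → ℝ) (i : ι) : 0 < rk Q i :=
  Finset.card_pos.2 ⟨i, by simp⟩

lemma measurable_rk (i : ι) : Measurable fun Q : ι → ℝ => rk Q i := by
  simp only [rk, Finset.card_filter]
  exact Finset.measurable_sum _ fun j _ =>
    Measurable.ite (measurableSet_le (measurable_pi_apply j) (measurable_pi_apply i))
      measurable_const measurable_const

lemma measurable_rev {V : ℝ → ℝ} (hV : Measurable V) (i : ι) :
    Measurable fun Q : ι → ℝ => rev V Q i :=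
  (hV.comp (measurable_pi_apply i)).mul
    ((Measurable.of_discrete (f := fun k : ℕ => (k : ℝ))).comp (measurable_rk i))

/-- Some sample in the blocks `H` does at least as well as all samples in the blocks `O₁` and
strictly better than those in `O₂`. -/
def dominates (V : ℝ → ℝ) (K : ℕ) (H O₁ O₂ : Set ℕ) : Set (ι → ℝ) :=
  {Q | ∃ i, blk K (Q i) ∈ H ∧ (∀ i', blk K (Q i') ∈ O₁ → rev V Q i' ≤ rev V Q i) ∧
    ∀ i', blk K (Q i') ∈ O₂ → rev V Q i' < rev V Q i}

/-- As `dominates`, but some sample in `O₁ ∪ O₂` with revenue at least `A` is within `B` of all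
samples in `H`. -/
def nearlyTied (V : ℝ → ℝ) (K : ℕ) (H O₁ O₂ : Set ℕ) (A B : ℝ) : Set (ι → ℝ) :=
  {Q | Q ∈ dominates V K H O₁ O₂ ∧ ∃ i', blk K (Q i') ∈ O₁ ∪ O₂ ∧ A ≤ rev V Q i' ∧
    ∀ i, blk K (Q i) ∈ H → rev V Q i ≤ rev V Q i' + B}

lemma measurableSet_blk_mem {ι : Type*} (K : ℕ) (H : Set ℕ) (i : ι) :
    MeasurableSet {Q : ι → ℝ | blk K (Q i) ∈ H} :=
  ((measurable_blk K).comp (measurable_pi_apply i)) (MeasurableSet.of_discrete (s := H))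

lemma measurableSet_dominates {V : ℝ → ℝ} (hV : Measurable V) (K : ℕ) (H O₁ O₂ : Set ℕ) :
    MeasurableSet (dominates V K H O₁ O₂ : Set (ι → ℝ)) := by
  have : (dominates V K H O₁ O₂ : Set (ι → ℝ)) = ⋃ i, ({Q | blk K (Q i) ∈ H} ∩
      ((⋂ i', ({Q | blk K (Q i') ∈ O₁}ᶜ ∪ {Q | rev V Q i' ≤ rev V Q i})) ∩
      ⋂ i', ({Q | blk K (Q i') ∈ O₂}ᶜ ∪ {Q | rev V Q i' < rev V Q i}))) := by
    ext Q
    simp only [dominates, Set.mem_ofPred_eq, Set.mem_iUnion, Set.mem_inter_iff, Set.mem_iInter,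
      Set.mem_union, Set.mem_compl_iff, imp_iff_not_or]
  rw [this]
  refine MeasurableSet.iUnion fun i => (measurableSet_blk_mem K H i).inter
    (MeasurableSet.inter ?_ ?_)
  · exact MeasurableSet.iInter fun i' => (measurableSet_blk_mem K O₁ i').compl.union
      (measurableSet_le (measurable_rev hV i') (measurable_rev hV i))
  · exact MeasurableSet.iInter fun i' => (measurableSet_blk_mem K O₂ i').compl.union
      (measurableSet_lt (measurable_rev hV i') (measurable_rev hV i))

lemma measurableSet_nearlyTied {V : ℝ → ℝ} (hV : Measurable V) (K : ℕ) (H O₁ O₂ : Set ℕ)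
    (A B : ℝ) : MeasurableSet (nearlyTied V K H O₁ O₂ A B : Set (ι → ℝ)) := by
  have : (nearlyTied V K H O₁ O₂ A B : Set (ι → ℝ)) = dominates V K H O₁ O₂ ∩
      ⋃ i', ({Q | blk K (Q i') ∈ O₁ ∪ O₂} ∩ ({Q | A ≤ rev V Q i'} ∩
      ⋂ i, ({Q | blk K (Q i) ∈ H}ᶜ ∪ {Q | rev V Q i ≤ rev V Q i' + B}))) := by
    ext Q
    simp only [nearlyTied, Set.mem_ofPred_eq, Set.mem_iUnion, Set.mem_inter_iff, Set.mem_iInter,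
      Set.mem_union, Set.mem_compl_iff, imp_iff_not_or]
  rw [this]
  refine (measurableSet_dominates hV K H O₁ O₂).inter (MeasurableSet.iUnion fun i' =>
    (measurableSet_blk_mem K _ i').inter (MeasurableSet.inter ?_ (MeasurableSet.iInter fun i =>
      (measurableSet_blk_mem K H i).compl.union ?_)))
  · exact measurableSet_le measurable_const (measurable_rev hV i')
  · exact measurableSet_le (measurable_rev hV i) ((measurable_rev hV i').add_const _)

variable [DecidableEq ι]

lemma sel_eq_of_sdiff_eq {ι α : Type*} [DecidableEq ι] {z : ι → α × α} {J s s' : Finset ι} (h : s \ J = s' \ J)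
    {i : ι} (hi : i ∉ J) : sel s z i = sel s' z i := by
  have : i ∈ s ↔ i ∈ s' := by
    have h1 : i ∈ s \ J ↔ i ∈ s' \ J := by rw [h]
    simpa [Finset.mem_sdiff, hi] using h1
  simp only [sel, this]

/-- The effect on ranks of moving `u' - u` points from the block `j₂` to the block `j₁`. -/
lemma rk_sel_shift {K : ℕ} {z : ι → ℝ × ℝ} {J s s' : Finset ι} {j₁ j₂ : ℕ}
    (hJ : ∀ i ∈ J, blk K (z i).1 = j₁ ∧ blk K (z i).2 = j₂) (h : s \ J = s' \ J)
    {i : ι} (h1 : blk K (sel s z i) ≠ j₁) (h2 : blk K (sel s z i) ≠ j₂) :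
    sel s' z i = sel s z i ∧ (rk (sel s' z) i : ℤ) = rk (sel s z) i +
      ((if j₁ < blk K (sel s z i) then 1 else 0) - (if j₂ < blk K (sel s z i) then 1 else 0)) *
        (((s' ∩ J).card : ℤ) - (s ∩ J).card) := by
  have hi : i ∉ J := by
    intro hi
    have := hJ i hi
    by_cases hs : i ∈ s
    · simp only [sel, hs, if_true] at h1; exact h1 this.1
    · simp only [sel, hs, if_false] at h2; exact h2 this.2
  have hsel := sel_eq_of_sdiff_eq (z := z) h hi
  set b := blk K (sel s z i) with hb
  -- The rank is a contribution of the pairs outside `J` plus that of `J`. A pair in `J` counts when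
  -- its selected block lies below `b`; equality of blocks is excluded, so comparing blocks decides
  -- the comparison of points.
  have main : ∀ r : Finset ι, sel r z i = sel s z i → (rk (sel r z) i : ℤ) =
      ((Jᶜ.filter fun i' => sel r z i' ≤ sel s z i).card : ℤ) +
      ((if j₁ < b then ((r ∩ J).card : ℤ) else 0) +
        (if j₂ < b then (J.card : ℤ) - (r ∩ J).card else 0)) := by
    intro r hr
    have e0 : rk (sel r z) i = (Jᶜ.filter fun i' => sel r z i' ≤ sel s z i).card +
        (J.filter fun i' => sel r z i' ≤ sel s z i).card := by
      rw [rk, hr, ← Finset.card_union_of_disjoint]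
      · congr 1
        rw [← Finset.filter_union, Finset.union_comm, Finset.union_compl]
      · exact Finset.disjoint_filter_filter disjoint_compl_left
    have e1 : (J.filter fun i' => sel r z i' ≤ sel s z i).card =
        ((r ∩ J).filter fun _ => j₁ < b).card + ((J \ r).filter fun _ => j₂ < b).card := by
      rw [← Finset.card_union_of_disjoint]
      · congr 1
        ext i'
        simp only [Finset.mem_filter, Finset.mem_union, Finset.mem_inter, Finset.mem_sdiff]
        by_cases hi' : i' ∈ J
        swap
        · simp [hi']
        obtain ⟨g1, g2⟩ := hJ i' hi'
        by_cases hr' : i' ∈ r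
        · simp only [sel, hi', hr', if_true, true_and, not_true, and_false, false_and, or_false]
          constructor
          · intro hle
            have := blk_mono K hle
            rw [g1] at this
            exact lt_of_le_of_ne this (Ne.symm h1)
          · intro hlt
            rw [← g1] at hlt
            exact (lt_of_blk_lt hlt).le
        · simp only [sel, hi', hr', if_false, true_and, not_false_iff, false_and, false_or]
          constructor
          · intro hle
            have := blk_mono K hle
            rw [g2] at this
            exact lt_of_le_of_ne this (Ne.symm h2)
          · intro hlt
            rw [← g2] at hlt
            exact (lt_of_blk_lt hlt).le
      · refine Finset.disjoint_filter_filter ?_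
        rw [Finset.disjoint_left]
        intro x hx hx'
        simp only [Finset.mem_inter, Finset.mem_sdiff] at hx hx'
        exact hx'.2 hx.1
    have e2 : ((J \ r).card : ℤ) = J.card - (r ∩ J).card := by
      rw [Finset.card_sdiff, Nat.cast_sub (Finset.card_le_card Finset.inter_subset_right)]
    rw [e0, e1]
    rw [Finset.filter_const, Finset.filter_const]
    push_cast
    congr 2
    · split_ifs <;> simp
    · split_ifs
      · exact e2
      · simp
  have hbase : (Jᶜ.filter fun i' => sel s' z i' ≤ sel s z i) =
      (Jᶜ.filter fun i' => sel s z i' ≤ sel s z i) := by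
    refine Finset.filter_congr fun i' hi' => ?_
    rw [sel_eq_of_sdiff_eq (z := z) h (Finset.mem_compl.1 hi')]
  refine ⟨hsel.symm, ?_⟩
  rw [main s' hsel.symm, main s rfl, hbase]
  split_ifs <;> ring

/-- How `H`, `O₁ ∪ O₂` and the swapped blocks `j₁` (coin on), `j₂` (coin off) are arranged:
each swap moves the ranks in `H` up by one relative to those in `O₁ ∪ O₂`. -/
def Arranged (H O : Set ℕ) (j₁ j₂ : ℕ) : Prop :=
  ((∀ b ∈ H, j₁ < b ∧ b < j₂) ∧ ∀ b ∈ O, (b < j₁ ∧ b < j₂) ∨ (j₁ < b ∧ j₂ < b)) ∨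
  ((∀ b ∈ H, j₁ < b ∧ j₂ < b) ∧ ∀ b ∈ O, j₂ < b ∧ b < j₁)

open Classical in
-- Each additional coin in `J` changes the relative rank of `H` and `O₁ ∪ O₂` by one in favour of
-- `H`, hence the revenue difference by the value of the sample that moves. That value is at least
-- `a`, because a revenue of `a * n` is spread over at most `n` ranks. Starting from a lead, more
-- than `t` extra coins would open a gap exceeding `B`.
lemma card_nearlyTied_le {V : ℝ → ℝ} (hV : ∀ q, 0 ≤ V q) {K : ℕ} {H O₁ O₂ : Set ℕ} {j₁ j₂ : ℕ}
    (hA : Arranged H (O₁ ∪ O₂) j₁ j₂) {z : ι → ℝ × ℝ} {J : Finset ι}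
    (hJ : ∀ i ∈ J, blk K (z i).1 = j₁ ∧ blk K (z i).2 = j₂) (hne : J.Nonempty)
    {l a B : ℝ} (hl : 1 ≤ l) (ha : 0 < a) (t : ℕ) (hB : B ≤ t * a) :
    ((Finset.univ.filter fun s : Finset ι =>
      sel s z ∈ nearlyTied V K H O₁ O₂ (a * Fintype.card ι) B).card : ℝ) ≤
      (t + 1) * (36 * l / √J.card) *
        (Finset.univ.filter fun s : Finset ι => sel s z ∈ dominates V K H O₁ O₂).card +
        2 ^ (Fintype.card ι) * Real.exp (-2 * l ^ 2) := by
  have hn : (0 : ℝ) < Fintype.card ι := by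
    exact_mod_cast Fintype.card_pos_iff.2 ⟨hne.choose⟩
  have hH : ∀ {s s' : Finset ι}, s \ J = s' \ J → (s ∩ J).card ≤ (s' ∩ J).card → ∀ {i},
      blk K (sel s z i) ∈ H → sel s' z i = sel s z i ∧
        rev V (sel s z) i ≤ rev V (sel s' z) i := by
    intro s s' h hc i hi
    have hne1 : blk K (sel s z i) ≠ j₁ ∧ blk K (sel s z i) ≠ j₂ := by
      rcases hA with hA | hA <;> have := hA.1 _ hi <;> omega
    obtain ⟨e1, e2⟩ := rk_sel_shift hJ h hne1.1 hne1.2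
    refine ⟨e1, ?_⟩
    rw [rev, rev, e1]
    refine mul_le_mul_of_nonneg_left ?_ (hV _)
    have : rk (sel s z) i ≤ rk (sel s' z) i := by
      zify
      rw [e2]
      rcases hA with hA | hA <;> have h3 := hA.1 _ hi
      · rw [if_pos h3.1, if_neg (by omega)]; omega
      · rw [if_pos h3.1, if_pos h3.2]; omega
    exact_mod_cast this
  have hO : ∀ {s s' : Finset ι}, s \ J = s' \ J → (s ∩ J).card ≤ (s' ∩ J).card → ∀ {i},
      blk K (sel s z i) ∈ O₁ ∪ O₂ → sel s' z i = sel s z i ∧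
        rev V (sel s' z) i ≤ rev V (sel s z) i := by
    intro s s' h hc i hi
    have hne1 : blk K (sel s z i) ≠ j₁ ∧ blk K (sel s z i) ≠ j₂ := by
      rcases hA with hA | hA <;> have := hA.2 _ hi <;> omega
    obtain ⟨e1, e2⟩ := rk_sel_shift hJ h hne1.1 hne1.2
    refine ⟨e1, ?_⟩
    rw [rev, rev, e1]
    refine mul_le_mul_of_nonneg_left ?_ (hV _)
    have : rk (sel s' z) i ≤ rk (sel s z) i := by
      zify
      rw [e2]
      rcases hA with hA | hA <;> have h3 := hA.2 _ hi
      · rcases h3 with h3 | h3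
        · rw [if_neg (by omega), if_neg (by omega)]; omega
        · rw [if_pos h3.1, if_pos h3.2]; omega
      · rw [if_neg (by omega), if_pos h3.1]; omega
    exact_mod_cast this
  refine card_coins_le J hne hl t (fun s => sel s z ∈ dominates V K H O₁ O₂)
    (fun s => sel s z ∈ nearlyTied V K H O₁ O₂ (a * Fintype.card ι) B) (fun s h => h.1) ?_ ?_
  · rintro s s' h hc ⟨i, hi, h1, h2⟩
    obtain ⟨e1, e2⟩ := hH h hc hi
    have back : ∀ {i'}, blk K (sel s' z i') ∈ O₁ ∪ O₂ →
        sel s z i' = sel s' z i' ∧ blk K (sel s z i') ∈ O₁ ∪ O₂ := by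
      intro i' hi'
      have hne1 : blk K (sel s' z i') ≠ j₁ ∧ blk K (sel s' z i') ≠ j₂ := by
        rcases hA with hA | hA <;> have := hA.2 _ hi' <;> omega
      have := (rk_sel_shift hJ h.symm hne1.1 hne1.2).1
      exact ⟨this, this ▸ hi'⟩
    refine ⟨i, by rw [e1]; exact hi, fun i' hi' => ?_, fun i' hi' => ?_⟩
    · obtain ⟨f1, f2⟩ := back (Or.inl hi')
      have := (hO h hc f2).2
      have := h1 i' (by rw [f1]; exact hi')
      linarith
    · obtain ⟨f1, f2⟩ := back (Or.inr hi')
      have := (hO h hc f2).2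
      have := h2 i' (by rw [f1]; exact hi')
      linarith
  · rintro s s' h hc ⟨i, hi, h1, h2⟩ ⟨-, i', hi', h3, h4⟩
    obtain ⟨e1, -⟩ := hH h hc hi
    have hne1 : blk K (sel s' z i') ≠ j₁ ∧ blk K (sel s' z i') ≠ j₂ := by
      rcases hA with hA | hA <;> have := hA.2 _ hi' <;> omega
    have f1 := (rk_sel_shift hJ h.symm hne1.1 hne1.2).1
    have hi's : blk K (sel s z i') ∈ O₁ ∪ O₂ := by rw [f1]; exact hi'
    have hle : rev V (sel s z) i' ≤ rev V (sel s z) i := by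
      rcases hi's with h5 | h5
      · exact h1 i' h5
      · exact (h2 i' h5).le
    have h4' := h4 i (by rw [e1]; exact hi)
    have large : ∀ (r : Finset ι) (x : ι), a * Fintype.card ι ≤ rev V (sel r z) x →
        a ≤ V (sel r z x) := by
      intro r x hx
      have h6 : rev V (sel r z) x ≤ V (sel r z x) * Fintype.card ι := by
        refine mul_le_mul_of_nonneg_left ?_ (hV _)
        exact_mod_cast rk_le_card _ _
      exact le_of_mul_le_mul_right (hx.trans h6) hn
    have hO' := (hO h hc hi's).2
    have hneH : blk K (sel s z i) ≠ j₁ ∧ blk K (sel s z i) ≠ j₂ := by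
      rcases hA with hA | hA <;> have := hA.1 _ hi <;> omega
    have hneO : blk K (sel s z i') ≠ j₁ ∧ blk K (sel s z i') ≠ j₂ := by
      rcases hA with hA | hA <;> have := hA.2 _ hi's <;> omega
    obtain ⟨-, g1⟩ := rk_sel_shift hJ h hneH.1 hneH.2
    obtain ⟨-, g2⟩ := rk_sel_shift hJ h hneO.1 hneO.2
    have fin : ∀ x : ℝ, a ≤ x → x * (((s' ∩ J).card : ℝ) - (s ∩ J).card) ≤ B →
        (s' ∩ J).card ≤ (s ∩ J).card + t := by
      intro x hx hxB
      have h7 : (0 : ℝ) ≤ ((s' ∩ J).card : ℝ) - (s ∩ J).card := by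
        rw [sub_nonneg]; exact_mod_cast hc
      have h8 : a * (((s' ∩ J).card : ℝ) - (s ∩ J).card) ≤ a * t := by
        nlinarith [mul_le_mul_of_nonneg_right hx h7]
      have h9 := le_of_mul_le_mul_left h8 ha
      have : ((s' ∩ J).card : ℝ) ≤ (s ∩ J).card + t := by linarith
      exact_mod_cast this
    -- In the first arrangement the leader in `H` gains revenue and the rival keeps its own; in the
    -- second the leader stays put and the rival loses.
    rcases hA with hA | hA
    · have h5 := hA.1 _ hi
      rw [if_pos h5.1, if_neg (by omega)] at g1
      have g1' : (rk (sel s' z) i : ℝ) = rk (sel s z) i +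
          (((s' ∩ J).card : ℝ) - (s ∩ J).card) := by
        have : (rk (sel s' z) i : ℤ) = rk (sel s z) i +
          (((s' ∩ J).card : ℤ) - (s ∩ J).card) := by rw [g1]; ring
        exact_mod_cast this
      refine fin (V (sel s z i)) (large s i (by linarith)) ?_
      have : rev V (sel s' z) i = rev V (sel s z) i +
          V (sel s z i) * (((s' ∩ J).card : ℝ) - (s ∩ J).card) := by
        rw [rev, rev, e1, g1']; ring
      linarith
    · have h5 := hA.1 _ hi
      have h6 := hA.2 _ hi's
      rw [if_pos h5.1, if_pos h5.2] at g1
      rw [if_neg (by omega), if_pos h6.1] at g2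
      have g1' : (rk (sel s' z) i : ℝ) = rk (sel s z) i := by
        have : (rk (sel s' z) i : ℤ) = rk (sel s z) i := by rw [g1]; ring
        exact_mod_cast this
      have g2' : (rk (sel s' z) i' : ℝ) = rk (sel s z) i' -
          (((s' ∩ J).card : ℝ) - (s ∩ J).card) := by
        have : (rk (sel s' z) i' : ℤ) = rk (sel s z) i' -
          (((s' ∩ J).card : ℤ) - (s ∩ J).card) := by rw [g2]; ring
        exact_mod_cast this
      refine fin (V (sel s z i')) (large s i' (by linarith)) ?_
      have r1 : rev V (sel s' z) i = rev V (sel s z) i := by rw [rev, rev, e1, g1']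
      have r2 : rev V (sel s' z) i' = rev V (sel s z) i' -
          V (sel s z i') * (((s' ∩ J).card : ℝ) - (s ∩ J).card) := by
        rw [rev, rev, ← f1, g2']; ring
      linarith

end ranks

end IncentiveAwareness

/-! ### Uniform quantiles: near-tie probabilities and the reduction of `spread` to near ties -/

namespace IncentiveAwareness

/-- The uniform distribution on the unit interval. -/
noncomputable def unif : Measure ℝ := volume.restrict (Set.Ioo 0 1)

instance : IsProbabilityMeasure unif := ⟨by simp [unif]⟩

lemma unif_real_blk {K j : ℕ} (hj : j < K) : unif.real {q | blk K q = j} = 1 / K := by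
  have hK : (0 : ℝ) < K := by exact_mod_cast (Nat.zero_le j).trans_lt hj
  have hjK : (j : ℝ) + 1 ≤ K := by exact_mod_cast hj
  have hset : ({q | blk K q = j} ∩ Set.Ioo 0 1 : Set ℝ) =ᵐ[volume]
      Set.Ioo ((j : ℝ) / K) ((j + 1) / K) := by
    have h1 : (({q | blk K q = j} ∩ Set.Ioo 0 1) \ {(j : ℝ) / K} : Set ℝ) =
        Set.Ioo ((j : ℝ) / K) ((j + 1) / K) := by
      ext q
      simp only [Set.mem_sdiff, Set.mem_inter_iff, Set.mem_ofPred_eq, Set.mem_Ioo,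
        Set.mem_singleton_iff, div_lt_iff₀ hK, lt_div_iff₀ hK, eq_div_iff hK.ne']
      constructor
      · rintro ⟨⟨h2, h3, h4⟩, h5⟩
        rw [blk, Nat.floor_eq_iff (by positivity)] at h2
        rw [mul_comm] at h5
        rw [mul_comm q]
        exact ⟨lt_of_le_of_ne h2.1 (Ne.symm h5), h2.2⟩
      · rintro ⟨h2, h3⟩
        have h0 : 0 < q := by
          by_contra hn
          push Not at hn
          have : q * K ≤ 0 := mul_nonpos_of_nonpos_of_nonneg hn hK.le
          linarith [Nat.cast_nonneg (α := ℝ) j]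
        refine ⟨⟨?_, h0, ?_⟩, by linarith⟩
        · rw [blk, Nat.floor_eq_iff (by positivity), mul_comm]
          exact ⟨h2.le, h3⟩
        · nlinarith
    rw [← h1]
    exact (sdiff_null_ae_eq_self Real.volume_singleton).symm
  have hm : MeasurableSet {q | blk K q = j} :=
    measurable_blk K (MeasurableSet.of_discrete (s := {j}))
  rw [unif, measureReal_restrict_apply hm,
    measureReal_congr hset, Measure.real, Real.volume_Ioo, ENNReal.toReal_ofReal]
  · ring
  · rw [← sub_div]; ring_nf; positivity

lemma ae_unif_pi {ι : Type*} [Fintype ι] :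
    ∀ᵐ Q ∂(Measure.pi fun _ : ι => unif), ∀ i, Q i ∈ Set.Ioo (0 : ℝ) 1 := by
  rw [ae_all_iff]
  intro i
  have h : ∀ᵐ q ∂unif, q ∈ Set.Ioo (0 : ℝ) 1 := ae_restrict_mem measurableSet_Ioo
  exact (Measure.tendsto_eval_ae_ae (μ := fun _ : ι => unif) (i := i)).eventually h

lemma blk_lt {K : ℕ} (hK : 0 < K) {q : ℝ} (hq : q ∈ Set.Ioo (0 : ℝ) 1) : blk K q < K := by
  have : (0 : ℝ) < K := by exact_mod_cast hK
  rw [blk, Nat.floor_lt (mul_nonneg this.le hq.1.le)]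
  nlinarith [hq.2]

section bound
variable {ι : Type*} [Fintype ι]

/-- A pair falls into block `j₁` times block `j₂` with probability 1/K². Except with probability
exp(-n/(4K²)) there are thus more than n/(4K²) usable coins, and the coin estimate applies with √L ≥
√n/(2K). -/
lemma real_nearlyTied_le {V : ℝ → ℝ} (hV : ∀ q, 0 ≤ V q) (hVm : Measurable V) {K : ℕ}
    {H O₁ O₂ : Set ℕ} {j₁ j₂ : ℕ} (hj₁ : j₁ < K) (hj₂ : j₂ < K)
    (hA : Arranged H (O₁ ∪ O₂) j₁ j₂) (hι : 0 < Fintype.card ι)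
    {l a B : ℝ} (hl : 1 ≤ l) (ha : 0 < a) (t : ℕ) (hB : B ≤ t * a) :
    (Measure.pi fun _ : ι => unif).real (nearlyTied V K H O₁ O₂ (a * Fintype.card ι) B) ≤
      (t + 1) * (72 * l * K / √(Fintype.card ι)) *
        (Measure.pi fun _ : ι => unif).real (dominates V K H O₁ O₂) +
        Real.exp (-2 * l ^ 2) + Real.exp (-(Fintype.card ι * (1 / K) ^ 2 / 4)) := by
  classical
  have hK : (0 : ℝ) < K := by exact_mod_cast (Nat.zero_le _).trans_lt hj₁
  have hn : (0 : ℝ) < Fintype.card ι := by exact_mod_cast hι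
  set S : Set (ℝ × ℝ) := {q | blk K q = j₁} ×ˢ {q | blk K q = j₂} with hS
  have hSm : MeasurableSet S :=
    (measurable_blk K (MeasurableSet.of_discrete (s := {j₁}))).prod
      (measurable_blk K (MeasurableSet.of_discrete (s := {j₂})))
  have hSr : (unif.prod unif).real S = (1 / K) ^ 2 := by
    rw [hS, measureReal_prod_prod, unif_real_blk hj₁, unif_real_blk hj₂, sq]
  have hch := real_cntIn_le_le (ι := ι) (unif.prod unif) hSm (p := (1 / K : ℝ) ^ 2)
    (by positivity) hSr.ge
  refine (real_le_of_card_sel unif (measurableSet_nearlyTied hVm K H O₁ O₂ _ B)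
    (measurableSet_dominates hVm K H O₁ O₂)
    (B := {z | (cntIn S z : ℝ) ≤ Fintype.card ι * (1 / K) ^ 2 / 4})
    (measurableSet_le ((Measurable.of_discrete (f := fun k : ℕ => (k : ℝ))).comp
      (measurable_cntIn hSm)) measurable_const)
    (h := (t + 1) * (72 * l * K / √(Fintype.card ι))) (e := Real.exp (-2 * l ^ 2))
    (by positivity) (by positivity) ?_).trans (by linarith)
  intro z hz
  simp only [Set.mem_ofPred_eq, not_le] at hz
  set J : Finset ι := Finset.univ.filter fun i => z i ∈ S with hJdef
  have hJc : cntIn S z = J.card := by rw [cntIn, hJdef]; congr!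
  rw [hJc] at hz
  have hJpos : (0 : ℝ) < J.card := lt_of_le_of_lt (by positivity) hz
  have hJne : J.Nonempty := Finset.card_pos.1 (by exact_mod_cast hJpos)
  have hJ : ∀ i ∈ J, blk K (z i).1 = j₁ ∧ blk K (z i).2 = j₂ := by
    intro i hi
    simpa [hJdef, hS] using hi
  refine (card_nearlyTied_le hV hA hJ hJne hl ha t hB).trans ?_
  have hsq : √(Fintype.card ι : ℝ) / (2 * K) ≤ √J.card := by
    refine Real.le_sqrt_of_sq_le ?_
    rw [div_pow, Real.sq_sqrt hn.le]
    refine le_trans (le_of_eq ?_) hz.le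
    field_simp; ring
  have h36 : 36 * l / √J.card ≤ 72 * l * K / √(Fintype.card ι) := by
    have hs : 0 < √(Fintype.card ι : ℝ) := Real.sqrt_pos.2 hn
    calc 36 * l / √J.card ≤ 36 * l / (√(Fintype.card ι : ℝ) / (2 * K)) :=
          div_le_div_of_nonneg_left (by linarith) (by positivity) hsq
      _ = 72 * l * K / √(Fintype.card ι) := by field_simp; ring
  gcongr

/-- The event that the samples are uninformative at resolution `1 / K`: some sample whose revenue
is within `m` units of the maximum is far in rank from the best sample. -/
def spread (V : ℝ → ℝ) (m : ℕ) (d : ℝ) : Set (ι → ℝ) :=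
  {Q | ∃ r, (∀ i, rev V Q i ≤ rev V Q r) ∧ (∀ i, Q r < Q i → rev V Q i < rev V Q r) ∧
    ∃ i', rev V Q r ≤ rev V Q i' + m * V (Q i') ∧ d < |(rk Q i' : ℝ) - rk Q r|}

/-- The samples have maximal revenue at least `v₀` each, and no nearly optimal sample exceeds
`D * v₀`. -/
def typical (V : ℝ → ℝ) (m : ℕ) (v₀ D : ℝ) : Set (ι → ℝ) :=
  {Q | (∃ i, v₀ * Fintype.card ι ≤ rev V Q i) ∧
    ∀ i', (∀ i, rev V Q i ≤ rev V Q i' + m * V (Q i')) → V (Q i') ≤ D * v₀}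

/-- The samples that separate the two ranks lie in at most three consecutive blocks. -/
lemma rk_sub_le_of_blk {K : ℕ} {Q : ι → ℝ} {i i' : ι} {w : ℝ}
    (hw : ∀ j, (cntIn {q | blk K q = j} Q : ℝ) ≤ w)
    (hb : blk K (Q i') ≤ blk K (Q i) + 2) : (rk Q i' : ℝ) - rk Q i ≤ 3 * w := by
  classical
  have h1 : rk Q i' ≤ rk Q i + ∑ j ∈ Finset.range 3, cntIn {q | blk K q = blk K (Q i) + j} Q := by
    have hsub : (Finset.univ.filter fun x => Q x ≤ Q i') ⊆
        (Finset.univ.filter fun x => Q x ≤ Q i) ∪ (Finset.range 3).biUnion fun j =>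
          Finset.univ.filter fun x => Q x ∈ {q | blk K q = blk K (Q i) + j} := by
      intro x hx
      simp only [Finset.mem_filter, Finset.mem_univ, true_and, Finset.mem_union,
        Finset.mem_biUnion, Finset.mem_range, Set.mem_ofPred_eq] at hx ⊢
      rcases le_or_gt (Q x) (Q i) with h | h
      · exact Or.inl h
      · right
        have g1 := blk_mono K h.le
        have g2 := blk_mono K hx
        exact ⟨blk K (Q x) - blk K (Q i), by omega, by omega⟩
    refine (Finset.card_le_card hsub).trans ((Finset.card_union_le (α := ι) _ _).trans ?_)
    refine Nat.add_le_add_left (Finset.card_biUnion_le.trans (Finset.sum_le_sum fun j _ => ?_)) _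
    unfold cntIn
    exact le_of_eq (by congr!)
  have h2 : (rk Q i' : ℝ) ≤ rk Q i +
      ∑ j ∈ Finset.range 3, (cntIn {q | blk K q = blk K (Q i) + j} Q : ℝ) := by
    exact_mod_cast h1
  have h3 : ∑ j ∈ Finset.range 3, (cntIn {q | blk K q = blk K (Q i) + j} Q : ℝ) ≤
      ∑ _j ∈ Finset.range 3, w := Finset.sum_le_sum fun j _ => hw _
  simp at h3
  linarith

lemma rk_le_of_blk_eq_zero {K : ℕ} {Q : ι → ℝ} {i : ι} {w : ℝ}
    (hw : ∀ j, (cntIn {q | blk K q = j} Q : ℝ) ≤ w) (hb : blk K (Q i) = 0) :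
    (rk Q i : ℝ) ≤ w := by
  classical
  refine le_trans ?_ (hw 0)
  have : rk Q i ≤ cntIn {q | blk K q = 0} Q := by
    refine Finset.card_le_card fun x hx => ?_
    simp only [Finset.mem_filter, Finset.mem_univ, true_and, Set.mem_ofPred_eq] at hx ⊢
    have := blk_mono K hx
    omega
  exact_mod_cast this

/-- The event `nearlyTied` for the best sample in the block `j`, compared with non-adjacent
blocks. -/
def tiedAt (V : ℝ → ℝ) (K : ℕ) (A B : ℝ) (j : ℕ) : Set (ι → ℝ) :=
  nearlyTied V K {j} {b | b + 2 ≤ j} {b | j + 2 ≤ b} A B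

/-- The event `nearlyTied` for the best sample in the last block, compared with all but the first
block and the last two. -/
def tiedLast (V : ℝ → ℝ) (K : ℕ) (A B : ℝ) : Set (ι → ℝ) :=
  nearlyTied V K {K - 1} {b | 0 < b ∧ b < K - 2} ∅ A B

/-- If no block holds more than 3n/K samples, a rank distance above 9n/K forces a block distance of
at least 3. The best sample then makes its own block the leader, and its rival witnesses a near tie.
-/
lemma spread_inter_typical_subset {V : ℝ → ℝ} (hV : ∀ q, 0 ≤ V q) {m K : ℕ} {v₀ D : ℝ}
    (hv₀ : 0 < v₀) (hK3 : 3 ≤ K) (hm : m * D ≤ Fintype.card ι / 2) (hKD : 6 * D < K)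
    {Q : ι → ℝ} (hQ : ∀ i, Q i ∈ Set.Ioo (0 : ℝ) 1)
    (hw : ∀ j, (cntIn {q | blk K q = j} Q : ℝ) ≤ 3 * (Fintype.card ι * (1 / K)))
    (hs : Q ∈ spread V m (9 * Fintype.card ι / K)) (ht : Q ∈ typical V m v₀ D) :
    (∃ j, 1 ≤ j ∧ j + 1 < K ∧ Q ∈ tiedAt V K (v₀ / 2 * Fintype.card ι) (m * (D * v₀)) j) ∨
      Q ∈ tiedLast V K (v₀ / 2 * Fintype.card ι) (m * (D * v₀)) := by
  obtain ⟨r, hmax, hlow, i', hnear, hd⟩ := hs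
  obtain ⟨⟨i₀, hi₀⟩, hD⟩ := ht
  set n : ℝ := (Fintype.card ι : ℝ) with hn
  have hn0 : 0 < n := by
    rw [hn]; exact_mod_cast Fintype.card_pos_iff.2 ⟨r⟩
  have hKr : (0 : ℝ) < K := by exact_mod_cast (by omega : 0 < K)
  have hM : v₀ * n ≤ rev V Q r := hi₀.trans (hmax i₀)
  have hm0 : (0 : ℝ) ≤ m := Nat.cast_nonneg m
  have hVr : V (Q r) ≤ D * v₀ := hD r fun i => (hmax i).trans (by
    have := mul_nonneg hm0 (hV (Q r)); linarith)
  have hVi : V (Q i') ≤ D * v₀ := hD i' fun i => (hmax i).trans hnear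
  have hmV : m * V (Q i') ≤ m * (D * v₀) := mul_le_mul_of_nonneg_left hVi hm0
  have hmD : m * (D * v₀) ≤ v₀ / 2 * n := by nlinarith
  have hrev' : v₀ / 2 * n ≤ rev V Q i' := by linarith
  -- A sample of block 0 has rank at most 3n/K, so at value at most D v₀ its revenue is below v₀ n /
  -- 2 once K > 6D. Block 0 must be excluded because it has no block below it, and because
  -- `tiedLast` swaps points with it.
  have hlarge : ∀ i, V (Q i) ≤ D * v₀ → v₀ / 2 * n ≤ rev V Q i → blk K (Q i) ≠ 0 := by
    intro i h1 h2 h0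
    have h3 := rk_le_of_blk_eq_zero hw h0
    have h4 : rev V Q i ≤ D * v₀ * (3 * (n * (1 / K))) :=
      mul_le_mul h1 h3 (Nat.cast_nonneg _) ((hV _).trans h1)
    have h5 : v₀ / 2 * n * K ≤ D * v₀ * (3 * n) := by
      calc v₀ / 2 * n * K ≤ D * v₀ * (3 * (n * (1 / K))) * K :=
            mul_le_mul_of_nonneg_right (h2.trans h4) hKr.le
        _ = D * v₀ * (3 * n) := by field_simp
    have h6 : 0 < v₀ * n := mul_pos hv₀ hn0
    nlinarith
  have hr0 : blk K (Q r) ≠ 0 := hlarge r hVr (by nlinarith)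
  have hi0 : blk K (Q i') ≠ 0 := hlarge i' hVi hrev'
  have hfar : blk K (Q i') + 3 ≤ blk K (Q r) ∨ blk K (Q r) + 3 ≤ blk K (Q i') := by
    by_contra hcon
    push Not at hcon
    have h9 : 3 * (3 * (n * (1 / K))) = 9 * n / K := by ring
    rcases le_total (Q i') (Q r) with h | h
    · have h1 := rk_sub_le_of_blk (i := i') (i' := r) hw (by omega)
      have h2 : (rk Q i' : ℝ) ≤ rk Q r := by
        exact_mod_cast Finset.card_le_card fun x hx => by
          simp only [Finset.mem_filter, Finset.mem_univ, true_and] at hx ⊢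
          exact hx.trans h
      rw [abs_sub_comm, abs_of_nonneg (by linarith)] at hd
      linarith
    · have h1 := rk_sub_le_of_blk (i := r) (i' := i') hw (by omega)
      have h2 : (rk Q r : ℝ) ≤ rk Q i' := by
        exact_mod_cast Finset.card_le_card fun x hx => by
          simp only [Finset.mem_filter, Finset.mem_univ, true_and] at hx ⊢
          exact hx.trans h
      rw [abs_of_nonneg (by linarith)] at hd
      linarith
  have hrK := blk_lt (by omega : 0 < K) (hQ r)
  have hiK := blk_lt (by omega : 0 < K) (hQ i')
  have htie : ∀ i, rev V Q i ≤ rev V Q i' + m * (D * v₀) := fun i => by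
    linarith [hmax i]
  rcases Nat.lt_or_ge (blk K (Q r) + 1) K with h | h
  · refine Or.inl ⟨blk K (Q r), by omega, h, ⟨r, rfl, fun i _ => hmax i, fun i hi => hlow i ?_⟩,
      i', ?_, hrev', fun i _ => htie i⟩
    · simp only [Set.mem_ofPred_eq] at hi
      exact lt_of_blk_lt (K := K) (by omega)
    · simp only [Set.mem_union, Set.mem_ofPred_eq]; omega
  · refine Or.inr ⟨⟨r, ?_, fun i _ => hmax i, fun i hi => absurd hi (Set.notMem_empty _)⟩,
      i', ?_, hrev', fun i _ => htie i⟩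
    · rw [Set.mem_singleton_iff]; omega
    · simp only [Set.mem_union, Set.mem_ofPred_eq]; left; omega

end bound

end IncentiveAwareness

namespace IncentiveAwareness

/-! ### The probability that nearly optimal samples are far apart -/

section spread
variable {ι : Type*} [Fintype ι]

/-- Two non-adjacent blocks cannot both lead: the lower one would have to win strictly and the upper
one at least weakly. The strict inequality for higher blocks in `dominates` serves exactly this
disjointness. -/
lemma sum_parity_dominates_le {V : ℝ → ℝ} (hVm : Measurable V) (K e : ℕ) :
    ∑ j ∈ (Finset.range K).filter (fun j => j % 2 = e), (Measure.pi fun _ : ι => unif).real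
      (dominates V K {j} {b | b + 2 ≤ j} {b | j + 2 ≤ b}) ≤ 1 := by
  have hdis : ∀ i j, i + 2 ≤ j → Disjoint
      (dominates V K {i} {b | b + 2 ≤ i} {b | i + 2 ≤ b} : Set (ι → ℝ))
      (dominates V K {j} {b | b + 2 ≤ j} {b | j + 2 ≤ b}) := by
    intro i j hij
    rw [Set.disjoint_left]
    rintro Q ⟨x, hx, -, hx2⟩ ⟨y, hy, hy1, -⟩
    rw [Set.mem_singleton_iff] at hx hy
    have h1 := hx2 y (by simp only [Set.mem_ofPred_eq]; omega)
    have h2 := hy1 x (by simp only [Set.mem_ofPred_eq]; omega)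
    linarith
  rw [← measureReal_biUnion_finset]
  · exact measureReal_le_one
  · intro i hi j hj hij
    simp only [Finset.coe_filter, Finset.mem_range, Set.mem_ofPred_eq] at hi hj
    rcases Nat.lt_or_gt_of_ne hij with h | h
    · exact hdis i j (by omega)
    · exact (hdis j i (by omega)).symm
  · exact fun j _ => measurableSet_dominates hVm _ _ _ _

lemma sum_dominates_le {V : ℝ → ℝ} (hVm : Measurable V) (K : ℕ) :
    ∑ j ∈ Finset.range K, (Measure.pi fun _ : ι => unif).real
      (dominates V K {j} {b | b + 2 ≤ j} {b | j + 2 ≤ b}) ≤ 2 := by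
  rw [← Finset.sum_filter_add_sum_filter_not _ (fun j => j % 2 = 0)]
  have h : (Finset.range K).filter (fun j => ¬ j % 2 = 0) =
      (Finset.range K).filter (fun j => j % 2 = 1) :=
    Finset.filter_congr fun j _ => by omega
  rw [h]
  linarith [sum_parity_dominates_le (ι := ι) hVm K 0, sum_parity_dominates_le (ι := ι) hVm K 1]

/-- The main terms are proportional to the probabilities of `dominates`, which sum to at most 2 over
the inner blocks; the last block adds at most one more. Only the exponentially small errors are
multiplied by K. -/
lemma real_spread_inter_typical_le {V : ℝ → ℝ} (hV : ∀ q, 0 ≤ V q) (hVm : Measurable V)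
    {m K : ℕ} {v₀ D l : ℝ} (hv₀ : 0 < v₀) (hι : 0 < Fintype.card ι) (hK3 : 3 ≤ K)
    (hm : m * D ≤ Fintype.card ι / 2) (hKD : 6 * D < K) (hl : 1 ≤ l) (t : ℕ)
    (ht : 2 * (m * D) ≤ t) :
    (Measure.pi fun _ : ι => unif).real
      (spread V m (9 * Fintype.card ι / K) ∩ typical V m v₀ D) ≤
      3 * ((t + 1) * (72 * l * K / √(Fintype.card ι))) +
      K * (Real.exp (-2 * l ^ 2) + Real.exp (-(Fintype.card ι * (1 / K) ^ 2 / 4)) +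
        Real.exp (-(Fintype.card ι * (1 / K)))) := by
  classical
  set n : ℝ := (Fintype.card ι : ℝ) with hn
  set μ := (Measure.pi fun _ : ι => unif) with hμ
  set h : ℝ := (t + 1) * (72 * l * K / √n) with hh
  have hh0 : 0 ≤ h := by positivity
  set e : ℝ := Real.exp (-2 * l ^ 2) + Real.exp (-(n * (1 / K) ^ 2 / 4)) with he
  have he0 : 0 ≤ e := by positivity
  set JJ := (Finset.range K).filter fun j => 1 ≤ j ∧ j + 1 < K with hJJ
  have hB : m * (D * v₀) ≤ t * (v₀ / 2) := by nlinarith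
  set B : Set (ι → ℝ) := (⋃ j ∈ JJ, tiedAt V K (v₀ / 2 * n) (m * (D * v₀)) j) ∪
    (tiedLast V K (v₀ / 2 * n) (m * (D * v₀)) ∪
      ⋃ j ∈ Finset.range K, {Q | 3 * (n * (1 / K)) ≤ cntIn {q | blk K q = j} Q}) with hBdef
  have hsub : (spread V m (9 * n / K) ∩ typical V m v₀ D : Set (ι → ℝ)) ≤ᵐ[μ] B := by
    filter_upwards [ae_unif_pi (ι := ι)] with Q hQ hmem
    obtain ⟨hs, htp⟩ := hmem
    change Q ∈ B
    by_cases hw : ∃ j, j < K ∧ 3 * (n * (1 / K)) ≤ cntIn {q | blk K q = j} Q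
    · obtain ⟨j, hj, hjw⟩ := hw
      refine Or.inr (Or.inr ?_)
      simp only [Set.mem_iUnion, Finset.mem_range]
      exact ⟨j, hj, hjw⟩
    · push Not at hw
      have hw' : ∀ j, (cntIn {q | blk K q = j} Q : ℝ) ≤ 3 * (n * (1 / K)) := by
        intro j
        rcases Nat.lt_or_ge j K with hj | hj
        · exact (hw j hj).le
        · have : cntIn {q | blk K q = j} Q = 0 := by
            refine cntIn_eq_zero fun i hi => ?_
            have := blk_lt (by omega : 0 < K) (hQ i)
            simp only [Set.mem_ofPred_eq] at hi
            omega
          rw [this]; simp only [Nat.cast_zero]; positivity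
      rcases spread_inter_typical_subset hV hv₀ hK3 hm hKD hQ hw' hs htp with
        ⟨j, h1, h2, h3⟩ | h3
      · refine Or.inl ?_
        simp only [Set.mem_iUnion, hJJ, Finset.mem_filter, Finset.mem_range]
        exact ⟨j, ⟨by omega, h1, h2⟩, h3⟩
      · exact Or.inr (Or.inl h3)
  have h1 : μ.real (spread V m (9 * n / K) ∩ typical V m v₀ D) ≤ μ.real B :=
    ENNReal.toReal_mono (measure_ne_top _ _) (measure_mono_ae hsub)
  have hat : ∀ j ∈ JJ, μ.real (tiedAt V K (v₀ / 2 * n) (m * (D * v₀)) j) ≤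
      h * μ.real (dominates V K {j} {b | b + 2 ≤ j} {b | j + 2 ≤ b}) + e := by
    intro j hj
    simp only [hJJ, Finset.mem_filter, Finset.mem_range] at hj
    -- Points move between the two neighbours of block j, past block j and no other.
    have hA : Arranged {j} ({b | b + 2 ≤ j} ∪ {b | j + 2 ≤ b}) (j - 1) (j + 1) := by
      left
      refine ⟨fun b hb => ?_, fun b hb => ?_⟩
      · rw [Set.mem_singleton_iff] at hb; omega
      · simp only [Set.mem_union, Set.mem_ofPred_eq] at hb; omega
    have := real_nearlyTied_le (ι := ι) hV hVm (K := K) (by omega) (by omega) hA hι hl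
      (half_pos hv₀) t hB
    rw [add_assoc] at this
    exact this
  have hlast : μ.real (tiedLast V K (v₀ / 2 * n) (m * (D * v₀))) ≤ h + e := by
    -- The last block has no upper neighbour. Moving points from block 0 to block K - 2 instead
    -- lowers the ranks strictly in between and leaves the last block alone.
    have hA : Arranged {K - 1} ({b | 0 < b ∧ b < K - 2} ∪ ∅) (K - 2) 0 := by
      right
      refine ⟨fun b hb => ?_, fun b hb => ?_⟩
      · rw [Set.mem_singleton_iff] at hb; omega
      · simp only [Set.mem_union, Set.mem_ofPred_eq, Set.mem_empty_iff_false, or_false] at hb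
        omega
    have := real_nearlyTied_le (ι := ι) hV hVm (K := K) (by omega) (by omega) hA hι hl
      (half_pos hv₀) t hB
    rw [add_assoc] at this
    refine this.trans (add_le_add_left ?_ _)
    exact mul_le_of_le_one_right hh0 measureReal_le_one
  have hcnt : ∀ j ∈ Finset.range K,
      μ.real {Q | 3 * (n * (1 / K)) ≤ cntIn {q | blk K q = j} Q} ≤ Real.exp (-(n * (1 / K))) := by
    intro j hj
    exact real_cntIn_ge_le unif (measurable_blk K (MeasurableSet.of_discrete (s := {j})))
      (unif_real_blk (Finset.mem_range.1 hj)).le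
  have hJc : ((JJ.card : ℕ) : ℝ) + 1 ≤ K := by
    have : JJ.card + 1 ≤ K := by
      have h2 : JJ ⊆ Finset.Ico 1 K := by
        intro j hj
        simp only [hJJ, Finset.mem_filter, Finset.mem_range, Finset.mem_Ico] at hj ⊢
        omega
      have h3 := Finset.card_le_card h2
      rw [Nat.card_Ico] at h3
      omega
    exact_mod_cast this
  have s1 : μ.real (⋃ j ∈ JJ, tiedAt V K (v₀ / 2 * n) (m * (D * v₀)) j) ≤ 2 * h + JJ.card * e := by
    refine (measureReal_biUnion_finset_le _ _).trans ((Finset.sum_le_sum hat).trans ?_)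
    rw [Finset.sum_add_distrib, ← Finset.mul_sum, Finset.sum_const, nsmul_eq_mul]
    have h4 : ∑ j ∈ JJ, μ.real (dominates V K {j} {b | b + 2 ≤ j} {b | j + 2 ≤ b}) ≤ 2 :=
      (Finset.sum_le_sum_of_subset_of_nonneg (Finset.filter_subset _ _)
        fun _ _ _ => measureReal_nonneg).trans (sum_dominates_le hVm K)
    nlinarith
  have s2 : μ.real (⋃ j ∈ Finset.range K, {Q | 3 * (n * (1 / K)) ≤ cntIn {q | blk K q = j} Q}) ≤
      K * Real.exp (-(n * (1 / K))) := by
    refine (measureReal_biUnion_finset_le _ _).trans ((Finset.sum_le_sum hcnt).trans ?_)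
    simp
  have h5 : μ.real B ≤ (2 * h + JJ.card * e) + ((h + e) + K * Real.exp (-(n * (1 / K)))) :=
    (measureReal_union_le _ _).trans (add_le_add s1
      ((measureReal_union_le _ _).trans (add_le_add hlast s2)))
  nlinarith

/-- The choice l² = log n makes the binomial error at most 1/n², and 16 K² log n ≤ n does the same
job for the failures of the block counts. The window length is the ceiling of 2mD. -/
lemma real_spread_le {V : ℝ → ℝ} (hV : ∀ q, 0 ≤ V q) (hVm : Measurable V)
    {m K : ℕ} {v₀ D : ℝ} (hv₀ : 0 < v₀) (hn : 3 ≤ Fintype.card ι) (hm1 : 1 ≤ m) (hD : 1 ≤ D)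
    (hm : m * D ≤ Fintype.card ι / 2) (hKD : 6 * D < K)
    (hKn : 16 * Real.log (Fintype.card ι) * K ^ 2 ≤ Fintype.card ι) :
    (Measure.pi fun _ : ι => unif).real
      (spread V m (9 * Fintype.card ι / K) ∩ typical V m v₀ D) ≤
      900 * (m * D) * K * √(Real.log (Fintype.card ι)) / √(Fintype.card ι) := by
  set n : ℝ := (Fintype.card ι : ℝ) with hndef
  have hn3 : (3 : ℝ) ≤ n := by rw [hndef]; exact_mod_cast hn
  have hlog : 1 ≤ Real.log n := by
    rw [Real.le_log_iff_exp_le (by linarith)]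
    have := Real.exp_one_lt_d9
    linarith
  set l := √(Real.log n) with hl
  have hl1 : 1 ≤ l := by rw [hl]; exact Real.one_le_sqrt.2 hlog
  have hl2 : l ^ 2 = Real.log n := Real.sq_sqrt (by linarith)
  have hK6 : (6 : ℝ) < K := by linarith
  have hK3 : 3 ≤ K := by
    have : (6 : ℕ) < K := by exact_mod_cast hK6
    omega
  have hmr : (1 : ℝ) ≤ m := by exact_mod_cast hm1
  have hmD : 1 ≤ m * D := by nlinarith
  have hs0 : 0 < √n := Real.sqrt_pos.2 (by linarith)
  have hmain := real_spread_inter_typical_le (ι := ι) hV hVm hv₀ (by omega) hK3 hm hKD hl1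
    ⌈2 * (m * D)⌉₊ (Nat.le_ceil _)
  have ht : ((⌈2 * (m * D)⌉₊ : ℕ) : ℝ) + 1 ≤ 4 * (m * D) := by
    have := Nat.ceil_lt_add_one (by positivity : 0 ≤ 2 * (m * D))
    linarith
  have hexp : ∀ x, 2 * Real.log n ≤ x → Real.exp (-x) ≤ 1 / √n := by
    intro x hx
    have h1 : Real.exp (-x) ≤ 1 / n := by
      have h2 : Real.exp (-Real.log n) = 1 / n := by
        rw [Real.exp_neg, Real.exp_log (by linarith), one_div]
      exact (Real.exp_le_exp.2 (by linarith)).trans_eq h2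
    refine h1.trans (one_div_le_one_div_of_le hs0 ?_)
    rw [Real.sqrt_le_left (by linarith)]
    nlinarith
  have hKp : (0 : ℝ) < K := by linarith
  have hnK : 16 * Real.log n ≤ n * (1 / K) ^ 2 := by
    rw [one_div, inv_pow, ← div_eq_mul_inv, le_div_iff₀ (by positivity)]
    exact hKn
  have hnK' : n * (1 / K : ℝ) ^ 2 ≤ n * (1 / K) := by
    refine mul_le_mul_of_nonneg_left ?_ (by linarith)
    have h1 : (1 / K : ℝ) ≤ 1 := by rw [div_le_one hKp]; linarith
    have h2 : (0 : ℝ) ≤ 1 / K := by positivity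
    nlinarith
  have e1 : Real.exp (-2 * l ^ 2) ≤ 1 / √n := by
    rw [hl2, neg_mul]; exact hexp _ le_rfl
  have e2 := hexp (n * (1 / K) ^ 2 / 4) (by linarith)
  have e3 := hexp (n * (1 / K)) (by linarith)
  refine hmain.trans ?_
  have hKs : 0 ≤ (K : ℝ) / √n := by positivity
  have a1 : 3 * (((⌈2 * (m * D)⌉₊ : ℕ) + 1 : ℝ) * (72 * l * K / √n)) ≤
      864 * ((m * D) * l * (K / √n)) := by
    have h1 : 0 ≤ 72 * l * K / √n := by positivity
    have h2 := mul_le_mul_of_nonneg_right ht h1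
    have h3 : 4 * (m * D) * (72 * l * K / √n) = 288 * ((m * D) * l * (K / √n)) := by ring
    linarith
  have a2 : (K : ℝ) * (Real.exp (-2 * l ^ 2) + Real.exp (-(n * (1 / K) ^ 2 / 4)) +
      Real.exp (-(n * (1 / K)))) ≤ 3 * (K / √n) := by
    have h1 := mul_le_mul_of_nonneg_left (add_le_add (add_le_add e1 e2) e3) hKp.le
    have h2 : (K : ℝ) * (1 / √n + 1 / √n + 1 / √n) = 3 * (K / √n) := by ring
    linarith
  have a3 : (K : ℝ) / √n ≤ (m * D) * l * (K / √n) :=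
    le_mul_of_one_le_left hKs (by nlinarith)
  have a4 : 900 * (m * D) * K * l / √n = 900 * ((m * D) * l * (K / √n)) := by ring
  rw [a4]
  linarith [mul_nonneg (by positivity : 0 ≤ (m * D) * l) hKs]

end spread

/-! ### From rank concentration to a bound on `deltaWorst` -/

section pointwise
variable {N : ℕ} {I : Finset (Fin N)} {c : ℝ}

/-- Take the largest quantile whose value is still at least `p`. It works even when `V` has
plateaus, that is, when the law has atoms. -/
lemma exists_rk_eq_cnt {ι : Type*} [Fintype ι] {V : ℝ → ℝ} (hV : AntitoneOn V (Set.Ioo 0 1))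
    {Q : ι → ℝ} (hQ : ∀ i, Q i ∈ Set.Ioo (0 : ℝ) 1) {p : ℝ} (hp : 1 ≤ cnt (fun i => V (Q i)) p) :
    ∃ i, p ≤ V (Q i) ∧ rk Q i = cnt (fun i => V (Q i)) p := by
  obtain ⟨j, hj⟩ := (cnt_pos_iff _ _).1 hp
  obtain ⟨i, hi, hmax⟩ := Finset.exists_max_image (Finset.univ.filter fun i => p ≤ V (Q i)) Q
    ⟨j, by simpa using hj⟩
  simp only [Finset.mem_filter, Finset.mem_univ, true_and] at hi hmax
  refine ⟨i, hi, ?_⟩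
  rw [rk, cnt]
  congr 1
  refine Finset.filter_congr fun x _ => ⟨fun h => hi.trans (hV (hQ x) (hQ i) h), hmax x⟩

lemma rk_le_cnt {ι : Type*} [Fintype ι] {V : ℝ → ℝ} (hV : AntitoneOn V (Set.Ioo 0 1))
    {Q : ι → ℝ} (hQ : ∀ i, Q i ∈ Set.Ioo (0 : ℝ) 1) (i : ι) :
    rk Q i ≤ cnt (fun i => V (Q i)) (V (Q i)) := by
  refine Finset.card_le_card fun x hx => ?_
  simp only [Finset.mem_filter, Finset.mem_univ, true_and] at hx ⊢
  exact hV (hQ x) (hQ i) hx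

/-- Every price is represented by a sample with the same count and at least the same value, so
nearly optimal prices inherit the rank concentration of nearly optimal samples. -/
lemma deltaWorst_le_of_not_spread {V : ℝ → ℝ} (hV : AntitoneOn V (Set.Ioo 0 1))
    {Q : {j // j ∉ I} → ℝ} (hQ : ∀ i, Q i ∈ Set.Ioo (0 : ℝ) 1)
    (hreg : Regular c I fun i => V (Q i)) {v₀ D d : ℝ} (hv₀ : 0 < v₀) (hD : 0 < D)
    (hcD : c * N * D < Fintype.card {j // j ∉ I}) (ht : Q ∈ typical V I.card v₀ D)
    (hd : 0 ≤ d) (hs : Q ∉ spread V I.card d) :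
    deltaWorst (erm c) I (fun i => V (Q i)) ≤
      (2 * d + I.card) * D / Fintype.card {j // j ∉ I} := by
  set w : {j // j ∉ I} → ℝ := fun i => V (Q i) with hw
  have hne : Nonempty {j // j ∉ I} := Fintype.card_pos_iff.1 hreg.card_pos
  obtain ⟨r₀, hr₀⟩ := Finite.exists_max (rev V Q)
  -- Among the samples of maximal revenue the one with the largest quantile, as the strict
  -- inequality in `spread` demands.
  obtain ⟨r, hr, hrmax⟩ := Finset.exists_max_image
    (Finset.univ.filter fun r => ∀ i, rev V Q i ≤ rev V Q r) Q ⟨r₀, by simpa using hr₀⟩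
  simp only [Finset.mem_filter, Finset.mem_univ, true_and] at hr hrmax
  have hlow : ∀ i, Q r < Q i → rev V Q i < rev V Q r := by
    intro i hi
    refine lt_of_le_of_ne (hr i) fun he => ?_
    exact absurd (hrmax i fun x => he ▸ hr x) (not_le.2 hi)
  have hpos : 0 < V (Q r) := hreg.pos r
  have bound : ∀ p, 1 ≤ cnt w p → ∃ i, p ≤ V (Q i) ∧ rk Q i = cnt w p ∧
      p * cnt w p ≤ rev V Q i := by
    intro p hp
    obtain ⟨i, h1, h2⟩ := exists_rk_eq_cnt hV hQ hp
    refine ⟨i, h1, h2, ?_⟩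
    rw [rev, h2]
    exact mul_le_mul_of_nonneg_right h1 (Nat.cast_nonneg _)
  have hge : (rk Q r : ℝ) ≤ cnt w (V (Q r)) := by exact_mod_cast rk_le_cnt hV hQ r
  have hcr : (cnt w (V (Q r)) : ℝ) = rk Q r := by
    refine le_antisymm ?_ hge
    obtain ⟨i, -, -, h3⟩ := bound (V (Q r)) ((rk_pos Q r).trans_le (rk_le_cnt hV hQ r))
    exact le_of_mul_le_mul_left (h3.trans (hr i)) hpos
  have hM : ∀ p, p * cnt w p ≤ V (Q r) * cnt w (V (Q r)) := by
    intro p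
    rw [hcr]
    rcases Nat.eq_zero_or_pos (cnt w p) with h0 | h0
    · rw [h0]; simp only [Nat.cast_zero, mul_zero]; positivity
    · obtain ⟨i, -, -, h3⟩ := bound p h0
      exact h3.trans (hr i)
  have hn0 : (0 : ℝ) < Fintype.card {j // j ∉ I} := by exact_mod_cast hreg.card_pos
  obtain ⟨⟨i₀, hi₀⟩, htD⟩ := ht
  have hVr : V (Q r) ≤ D * v₀ := htD r fun i => (hr i).trans (by
    have := mul_nonneg (Nat.cast_nonneg (α := ℝ) I.card) hpos.le; linarith)
  -- Revenue at least v₀ n at a value of at most D v₀ needs rank at least n/D; in particular the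
  -- best price passes the guard.
  have hrk : (Fintype.card {j // j ∉ I} : ℝ) ≤ D * rk Q r := by
    have h1 : v₀ * Fintype.card {j // j ∉ I} ≤ D * v₀ * rk Q r :=
      (hi₀.trans (hr i₀)).trans (mul_le_mul_of_nonneg_right hVr (Nat.cast_nonneg _))
    refine le_of_mul_le_mul_left (h1.trans_eq ?_) hv₀
    ring
  have hg : c * N < cnt w (V (Q r)) := by
    rw [hcr]
    refine lt_of_mul_lt_mul_right (hcD.trans_le (hrk.trans_eq (mul_comm _ _))) hD.le
  refine (hreg.deltaWorst_le_of_near hM hg (d := d) fun p hp hnear => ?_).trans ?_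
  · obtain ⟨i, h1, h2, h3⟩ := bound p hp
    rw [hcr, ← h2]
    by_contra hlt
    push Not at hlt
    refine hs ⟨r, hr, hlow, i, ?_, hlt⟩
    rw [hcr, ← h2] at hnear
    refine le_trans hnear ?_
    rw [rev]
    have := mul_le_mul_of_nonneg_right h1
      (by positivity : (0 : ℝ) ≤ (rk Q i : ℝ) + I.card)
    linarith
  · rw [hcr, div_le_div_iff₀ (by exact_mod_cast rk_pos Q r) hn0]
    have : 0 ≤ 2 * d + (I.card : ℝ) := by positivity
    nlinarith

end pointwise

end IncentiveAwareness

/-! ### The quantile coupling and averaging over dyadic resolutions -/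

namespace IncentiveAwareness

/-- A non-negative random variable is an antitone function of a uniform one. -/
lemma exists_quantile (F : Measure ℝ) [IsProbabilityMeasure F] (hF : ∀ᵐ x ∂F, 0 ≤ x) :
    ∃ V : ℝ → ℝ, (∀ q, 0 ≤ V q) ∧ AntitoneOn V (Set.Ioo 0 1) ∧ MeasurePreserving V unif F ∧
      ∀ q ∈ Set.Ioo (0 : ℝ) 1, ∀ t, V q ≤ t ↔ 1 - q ≤ cdf F t := by
  classical
  set S : ℝ → Set ℝ := fun q => {t | 0 ≤ t ∧ 1 - q ≤ cdf F t} with hS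
  set V : ℝ → ℝ := fun q => if q ∈ Set.Ioo (0 : ℝ) 1 then sInf (S q) else 0 with hV
  have hbdd : ∀ q, BddBelow (S q) := fun q => ⟨0, fun t ht => ht.1⟩
  have hne : ∀ q, 0 < q → (S q).Nonempty := by
    intro q hq
    have h1 := (tendsto_cdf_atTop F).eventually (lt_mem_nhds (by linarith : 1 - q < 1))
    obtain ⟨t, ht0, ht1⟩ := ((eventually_ge_atTop (0 : ℝ)).and h1).exists
    exact ⟨t, ht0, ht1.le⟩
  have hV0 : ∀ q, 0 ≤ V q := by
    intro q
    simp only [hV]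
    split_ifs with h
    · exact le_csInf (hne q h.1) fun t ht => ht.1
    · exact le_rfl
  have hneg : ∀ t, t < 0 → cdf F t = 0 := by
    intro t ht
    rw [cdf_eq_real, measureReal_def, (measure_eq_zero_iff_ae_notMem).2, ENNReal.toReal_zero]
    filter_upwards [hF] with x hx hxt
    exact absurd (Set.mem_Iic.1 hxt) (by linarith)
  have hgal : ∀ q ∈ Set.Ioo (0 : ℝ) 1, ∀ t, V q ≤ t ↔ 1 - q ≤ cdf F t := by
    intro q hq t
    have hVq : V q = sInf (S q) := by simp only [hV, if_pos hq]
    constructor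
    · intro h
      have ht0 : 0 ≤ t := (hV0 q).trans h
      -- The infimum defining `V q` satisfies the inequality itself, by right continuity of the
      -- distribution function.
      refine ge_of_tendsto (x := nhdsWithin t (Set.Ioi t))
        (((cdf F).right_continuous t).mono_left (nhdsWithin_mono t Set.Ioi_subset_Ici_self)) ?_
      filter_upwards [self_mem_nhdsWithin] with s hs
      obtain ⟨r, hr, hrs⟩ := exists_lt_of_csInf_lt (hne q hq.1)
        (by rw [← hVq]; exact lt_of_le_of_lt h hs)
      exact hr.2.trans (monotone_cdf F hrs.le)
    · intro h
      rcases lt_or_ge t 0 with ht | ht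
      · rw [hneg t ht] at h; linarith [hq.2]
      · rw [hVq]; exact csInf_le (hbdd q) ⟨ht, h⟩
  have hpre : ∀ t, 0 ≤ t → V ⁻¹' Set.Iic t =
      (Set.Ioo 0 1)ᶜ ∪ (Set.Ioo 0 1 ∩ Set.Ici (1 - cdf F t)) := by
    intro t ht
    ext q
    by_cases hq : q ∈ Set.Ioo (0 : ℝ) 1
    · simp only [Set.mem_preimage, Set.mem_Iic, Set.mem_union, Set.mem_compl_iff, hq, not_true,
        false_or, Set.mem_inter_iff, true_and, Set.mem_Ici]
      rw [hgal q hq]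
      constructor <;> intro h <;> linarith
    · have hVq : V q = 0 := if_neg hq
      simp [Set.mem_preimage, hVq, ht, Set.mem_compl_iff, hq]
  have hVm : Measurable V := by
    refine measurable_of_Iic fun t => ?_
    rcases lt_or_ge t 0 with ht | ht
    · have : V ⁻¹' Set.Iic t = ∅ := by
        ext q; simp only [Set.mem_preimage, Set.mem_Iic, Set.mem_empty_iff_false, iff_false, not_le]
        exact lt_of_lt_of_le ht (hV0 q)
      rw [this]; exact MeasurableSet.empty
    · rw [hpre t ht]
      exact measurableSet_Ioo.compl.union (measurableSet_Ioo.inter measurableSet_Ici)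
  refine ⟨V, hV0, ?_, ⟨hVm, ?_⟩, hgal⟩
  · intro p hp q hq hpq
    rw [hgal q hq]
    have := (hgal p hp (V p)).1 le_rfl
    linarith
  · have : IsProbabilityMeasure (unif.map V) := Measure.isProbabilityMeasure_map hVm.aemeasurable
    refine Measure.ext_of_Iic _ _ fun t => ?_
    rw [Measure.map_apply hVm measurableSet_Iic]
    rcases lt_or_ge t 0 with ht | ht
    · have h1 : V ⁻¹' Set.Iic t = ∅ := by
        ext q; simp only [Set.mem_preimage, Set.mem_Iic, Set.mem_empty_iff_false, iff_false, not_le]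
        exact lt_of_lt_of_le ht (hV0 q)
      rw [h1, measure_empty, ← ofReal_cdf, hneg t ht, ENNReal.ofReal_zero]
    · have hc0 := cdf_nonneg F t
      have hc1 := cdf_le_one F t
      have hmeas : MeasurableSet (V ⁻¹' Set.Iic t) := hVm measurableSet_Iic
      rw [unif, Measure.restrict_apply hmeas, hpre t ht, ← ofReal_cdf]
      have h2 : ((Set.Ioo 0 1)ᶜ ∪ (Set.Ioo 0 1 ∩ Set.Ici (1 - cdf F t))) ∩ Set.Ioo (0 : ℝ) 1 =
          Set.Ioo 0 1 ∩ Set.Ici (1 - cdf F t) := by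
        ext q; simp only [Set.mem_inter_iff, Set.mem_union, Set.mem_compl_iff]; tauto
      rw [h2]
      refine le_antisymm ?_ ?_
      · refine (measure_mono (t := Set.Icc (1 - cdf F t) 1) ?_).trans ?_
        · rintro q ⟨hq1, hq2⟩; exact ⟨hq2, hq1.2.le⟩
        · rw [Real.volume_Icc]; ring_nf; exact le_rfl
      · refine le_trans ?_ (measure_mono (s := Set.Ioo (1 - cdf F t) 1) ?_)
        · rw [Real.volume_Ioo]; ring_nf; exact le_rfl
        · rintro q ⟨hq1, hq2⟩; exact ⟨⟨by linarith, hq2⟩, hq1.le⟩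

/-- No measurability of `G` or of the `A k` is assumed: measurable hulls have the same measure and
only enlarge the indicators. -/
lemma integral_le_of_le_sum_indicator {Ω κ : Type*} [MeasurableSpace Ω] {μ : Measure Ω}
    [IsProbabilityMeasure μ] {f : Ω → ℝ} (hf : Integrable f μ) (s : Finset κ) (A : κ → Set Ω)
    (a : κ → ℝ) (ha : ∀ k ∈ s, 0 ≤ a k) (G : Set Ω) (b : ℝ)
    (h : ∀ᵐ x ∂μ, x ∈ G → f x ≤ b + ∑ k ∈ s, (A k).indicator (fun _ => a k) x)
    (h1 : ∀ᵐ x ∂μ, f x ≤ 1) (hb : 0 ≤ b) :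
    ∫ x, f x ∂μ ≤ μ.real Gᶜ + (b + ∑ k ∈ s, a k * μ.real (A k)) := by
  have hle : ∀ᵐ x ∂μ, f x ≤ (toMeasurable μ Gᶜ).indicator (fun _ => (1 : ℝ)) x +
      (b + ∑ k ∈ s, (toMeasurable μ (A k)).indicator (fun _ => a k) x) := by
    filter_upwards [h, h1] with x hx hx1
    have hmono : ∑ k ∈ s, (A k).indicator (fun _ => a k) x ≤
        ∑ k ∈ s, (toMeasurable μ (A k)).indicator (fun _ => a k) x :=
      Finset.sum_le_sum fun k hk => Set.indicator_le_indicator_of_subset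
        (subset_toMeasurable μ (A k)) (fun _ => ha k hk) x
    have hnn : 0 ≤ ∑ k ∈ s, (A k).indicator (fun _ => a k) x :=
      Finset.sum_nonneg fun k hk => Set.indicator_nonneg (fun _ _ => ha k hk) x
    by_cases hG : x ∈ G
    · have : 0 ≤ (toMeasurable μ Gᶜ).indicator (fun _ => (1 : ℝ)) x :=
        Set.indicator_nonneg (fun _ _ => zero_le_one) x
      linarith [hx hG]
    · rw [Set.indicator_of_mem (subset_toMeasurable μ _ hG)]
      linarith
  have i1 : Integrable ((toMeasurable μ Gᶜ).indicator (fun _ => (1 : ℝ))) μ :=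
    (integrable_const _).indicator (measurableSet_toMeasurable _ _)
  have i2 : ∀ k ∈ s, Integrable ((toMeasurable μ (A k)).indicator (fun _ => a k)) μ :=
    fun k _ => (integrable_const _).indicator (measurableSet_toMeasurable _ _)
  have i3 : Integrable (fun x => ∑ k ∈ s, (toMeasurable μ (A k)).indicator (fun _ => a k) x) μ :=
    integrable_finsetSum s i2
  have i4 : Integrable (fun x => b + ∑ k ∈ s, (toMeasurable μ (A k)).indicator (fun _ => a k) x) μ :=
    (integrable_const b).add i3
  refine (integral_mono_ae hf (i1.add i4) hle).trans (le_of_eq ?_)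
  rw [integral_add' i1 i4, integral_add (integrable_const b) i3, integral_finsetSum s i2,
    integral_indicator_const _ (measurableSet_toMeasurable _ _)]
  simp only [integral_indicator_const _ (measurableSet_toMeasurable _ _), measureReal_def,
    measure_toMeasurable, integral_const, measure_univ, ENNReal.toReal_one, smul_eq_mul, mul_one,
    one_mul]
  congr 2
  exact Finset.sum_congr rfl fun k _ => mul_comm _ _

lemma dyadic_bound_aux {S M b m D r l : ℝ} (hr : 0 < r) (hmr : 1 ≤ m) (hD : 1 ≤ D) (hl1 : 1 ≤ l)
    (hsum : S ≤ l ^ 2 * (32400 * (m * D ^ 2 * l / r))) (hbase : b ≤ 144 * (D * l / r))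
    (hmn : M ≤ m * D / r) : b + M + S ≤ 33000 * (m * D ^ 2 * (l ^ 2) ^ 2 / r) := by
  set u : ℝ := m * D ^ 2 / r with hu
  have hu0 : 0 ≤ u := by positivity
  have c1 : D * l / r ≤ u * l := by
    rw [hu, div_mul_eq_mul_div]
    refine div_le_div_of_nonneg_right ?_ hr.le
    have : D ≤ m * D ^ 2 := by nlinarith
    nlinarith
  have c2 : m * D / r ≤ u := by
    refine div_le_div_of_nonneg_right ?_ hr.le
    exact mul_le_mul_of_nonneg_left (le_self_pow₀ hD two_ne_zero) (by linarith)
  have c3 : m * D ^ 2 * l / r = u * l := by rw [hu]; ring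
  have c4 : m * D ^ 2 * (l ^ 2) ^ 2 / r = u * l ^ 4 := by rw [hu]; ring
  rw [c3] at hsum
  rw [c4]
  have d1 : l ≤ l ^ 4 := le_self_pow₀ hl1 (by norm_num)
  have d3 : l ^ 3 ≤ l ^ 4 := pow_le_pow_right₀ hl1 (by norm_num)
  have d4 : (1 : ℝ) ≤ l ^ 4 := one_le_pow₀ hl1
  have f1 := mul_le_mul_of_nonneg_left d1 hu0
  have f3 := mul_le_mul_of_nonneg_left d3 hu0
  have f4 := mul_le_mul_of_nonneg_left d4 hu0
  have e1 : l ^ 2 * (32400 * (u * l)) = 32400 * (u * l ^ 3) := by ring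
  linarith

section expectation
variable {N : ℕ} {I : Finset (Fin N)} {c : ℝ}

lemma DeltaWorst_le_one (F : Measure ℝ) [IsProbabilityMeasure F]
    (hreg : ∀ᵐ w ∂(lawOutside F I), Regular c I w) : DeltaWorst (erm c) F I ≤ 1 := by
  have hp : IsProbabilityMeasure (lawOutside F I) := by unfold lawOutside; infer_instance
  refine (integral_mono_ae (integrable_deltaWorst F hreg) (integrable_const 1)
    (hreg.mono fun w hw => hw.deltaWorst_le_one)).trans ?_
  simp

/-- A layer-cake sum over resolutions K = 2^a. Failure at resolution K costs about D/K and has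
probability proportional to K, so all scales contribute equally. There are at most log n scales,
each of order m D² √(log n) / √n. -/
lemma DeltaWorst_le (F : Measure ℝ) [IsProbabilityMeasure F] {V : ℝ → ℝ} (hV0 : ∀ q, 0 ≤ V q)
    (hVa : AntitoneOn V (Set.Ioo 0 1)) (hVp : MeasurePreserving V unif F)
    (hreg : ∀ᵐ w ∂(lawOutside F I), Regular c I w) {v₀ D : ℝ} (hv₀ : 0 < v₀) (hD : 1 ≤ D)
    (hn : 3 ≤ Fintype.card {j // j ∉ I}) (hm1 : 1 ≤ I.card)
    (hm : I.card * D ≤ (Fintype.card {j // j ∉ I} : ℝ) / 2)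
    (hcD : c * N * D < Fintype.card {j // j ∉ I}) :
    DeltaWorst (erm c) F I ≤
      (Measure.pi fun _ : {j // j ∉ I} => unif).real (typical V I.card v₀ D)ᶜ +
      33000 * (I.card * D ^ 2 * Real.log (Fintype.card {j // j ∉ I}) ^ 2 /
        √(Fintype.card {j // j ∉ I})) := by
  set n : ℝ := (Fintype.card {j // j ∉ I} : ℝ) with hndef
  set m : ℝ := (I.card : ℝ) with hmdef
  have hn3 : (3 : ℝ) ≤ n := by rw [hndef]; exact_mod_cast hn
  have hlog : 1 ≤ Real.log n := by
    rw [Real.le_log_iff_exp_le (by linarith)]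
    have := Real.exp_one_lt_d9
    linarith
  set l := √(Real.log n) with hl
  have hl1 : 1 ≤ l := by rw [hl]; exact Real.one_le_sqrt.2 hlog
  have hl2 : l ^ 2 = Real.log n := Real.sq_sqrt (by linarith)
  have hs0 : 0 < √n := Real.sqrt_pos.2 (by linarith)
  have hs2 : √n ^ 2 = n := Real.sq_sqrt (by linarith)
  have hs1 : 1 ≤ √n := Real.one_le_sqrt.2 (by linarith)
  have hmr : (1 : ℝ) ≤ m := by rw [hmdef]; exact_mod_cast hm1
  rw [← hl2]
  -- The finest resolution for which 16 K² log n ≤ n. When it is below 12 D, the claimed bound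
  -- already exceeds 1.
  set x : ℝ := √n / (4 * l) with hx
  have hx0 : 0 < x := by positivity
  rcases lt_or_ge x (12 * D) with hsmall | hbig
  · refine (DeltaWorst_le_one F hreg).trans ?_
    have h1 : √n ≤ 48 * D * l := by
      rw [hx, div_lt_iff₀ (by positivity)] at hsmall
      linarith
    have h2 : 1 ≤ 33000 * (m * D ^ 2 * (l ^ 2) ^ 2 / √n) := by
      rw [← mul_div_assoc, le_div_iff₀ hs0]
      have h3 : D * l ≤ m * D ^ 2 * (l ^ 2) ^ 2 := by
        have h4 : 1 ≤ m * D * l ^ 3 := by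
          have : 1 ≤ l ^ 3 := one_le_pow₀ hl1
          have : 1 ≤ m * D := by nlinarith
          nlinarith
        calc D * l = D * l * 1 := by ring
          _ ≤ D * l * (m * D * l ^ 3) := mul_le_mul_of_nonneg_left h4 (by positivity)
          _ = _ := by ring
      nlinarith [mul_pos (by linarith : 0 < D) (by linarith : 0 < l)]
    linarith [measureReal_nonneg (μ := Measure.pi fun _ : {j // j ∉ I} => unif)
      (s := (typical V I.card v₀ D)ᶜ)]
  · have hVm := hVp.measurable
    set μ := (Measure.pi fun _ : {j // j ∉ I} => unif) with hμ
    have hpres : MeasurePreserving (fun (Q : {j // j ∉ I} → ℝ) i => V (Q i)) μ (lawOutside F I) :=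
      measurePreserving_pi (fun _ => unif) (fun _ => F) fun _ => hVp
    have hint := integrable_deltaWorst F hreg
    have hreg' : ∀ᵐ Q ∂μ, Regular c I fun i => V (Q i) :=
      hpres.quasiMeasurePreserving.ae hreg
    obtain ⟨a', ha'1, ha'2⟩ := exists_nat_pow_near (by linarith : 1 ≤ 6 * D) one_lt_two
    set a₀ := a' + 1 with ha₀
    have ha₀2 : (2 : ℝ) ^ a₀ ≤ 12 * D := by rw [ha₀, pow_succ]; linarith
    obtain ⟨A, hA1, hA2⟩ := exists_nat_pow_near (by linarith : 1 ≤ x) one_lt_two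
    have ha₀A : a₀ ≤ A := by
      have : (2 : ℝ) ^ a₀ < 2 ^ (A + 1) := by linarith
      have := (pow_lt_pow_iff_right₀ (one_lt_two (α := ℝ))).1 this
      omega
    set bad : ℕ → Set ({j // j ∉ I} → ℝ) := fun a =>
      spread V I.card (9 * n / ((2 ^ a : ℕ) : ℝ)) ∩ typical V I.card v₀ D with hbad
    have hprob : ∀ a ∈ Finset.Icc a₀ A, (36 * D / 2 ^ a) * μ.real (bad a) ≤
        32400 * (m * D ^ 2 * l / √n) := by
      intro a ha
      rw [Finset.mem_Icc] at ha
      have h1 : (2 : ℝ) ^ a₀ ≤ 2 ^ a := pow_le_pow_right₀ one_le_two ha.1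
      have h2 : (2 : ℝ) ^ a ≤ 2 ^ A := pow_le_pow_right₀ one_le_two ha.2
      have h3 := real_spread_le (ι := {j // j ∉ I}) hV0 hVm (m := I.card) (K := 2 ^ a) hv₀ hn hm1
        hD hm (by push_cast; linarith) (by
          rw [← hndef]
          push_cast
          have h4 : (2 : ℝ) ^ a ≤ √n / (4 * l) := by linarith
          rw [le_div_iff₀ (by positivity)] at h4
          have h5 := pow_le_pow_left₀ (by positivity) h4 2
          rw [hs2, mul_pow, mul_pow, hl2] at h5
          linarith)
      rw [← hndef, ← hmdef, ← hl] at h3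
      have h6 : (0 : ℝ) < 2 ^ a := by positivity
      calc (36 * D / 2 ^ a) * μ.real (bad a)
          ≤ (36 * D / 2 ^ a) * (900 * (m * D) * ((2 ^ a : ℕ) : ℝ) * l / √n) :=
            mul_le_mul_of_nonneg_left h3 (by positivity)
        _ = _ := by push_cast; field_simp; ring
    have hpt : ∀ᵐ Q ∂μ, Q ∈ typical V I.card v₀ D →
        deltaWorst (erm c) I (fun i => V (Q i)) ≤ (18 * D / 2 ^ A + m * D / n) +
          ∑ a ∈ Finset.Icc a₀ A, (bad a).indicator (fun _ => 36 * D / 2 ^ a) Q := by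
      filter_upwards [hreg', ae_unif_pi (ι := {j // j ∉ I})] with Q hR hQ hty
      have good : ∀ a, Q ∉ bad a → deltaWorst (erm c) I (fun i => V (Q i)) ≤
          18 * D / 2 ^ a + m * D / n := by
        intro a hQa
        have hns : Q ∉ spread V I.card (9 * n / ((2 ^ a : ℕ) : ℝ)) := fun h => hQa ⟨h, hty⟩
        refine (deltaWorst_le_of_not_spread hVa hQ hR hv₀ (by linarith) hcD hty
          (by positivity) hns).trans (le_of_eq ?_)
        rw [← hndef, ← hmdef]
        have : n ≠ 0 := by linarith
        push_cast
        field_simp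
        ring
      have ind : ∀ B, a₀ ≤ B → deltaWorst (erm c) I (fun i => V (Q i)) ≤
          (18 * D / 2 ^ B + m * D / n) +
          ∑ a ∈ Finset.Icc a₀ B, (bad a).indicator (fun _ => 36 * D / 2 ^ a) Q := by
        intro B hB
        have hmDn : 0 ≤ m * D / n := by positivity
        have hsum0 : ∀ B, 0 ≤ ∑ a ∈ Finset.Icc a₀ B,
            (bad a).indicator (fun _ => 36 * D / 2 ^ a) Q := fun B =>
          Finset.sum_nonneg fun a _ => Set.indicator_nonneg (fun _ _ => by positivity) _
        induction B, hB using Nat.le_induction with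
        | base =>
          by_cases hb : Q ∈ bad a₀
          · rw [Finset.Icc_self, Finset.sum_singleton, Set.indicator_of_mem hb]
            have h1 : 1 ≤ 36 * D / 2 ^ a₀ := by
              -- At the coarsest scale 2^a₀ ≤ 12 D, so the indicator weight alone exceeds the
              -- trivial bound 1.
              rw [le_div_iff₀ (by positivity)]; linarith
            have h2 : 0 ≤ 18 * D / 2 ^ a₀ := by positivity
            linarith [hR.deltaWorst_le_one]
          · linarith [good a₀ hb, hsum0 a₀]
        | succ B hB ih =>
          by_cases hb : Q ∈ bad (B + 1)
          · rw [Finset.sum_Icc_succ_top (by omega), Set.indicator_of_mem hb]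
            -- The weight of a failure at scale B + 1 is exactly the bound available at scale B.
            have h1 : 36 * D / 2 ^ (B + 1) = 18 * D / 2 ^ B := by
              rw [pow_succ]; field_simp; ring
            have h2 : 0 ≤ 18 * D / 2 ^ (B + 1) := by positivity
            linarith
          · linarith [good (B + 1) hb, hsum0 (B + 1)]
      exact ind A ha₀A
    have hE : DeltaWorst (erm c) F I = ∫ Q, deltaWorst (erm c) I (fun i => V (Q i)) ∂μ := by
      rw [DeltaWorst, ← hpres.map_eq, integral_map hpres.measurable.aemeasurable]
      rw [hpres.map_eq]; exact hint.aestronglyMeasurable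
    have hint' : Integrable (fun Q : {j // j ∉ I} → ℝ =>
        deltaWorst (erm c) I (fun i => V (Q i))) μ :=
      hpres.integrable_comp_of_integrable hint
    have hfin := integral_le_of_le_sum_indicator hint' (Finset.Icc a₀ A) bad
      (fun a => 36 * D / 2 ^ a) (fun a _ => by positivity) _ _ hpt
      (hreg'.mono fun Q hQ => hQ.deltaWorst_le_one) (by positivity)
    rw [hE]
    refine hfin.trans ?_
    refine add_le_add le_rfl ?_
    have hA3 : (A : ℝ) ≤ l ^ 2 := by
      have h1 : (2 : ℝ) ^ A ≤ √n := by
        refine hA1.trans ?_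
        rw [hx]
        exact div_le_self hs0.le (by linarith)
      have h2 : (2 : ℝ) ^ (2 * A) ≤ n := by
        rw [pow_mul', ← hs2]; exact pow_le_pow_left₀ (by positivity) h1 2
      have h3 := Real.log_le_log (by positivity) h2
      rw [Real.log_pow] at h3
      push_cast at h3
      have h4 := Real.log_two_gt_d9
      have h5 : (0 : ℝ) ≤ A := Nat.cast_nonneg A
      rw [hl2]
      nlinarith
    have hcardA : ((Finset.Icc a₀ A).card : ℝ) ≤ A := by
      have : (Finset.Icc a₀ A).card ≤ A := by rw [Nat.card_Icc]; omega
      exact_mod_cast this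
    have hsum : ∑ a ∈ Finset.Icc a₀ A, (36 * D / 2 ^ a) * μ.real (bad a) ≤
        l ^ 2 * (32400 * (m * D ^ 2 * l / √n)) := by
      refine (Finset.sum_le_card_nsmul _ _ _ hprob).trans ?_
      rw [nsmul_eq_mul]
      exact mul_le_mul_of_nonneg_right (hcardA.trans hA3) (by positivity)
    have hbase : 18 * D / 2 ^ A ≤ 144 * (D * l / √n) := by
      have h1 : x ≤ 2 * 2 ^ A := by rw [pow_succ] at hA2; linarith
      rw [hx, div_le_iff₀ (by positivity)] at h1
      rw [← mul_div_assoc, div_le_div_iff₀ (by positivity) hs0]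
      have h2 := mul_le_mul_of_nonneg_left h1 (by linarith : 0 ≤ 18 * D)
      linarith
    have hmn : m * D / n ≤ m * D / √n := by
      refine div_le_div_of_nonneg_left (by positivity) hs0 ?_
      nlinarith
    exact dyadic_bound_aux hs0 hmr hD hl1 hsum hbase hmn

end expectation

end IncentiveAwareness

namespace IncentiveAwareness

/-! ### Chebyshev's inequality for sums over the sample -/

section chebyshev
variable {ι : Type*} [Fintype ι]

lemma real_abs_sum_sub_ge_le (ν : Measure ℝ) [IsProbabilityMeasure ν] {g : ℝ → ℝ} (hg : MemLp g 2 ν)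
    (hι : 0 < Fintype.card ι) {ε : ℝ} (hε : 0 < ε) :
    (Measure.pi fun _ : ι => ν).real
      {Q | ε * Fintype.card ι ≤ |∑ i, g (Q i) - Fintype.card ι * ∫ q, g q ∂ν|} ≤
      (∫ q, g q ^ 2 ∂ν) / (Fintype.card ι * ε ^ 2) := by
  set n : ℝ := (Fintype.card ι : ℝ) with hn
  have hn0 : 0 < n := by rw [hn]; exact_mod_cast hι
  have hmp : ∀ i : ι, MeasurePreserving (fun Q : ι → ℝ => Q i) (Measure.pi fun _ : ι => ν) ν :=
    fun i => measurePreserving_eval (fun _ : ι => ν) i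
  have hLp : ∀ i : ι, MemLp (fun Q : ι → ℝ => g (Q i)) 2 (Measure.pi fun _ : ι => ν) :=
    fun i => hg.comp_measurePreserving (hmp i)
  have hsum : MemLp (fun Q : ι → ℝ => ∑ i, g (Q i)) 2 (Measure.pi fun _ : ι => ν) :=
    memLp_finsetSum _ fun i _ => hLp i
  have hE : ∫ Q : ι → ℝ, ∑ i, g (Q i) ∂(Measure.pi fun _ : ι => ν) = n * ∫ q, g q ∂ν := by
    rw [integral_finsetSum _ fun i _ => (hLp i).integrable one_le_two]
    have : ∀ i : ι, ∫ Q : ι → ℝ, g (Q i) ∂(Measure.pi fun _ : ι => ν) = ∫ q, g q ∂ν := by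
      intro i
      have h1 := integral_map (μ := Measure.pi fun _ : ι => ν) (f := g)
        (hmp i).measurable.aemeasurable (by rw [(hmp i).map_eq]; exact hg.aestronglyMeasurable)
      rw [(hmp i).map_eq] at h1
      exact h1.symm
    simp [this, hn]
  have hVar : Var[fun Q : ι → ℝ => ∑ i, g (Q i); Measure.pi fun _ : ι => ν] ≤
      n * ∫ q, g q ^ 2 ∂ν := by
    have h1 := variance_sum_pi (μ := fun _ : ι => ν) (X := fun _ : ι => g) (fun _ => hg)
    have h2 : (∑ i : ι, fun Q : ι → ℝ => g (Q i)) = fun Q : ι → ℝ => ∑ i, g (Q i) := by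
      ext Q; simp
    rw [h2] at h1
    rw [h1, Finset.sum_const, nsmul_eq_mul, Finset.card_univ]
    exact mul_le_mul_of_nonneg_left (variance_le_expectation_sq hg.aestronglyMeasurable) hn0.le
  have hch := meas_ge_le_variance_div_sq hsum (mul_pos hε hn0)
  rw [hE] at hch
  have h3 := ENNReal.toReal_mono ENNReal.ofReal_ne_top hch
  rw [ENNReal.toReal_ofReal (div_nonneg (variance_nonneg _ _) (sq_nonneg _))] at h3
  refine h3.trans ?_
  rw [div_le_div_iff₀ (by positivity) (by positivity)]
  have h4 : 0 ≤ n * ε ^ 2 := by positivity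
  have h5 := mul_le_mul_of_nonneg_right hVar h4
  refine h5.trans_eq ?_
  ring

end chebyshev

/-! ### The logarithmic tail and monotone hazard rates -/

lemma unif_real_Iio {a : ℝ} (h0 : 0 ≤ a) (h1 : a ≤ 1) : unif.real (Set.Iio a) = a := by
  rw [unif, measureReal_restrict_apply measurableSet_Iio]
  have : Set.Iio a ∩ Set.Ioo (0 : ℝ) 1 = Set.Ioo 0 a := by
    ext q; simp only [Set.mem_inter_iff, Set.mem_Iio, Set.mem_Ioo]
    constructor
    · rintro ⟨h2, h3, h4⟩; exact ⟨h3, h2⟩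
    · rintro ⟨h2, h3⟩; exact ⟨h3, h2, by linarith⟩
  rw [this, Measure.real, Real.volume_Ioo, ENNReal.toReal_ofReal (by linarith)]
  ring

/-- An integrable majorant, with integral 32, for the second moment needed in Chebyshev's
inequality. -/
lemma neg_log_sq_le {q : ℝ} (hq : q ∈ Set.Ioo (0 : ℝ) 1) :
    (-Real.log q) ^ 2 ≤ 16 * q ^ (-(1 / 2) : ℝ) := by
  have h1 : 0 < -Real.log q := neg_pos.2 (Real.log_neg hq.1 hq.2)
  have h2 := Real.log_le_rpow_div (x := q⁻¹) (inv_nonneg.2 hq.1.le) (ε := 1 / 4) (by norm_num)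
  rw [Real.log_inv, Real.inv_rpow hq.1.le, ← Real.rpow_neg hq.1.le] at h2
  have h3 : 0 ≤ q ^ (-(1 / 4) : ℝ) := Real.rpow_nonneg hq.1.le _
  have h4 : -Real.log q ≤ 4 * q ^ (-(1 / 4) : ℝ) := by linarith
  have h5 := pow_le_pow_left₀ h1.le h4 2
  have h6 : (q ^ (-(1 / 4) : ℝ)) ^ 2 = q ^ (-(1 / 2) : ℝ) := by
    rw [← Real.rpow_natCast, ← Real.rpow_mul hq.1.le]; norm_num
  rw [mul_pow, h6] at h5
  linarith

/-- The part of `-log` above height `3`. -/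
noncomputable def tailLog : ℝ → ℝ := (Set.Iic (Real.exp (-3))).indicator fun q => -Real.log q

lemma measurable_tailLog : Measurable tailLog :=
  (Real.measurable_log.neg).indicator measurableSet_Iic

lemma tailLog_nonneg {q : ℝ} (hq : q ∈ Set.Ioo (0 : ℝ) 1) : 0 ≤ tailLog q :=
  Set.indicator_apply_nonneg fun _ => neg_nonneg.2 (Real.log_nonpos hq.1.le hq.2.le)

lemma ae_unif : ∀ᵐ q ∂unif, q ∈ Set.Ioo (0 : ℝ) 1 := ae_restrict_mem measurableSet_Ioo

lemma tailLog_sq_le {q : ℝ} (hq : q ∈ Set.Ioo (0 : ℝ) 1) :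
    tailLog q ^ 2 ≤ 16 * q ^ (-(1 / 2) : ℝ) := by
  unfold tailLog
  by_cases h : q ∈ Set.Iic (Real.exp (-3))
  · rw [Set.indicator_of_mem h]; exact neg_log_sq_le hq
  · rw [Set.indicator_of_notMem h]
    have : 0 ≤ q ^ (-(1 / 2) : ℝ) := Real.rpow_nonneg hq.1.le _
    simp only [ne_eq, OfNat.ofNat_ne_zero, not_false_eq_true, zero_pow]; linarith

lemma integrable_rpow_unif : Integrable (fun q : ℝ => 16 * q ^ (-(1 / 2) : ℝ)) unif := by
  refine Integrable.const_mul ?_ 16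
  have h := intervalIntegral.intervalIntegrable_rpow' (a := 0) (b := 1) (r := -(1 / 2))
    (by norm_num)
  rw [intervalIntegrable_iff_integrableOn_Ioo_of_le zero_le_one] at h
  exact h

lemma integral_tailLog_sq_le : MemLp tailLog 2 unif ∧ ∫ q, tailLog q ^ 2 ∂unif ≤ 32 := by
  have hae : ∀ᵐ q ∂unif, tailLog q ^ 2 ≤ 16 * q ^ (-(1 / 2) : ℝ) :=
    ae_unif.mono fun q hq => tailLog_sq_le hq
  have hint : Integrable (fun q => tailLog q ^ 2) unif := by
    refine integrable_rpow_unif.mono' (measurable_tailLog.pow_const 2).aestronglyMeasurable ?_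
    filter_upwards [hae] with q hq
    rw [Real.norm_of_nonneg (sq_nonneg _)]; exact hq
  refine ⟨(memLp_two_iff_integrable_sq measurable_tailLog.aestronglyMeasurable).2 hint,
    (integral_mono_ae hint integrable_rpow_unif hae).trans ?_⟩
  rw [integral_const_mul, unif, ← integral_Ioc_eq_integral_Ioo,
    ← intervalIntegral.integral_of_le zero_le_one, integral_rpow (Or.inl (by norm_num))]
  norm_num

lemma integral_tailLog : ∫ q, tailLog q ∂unif = 4 * Real.exp (-3) := by
  have he0 := Real.exp_pos (-3)
  have he1 : Real.exp (-3) < 1 := (Real.exp_lt_exp.2 (by norm_num : _ < (0 : ℝ))).trans_eq Real.exp_zero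
  unfold tailLog
  rw [integral_indicator measurableSet_Iic, unif, Measure.restrict_restrict measurableSet_Iic]
  have : Set.Iic (Real.exp (-3)) ∩ Set.Ioo (0 : ℝ) 1 = Set.Ioc 0 (Real.exp (-3)) := by
    ext q; simp only [Set.mem_inter_iff, Set.mem_Iic, Set.mem_Ioo, Set.mem_Ioc]
    constructor
    · rintro ⟨h2, h3, h4⟩; exact ⟨h3, h2⟩
    · rintro ⟨h2, h3⟩; exact ⟨h3, h2, by linarith⟩
  rw [this, ← intervalIntegral.integral_of_le he0.le, intervalIntegral.integral_neg, integral_log,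
    Real.log_exp]
  simp; ring

lemma tendsto_mul_le {A B x : ℝ} (h : ∀ᶠ k : ℕ in atTop, A * (1 + x / k) ^ k ≤ B) :
    A * Real.exp x ≤ B :=
  le_of_tendsto ((Real.tendsto_one_add_div_pow_exp x).const_mul A) h

/-- A Grönwall inequality without derivatives: subdivide [a, b] into k equal steps, multiply the
one-step bounds, and let k tend to infinity. -/
lemma exp_growth_le {S : ℝ → ℝ} {a b x : ℝ} (hab : a ≤ b)
    (h : ∀ y z, a ≤ y → y ≤ z → z ≤ b → S y * (1 + x * (z - y)) ≤ S z) :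
    S a * Real.exp (x * (b - a)) ≤ S b := by
  refine tendsto_mul_le ?_
  have hlim : Tendsto (fun k : ℕ => 1 + x * (b - a) / k) atTop (nhds (1 + 0)) :=
    tendsto_const_nhds.add (tendsto_const_div_atTop_nhds_zero_nat _)
  have hpos := hlim.eventually (lt_mem_nhds (by norm_num : (0 : ℝ) < 1 + 0))
  filter_upwards [hpos, eventually_gt_atTop 0] with k hk hk0
  have hkr : (0 : ℝ) < k := by exact_mod_cast hk0
  have ind : ∀ i : ℕ, i ≤ k → S a * (1 + x * (b - a) / k) ^ i ≤ S (a + i * ((b - a) / k)) := by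
    intro i
    induction i with
    | zero => intro _; simp
    | succ i ih =>
      intro hi
      have h1 := ih (by omega)
      have hir : ((i : ℝ) + 1) ≤ k := by exact_mod_cast hi
      have hd : 0 ≤ (b - a) / k := div_nonneg (by linarith) hkr.le
      have h2 := h (a + i * ((b - a) / k)) (a + (i + 1 : ℕ) * ((b - a) / k))
        (by have : 0 ≤ (i : ℝ) * ((b - a) / k) := by positivity
            linarith)
        (by push_cast; nlinarith)
        (by push_cast
            have := mul_le_mul_of_nonneg_right hir hd
            have h3 : (k : ℝ) * ((b - a) / k) = b - a := by field_simp
            linarith)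
      have h4 : 1 + x * (a + (i + 1 : ℕ) * ((b - a) / k) - (a + i * ((b - a) / k))) =
          1 + x * (b - a) / k := by push_cast; ring
      rw [h4] at h2
      rw [pow_succ, ← mul_assoc]
      exact (mul_le_mul_of_nonneg_right h1 hk.le).trans h2
  have h5 := ind k le_rfl
  have h6 : a + k * ((b - a) / k) = b := by field_simp; ring
  rwa [h6] at h5

/-- The only facts about monotone hazard rate distributions that are needed. -/
lemma IsMHR.exists_scale {F : Measure ℝ} [IsProbabilityMeasure F] (hF : IsMHR F) :
    F {0} = 0 ∧ ∃ v > 0, cdf F v = 1 - Real.exp (-1) ∧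
      ∀ t, 1 ≤ t → 1 - cdf F (t * v) ≤ Real.exp (-t) := by
  obtain ⟨h0, f, hfm, hf0, hFf, hmono⟩ := hF
  have hac : F ≪ volume := by rw [hFf]; exact withDensity_absolutelyContinuous _ _
  have hatom : ∀ x, F {x} = 0 := fun x => hac Real.volume_singleton
  refine ⟨hatom 0, ?_⟩
  set S : ℝ → ℝ := fun x => 1 - cdf F x with hS
  have hSanti : Antitone S := fun x y h => sub_le_sub_left (monotone_cdf F h) 1
  have hdiff : ∀ a b, a ≤ b → F (Set.Ioc a b) = ENNReal.ofReal (S a - S b) := by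
    intro a b _
    conv_lhs => rw [← measure_cdf F]
    rw [StieltjesFunction.measure_Ioc]
    congr 1; simp only [hS]; ring
  set haz : ℝ → ℝ := fun x => f x / S x with hhaz
  have hmono' : ∀ x y, x ≤ y → 0 < S y → haz x ≤ haz y := by
    intro x y hxy hy
    have hx : 0 < S x := hy.trans_le (hSanti hxy)
    exact hmono (by simp only [hS] at hx; simp only [Set.mem_ofPred_eq]; linarith)
      (by simp only [hS] at hy; simp only [Set.mem_ofPred_eq]; linarith) hxy
  have hhaz0 : ∀ x, 0 < S x → 0 ≤ haz x := fun x hx => div_nonneg (hf0 x) hx.le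
  have hfeq : ∀ x, 0 < S x → f x = haz x * S x := fun x hx => by
    simp only [hhaz]; field_simp
  -- `hlow` and `hupp` are the differential relation S' = -haz · S in integrated form, with
  -- monotonicity of the hazard rate and of S already used.
  have hlow : ∀ a b, a ≤ b → 0 < S b → haz a * S b * (b - a) ≤ S a - S b := by
    intro a b hab hb
    have ha := hb.trans_le (hSanti hab)
    have h1 : ENNReal.ofReal (haz a * S b * (b - a)) ≤ F (Set.Ioc a b) := by
      rw [hFf, withDensity_apply _ measurableSet_Ioc]
      calc ENNReal.ofReal (haz a * S b * (b - a))
          = ∫⁻ _ in Set.Ioc a b, ENNReal.ofReal (haz a * S b) := by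
            rw [setLIntegral_const, Real.volume_Ioc, ENNReal.ofReal_mul
              (mul_nonneg (hhaz0 a ha) hb.le)]
        _ ≤ _ := by
            refine setLIntegral_mono hfm.ennreal_ofReal fun x hx => ENNReal.ofReal_le_ofReal ?_
            have hx0 : 0 < S x := hb.trans_le (hSanti hx.2)
            rw [hfeq x hx0]
            exact mul_le_mul (hmono' a x hx.1.le hx0) (hSanti hx.2) hb.le (hhaz0 x hx0)
    rw [hdiff a b hab] at h1
    exact (ENNReal.ofReal_le_ofReal_iff (by linarith [hSanti hab])).1 h1
  have hupp : ∀ a b, a ≤ b → 0 < S b → S a - S b ≤ haz b * S a * (b - a) := by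
    intro a b hab hb
    have ha := hb.trans_le (hSanti hab)
    have h1 : F (Set.Ioc a b) ≤ ENNReal.ofReal (haz b * S a * (b - a)) := by
      rw [hFf, withDensity_apply _ measurableSet_Ioc]
      calc _ ≤ ∫⁻ _ in Set.Ioc a b, ENNReal.ofReal (haz b * S a) := by
            refine setLIntegral_mono measurable_const fun x hx => ENNReal.ofReal_le_ofReal ?_
            have hx0 : 0 < S x := hb.trans_le (hSanti hx.2)
            rw [hfeq x hx0]
            exact mul_le_mul (hmono' x b hx.2 hb) (hSanti hx.1.le) hx0.le (hhaz0 b hb)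
        _ = ENNReal.ofReal (haz b * S a * (b - a)) := by
            rw [setLIntegral_const, Real.volume_Ioc, ENNReal.ofReal_mul
              (mul_nonneg (hhaz0 b hb) ha.le)]
    rw [hdiff a b hab] at h1
    refine (ENNReal.ofReal_le_ofReal_iff ?_).1 h1
    exact mul_nonneg (mul_nonneg (hhaz0 b hb) ha.le) (by linarith)
  have hcont : Continuous (cdf F) := by
    rw [continuous_iff_continuousAt]
    intro x
    rw [(cdf F).mono.continuousAt_iff_leftLim_eq_rightLim, (cdf F).rightLim_eq]
    have h1 := (cdf F).measure_singleton x
    rw [measure_cdf, hatom x] at h1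
    have h2 := ENNReal.ofReal_eq_zero.1 h1.symm
    have h3 := (cdf F).mono.leftLim_le le_rfl (x := x)
    linarith
  have hS0 : cdf F 0 = 0 := by
    rw [cdf_eq_real, measureReal_def, (measure_eq_zero_iff_ae_notMem).2, ENNReal.toReal_zero]
    have h1 : ∀ᵐ x ∂F, x ≠ 0 := by
      rw [ae_iff]; simpa using hatom 0
    filter_upwards [h0, h1] with x hx hx1 hx2
    exact hx1 (le_antisymm hx2 hx)
  have he0 := Real.exp_pos (-1)
  have he1 : Real.exp (-1) < 1 := (Real.exp_lt_exp.2 (by norm_num : _ < (0 : ℝ))).trans_eq Real.exp_zero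
  obtain ⟨u, hu⟩ := ((tendsto_cdf_atTop F).eventually
    (lt_mem_nhds (by linarith : 1 - Real.exp (-1) < 1))).exists
  have hu0 : 0 ≤ u := by
    by_contra hn
    push Not at hn
    have := monotone_cdf F hn.le
    linarith
  obtain ⟨v, hv, hcv⟩ := intermediate_value_Icc hu0 hcont.continuousOn
    (show 1 - Real.exp (-1) ∈ Set.Icc (cdf F 0) (cdf F u) from ⟨by linarith, hu.le⟩)
  have hv0 : 0 < v := by
    rcases hv.1.lt_or_eq with h | h
    · exact h
    · rw [← h, hS0] at hcv; linarith
  refine ⟨v, hv0, hcv, fun t ht => ?_⟩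
  have hSv : S v = Real.exp (-1) := by simp only [hS]; linarith
  have hSvp : 0 < S v := by rw [hSv]; exact he0
  -- On [0, v] the hazard rate is at most haz v, so S(v) ≥ exp(-haz v · v); but S(v) = exp(-1).
  have hz1 : 1 ≤ haz v * v := by
    have h1 := exp_growth_le (S := S) (a := 0) (b := v) (x := -haz v) hv0.le (by
      intro y z hy hyz hz
      have hzp : 0 < S z := hSvp.trans_le (hSanti hz)
      have h2 := hupp y z hyz hzp
      have h3 := hmono' z v hz hSvp
      have hyp : 0 < S y := hzp.trans_le (hSanti hyz)
      have h4 := mul_le_mul_of_nonneg_right (mul_le_mul_of_nonneg_right h3 hyp.le)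
        (by linarith : 0 ≤ z - y)
      linarith)
    have h2 : S 0 = 1 := by simp only [hS, hS0]; ring
    rw [h2, one_mul, hSv, Real.exp_le_exp] at h1
    linarith
  have htv : v ≤ t * v := by nlinarith
  rcases le_or_gt (S (t * v)) 0 with hneg | hpos
  · exact hneg.trans (Real.exp_pos _).le
  -- Beyond v the hazard rate is at least haz v ≥ 1/v. Reflecting the axis turns this decay of S
  -- into the growth form of the lemma.
  · have h2 := exp_growth_le (S := fun y => S (-y)) (a := -(t * v)) (b := -v) (x := haz v)
      (by linarith) (by
      intro y z hy hyz hz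
      have hyp : 0 < S (-y) := hpos.trans_le (hSanti (by linarith))
      have hzp : 0 < S (-z) := hyp.trans_le (hSanti (by linarith))
      have h3 := hlow (-z) (-y) (by linarith) hyp
      have h4 := hmono' v (-z) (by linarith) hzp
      have h5 := mul_le_mul_of_nonneg_right (mul_le_mul_of_nonneg_right h4 hyp.le)
        (by linarith : 0 ≤ -y - -z)
      have h6 : haz v * S (-y) * (-y - -z) = S (-y) * (haz v * (z - y)) := by ring
      linarith)
    simp only [neg_neg, hSv] at h2
    have h7 : haz v * (-v - -(t * v)) = haz v * v * (t - 1) := by ring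
    rw [h7] at h2
    have h8 : t - 1 ≤ haz v * v * (t - 1) := le_mul_of_one_le_left (by linarith) hz1
    have h9 : S (t * v) * Real.exp (t - 1) ≤ Real.exp (-1) :=
      (mul_le_mul_of_nonneg_left (Real.exp_le_exp.2 h8) hpos.le).trans h2
    have h10 : Real.exp (-t) * Real.exp (t - 1) = Real.exp (-1) := by
      rw [← Real.exp_add]; ring_nf
    rw [← h10] at h9
    exact le_of_mul_le_mul_right h9 (Real.exp_pos _)

end IncentiveAwareness

namespace IncentiveAwareness

lemma exp_neg_three_le : Real.exp (-3) ≤ 1 / 20 := by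
  have h1 := Real.exp_one_gt_d9
  have h2 : Real.exp 3 = Real.exp 1 ^ 3 := by rw [← Real.exp_nat_mul]; norm_num
  rw [Real.exp_neg, ← one_div, h2]
  refine one_div_le_one_div_of_le (by norm_num) ?_
  have := pow_le_pow_left₀ (by norm_num) h1.le 3
  exact le_trans (by norm_num) this

lemma exp_neg_one_gt : (0.36 : ℝ) < Real.exp (-1) := by
  have := Real.exp_neg_one_gt_d9
  linarith

lemma sq_mul_exp_neg_le {s : ℝ} (hs : 0 < s) : s ^ 2 * Real.exp (-s) ≤ 6 / s := by
  have h1 := Real.pow_div_factorial_le_exp s hs.le 3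
  rw [Real.exp_neg, ← div_eq_mul_inv, div_le_div_iff₀ (Real.exp_pos s) hs]
  norm_num [Nat.factorial] at h1
  nlinarith

/-! ### Typical samples under a monotone hazard rate -/

section mhr
variable {ι : Type*} [Fintype ι]

/-- Selling at v or above to 0.3 n samples earns at least 0.3 v n. A sample above 3v has value at
most vL with L = -log Q > 3, and every sample ranked no lower than it contributes at least L to the
sum of `tailLog`. So its revenue is at most 0.21 v n, the m extra sales add at most 0.05 v n, and
0.26 < 0.3. -/
lemma mem_typical_of_sums {V : ℝ → ℝ} (hV0 : ∀ q, 0 ≤ V q) {v : ℝ} (hv : 0 < v)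
    (hlow : ∀ q ∈ Set.Ioo (0 : ℝ) 1, q < Real.exp (-1) → v ≤ V q)
    (hup : ∀ q ∈ Set.Ioo (0 : ℝ) 1, V q ≤ v * max 1 (-Real.log q)) {m : ℕ}
    (hι : 0 < Fintype.card ι) (hm : (m : ℝ) ≤ 0.05 * √(Fintype.card ι)) {Q : ι → ℝ}
    (hQ : ∀ i, Q i ∈ Set.Ioo (0 : ℝ) 1)
    (h1 : 0.3 * Fintype.card ι ≤ ∑ i, (Set.Iio (Real.exp (-1))).indicator (fun _ => (1 : ℝ)) (Q i))
    (h2 : ∑ i, tailLog (Q i) ≤ 0.21 * Fintype.card ι)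
    (h3 : ∀ i, Real.exp (-√(Fintype.card ι)) ≤ Q i) :
    Q ∈ typical V m (0.3 * v) 10 := by
  classical
  set n : ℝ := (Fintype.card ι : ℝ) with hn
  have hn0 : 0 < n := by rw [hn]; exact_mod_cast hι
  have hs2 : √n * √n = n := Real.mul_self_sqrt hn0.le
  have hcard : ∑ i, (Set.Iio (Real.exp (-1))).indicator (fun _ => (1 : ℝ)) (Q i) =
      ((Finset.univ.filter fun i => Q i < Real.exp (-1)).card : ℝ) := by
    rw [Finset.card_filter]
    push_cast
    exact Finset.sum_congr rfl fun i _ => by simp [Set.indicator_apply]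
  rw [hcard] at h1
  have hne : (Finset.univ.filter fun i => Q i < Real.exp (-1)).Nonempty := by
    rw [← Finset.card_pos]
    have : (0 : ℝ) < (Finset.univ.filter fun i => Q i < Real.exp (-1)).card := by linarith
    exact_mod_cast this
  obtain ⟨i₀, hi₀, hmax⟩ := Finset.exists_max_image _ Q hne
  simp only [Finset.mem_filter, Finset.mem_univ, true_and] at hi₀ hmax
  have hrk : (0.3 : ℝ) * n ≤ rk Q i₀ := by
    have hle : (Finset.univ.filter fun i => Q i < Real.exp (-1)).card ≤ rk Q i₀ :=
      Finset.card_le_card fun i hi => by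
        simp only [Finset.mem_filter, Finset.mem_univ, true_and] at hi ⊢
        exact hmax i hi
    exact h1.trans (Nat.cast_le.2 hle)
  have hrev : 0.3 * v * n ≤ rev V Q i₀ := by
    have := mul_le_mul (hlow _ (hQ i₀) hi₀) hrk (by positivity) (hV0 _)
    rw [rev]; linarith
  refine ⟨⟨i₀, hrev⟩, fun i' hnear => ?_⟩
  by_contra hlt
  push Not at hlt
  set L := -Real.log (Q i') with hL
  have hVL := hup _ (hQ i')
  have hL3 : 3 < L := by
    by_contra hle
    push Not at hle
    have : max 1 L ≤ 3 := max_le (by norm_num) hle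
    have := mul_le_mul_of_nonneg_left this hv.le
    linarith
  rw [max_eq_right (by linarith)] at hVL
  have hQ3 : Q i' ≤ Real.exp (-3) := by
    rw [← Real.log_le_iff_le_exp (hQ i').1]; linarith
  have hLn : L ≤ √n := by
    have := (Real.le_log_iff_exp_le (hQ i').1).2 (h3 i')
    linarith
  have hrkL : L * rk Q i' ≤ ∑ i, tailLog (Q i) := by
    calc L * rk Q i' = ∑ i ∈ Finset.univ.filter (fun i => Q i ≤ Q i'), L := by
          rw [Finset.sum_const, nsmul_eq_mul, rk, mul_comm]
      _ ≤ ∑ i ∈ Finset.univ.filter (fun i => Q i ≤ Q i'), tailLog (Q i) := by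
          refine Finset.sum_le_sum fun i hi => ?_
          simp only [Finset.mem_filter, Finset.mem_univ, true_and] at hi
          rw [tailLog, Set.indicator_of_mem (Set.mem_Iic.2 (hi.trans hQ3))]
          exact neg_le_neg (Real.log_le_log (hQ i).1 hi)
      _ ≤ ∑ i, tailLog (Q i) :=
          Finset.sum_le_sum_of_subset_of_nonneg (Finset.filter_subset _ _)
            fun i _ _ => tailLog_nonneg (hQ i)
  have e1 : rev V Q i' ≤ v * (0.21 * n) := by
    calc rev V Q i' ≤ v * L * rk Q i' := mul_le_mul_of_nonneg_right hVL (Nat.cast_nonneg _)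
      _ = v * (L * rk Q i') := by ring
      _ ≤ v * (0.21 * n) := mul_le_mul_of_nonneg_left (hrkL.trans h2) hv.le
  have e2 : m * V (Q i') ≤ v * (0.05 * n) := by
    calc m * V (Q i') ≤ (0.05 * √n) * (v * √n) :=
          mul_le_mul hm (hVL.trans (mul_le_mul_of_nonneg_left hLn hv.le)) (hV0 _) (by positivity)
      _ = v * (0.05 * (√n * √n)) := by ring
      _ = v * (0.05 * n) := by rw [hs2]
  have e3 := hnear i₀
  have e4 : 0 < v * n := mul_pos hv hn0
  nlinarith

/-- Chebyshev controls the two sums, with room because exp(-1) - 0.06 > 0.3 and 4 exp(-3) + 0.01 ≤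
0.21. A union bound excludes quantiles below exp(-√n), which keeps all values at most v √n. -/
lemma real_compl_typical_le {V : ℝ → ℝ} (hV0 : ∀ q, 0 ≤ V q) {v : ℝ} (hv : 0 < v)
    (hlow : ∀ q ∈ Set.Ioo (0 : ℝ) 1, q < Real.exp (-1) → v ≤ V q)
    (hup : ∀ q ∈ Set.Ioo (0 : ℝ) 1, V q ≤ v * max 1 (-Real.log q)) {m : ℕ}
    (hι : 0 < Fintype.card ι) (hm : (m : ℝ) ≤ 0.05 * √(Fintype.card ι)) :
    (Measure.pi fun _ : ι => unif).real (typical V m (0.3 * v) 10)ᶜ ≤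
      330000 / √(Fintype.card ι) := by
  set n : ℝ := (Fintype.card ι : ℝ) with hn
  set μ := Measure.pi fun _ : ι => unif with hμ
  have hn0 : 0 < n := by rw [hn]; exact_mod_cast hι
  have hn1 : 1 ≤ n := by rw [hn]; exact_mod_cast hι
  have hs0 : 0 < √n := Real.sqrt_pos.2 hn0
  have hs1 : 1 ≤ √n := Real.one_le_sqrt.2 hn1
  have hs2 : √n * √n = n := Real.mul_self_sqrt hn0.le
  set g : ℝ → ℝ := (Set.Iio (Real.exp (-1))).indicator fun _ => (1 : ℝ) with hg
  have he1 : Real.exp (-1) ≤ 1 := Real.exp_le_one_iff.2 (by norm_num)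
  have hgm : MemLp g 2 unif := (memLp_const 1).indicator measurableSet_Iio
  have hgi : ∫ q, g q ∂unif = Real.exp (-1) := by
    rw [hg, integral_indicator_const _ measurableSet_Iio, unif_real_Iio (Real.exp_pos _).le he1]
    simp
  have hgi2 : ∫ q, g q ^ 2 ∂unif = Real.exp (-1) := by
    rw [← hgi]; congr 1; ext q
    simp only [hg, Set.indicator_apply]; split_ifs <;> norm_num
  have c1 := real_abs_sum_sub_ge_le (ι := ι) unif hgm hι (ε := 0.06) (by norm_num)
  have c2 := real_abs_sum_sub_ge_le (ι := ι) unif integral_tailLog_sq_le.1 hι (ε := 0.01)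
    (by norm_num)
  rw [← hn] at c1 c2
  rw [hgi, hgi2] at c1
  rw [integral_tailLog] at c2
  set E₁ : Set (ι → ℝ) := {Q | 0.06 * n ≤ |∑ i, g (Q i) - n * Real.exp (-1)|} with hE₁
  set E₂ : Set (ι → ℝ) := {Q | 0.01 * n ≤ |∑ i, tailLog (Q i) - n * (4 * Real.exp (-3))|} with hE₂
  set E₃ : Set (ι → ℝ) := ⋃ i ∈ (Finset.univ : Finset ι),
    (fun Q : ι → ℝ => Q i) ⁻¹' Set.Iio (Real.exp (-√n)) with hE₃
  have hsub : ((typical V m (0.3 * v) 10)ᶜ : Set (ι → ℝ)) ≤ᵐ[μ] (E₁ ∪ (E₂ ∪ E₃) : Set (ι → ℝ)) := by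
    filter_upwards [ae_unif_pi (ι := ι)] with Q hQ hQt
    change Q ∈ E₁ ∪ (E₂ ∪ E₃)
    by_contra hnot
    simp only [hE₁, hE₂, hE₃, Set.mem_union, Set.mem_ofPred_eq, Set.mem_iUnion, Set.mem_preimage,
      Set.mem_Iio, Finset.mem_univ, exists_true_left, not_or, not_le, not_exists, not_lt] at hnot
    obtain ⟨g1, g2, g3⟩ := hnot
    have g1' := (abs_lt.1 g1).1
    have g2' := (abs_lt.1 g2).2
    have := exp_neg_three_le
    have := exp_neg_one_gt
    exact hQt (mem_typical_of_sums hV0 hv hlow hup hι hm hQ (by nlinarith) (by nlinarith) g3)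
  have p3 : μ.real E₃ ≤ n * Real.exp (-√n) := by
    refine (measureReal_biUnion_finset_le _ _).trans ?_
    have : ∀ i ∈ (Finset.univ : Finset ι),
        μ.real ((fun Q : ι → ℝ => Q i) ⁻¹' Set.Iio (Real.exp (-√n))) ≤ Real.exp (-√n) := by
      intro i _
      rw [measureReal_def, (measurePreserving_eval (fun _ : ι => unif) i).measure_preimage
        measurableSet_Iio.nullMeasurableSet, ← measureReal_def,
        unif_real_Iio (Real.exp_pos _).le (Real.exp_le_one_iff.2 (by linarith))]
    refine (Finset.sum_le_sum this).trans ?_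
    simp [hn]
  have p1 : μ.real E₁ ≤ 300 / √n := by
    refine c1.trans ?_
    rw [div_le_div_iff₀ (by positivity) hs0]
    nlinarith
  have p2 : μ.real E₂ ≤ 320000 / √n := by
    refine c2.trans ?_
    rw [div_le_div_iff₀ (by positivity) hs0]
    have := integral_tailLog_sq_le.2
    nlinarith
  have p3' : n * Real.exp (-√n) ≤ 6 / √n := by
    have := sq_mul_exp_neg_le hs0
    rwa [sq, hs2] at this
  have h4 : μ.real (typical V m (0.3 * v) 10)ᶜ ≤ μ.real (E₁ ∪ (E₂ ∪ E₃)) :=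
    ENNReal.toReal_mono (measure_ne_top _ _) (measure_mono_ae hsub)
  have h5 : μ.real (E₁ ∪ (E₂ ∪ E₃)) ≤ 300 / √n + (320000 / √n + 6 / √n) :=
    (measureReal_union_le _ _).trans (add_le_add p1
      ((measureReal_union_le _ _).trans (add_le_add p2 (p3.trans p3'))))
  have h6 : 300 / √n + (320000 / √n + 6 / √n) ≤ 330000 / √n := by
    rw [← add_div, ← add_div]
    exact div_le_div_of_nonneg_right (by norm_num) hs0.le
  linarith

end mhr

/-! ### The two bounds -/

section final
variable {N : ℕ} {I : Finset (Fin N)} {c : ℝ}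

lemma ae_regular (F : Measure ℝ) [IsProbabilityMeasure F] (hF : ∀ᵐ x ∂F, 0 < x) (hc : 0 ≤ c)
    (h1 : (I.card : ℝ) ≤ c * N) (h2 : c * N < Fintype.card {j // j ∉ I}) :
    ∀ᵐ w ∂(lawOutside F I), Regular c I w := by
  have h : ∀ᵐ w ∂(lawOutside F I), ∀ j, 0 < w j := by
    rw [ae_all_iff]
    intro j
    exact (Measure.tendsto_eval_ae_ae (μ := fun _ : {j // j ∉ I} => F) (i := j)).eventually hF
  exact h.mono fun w hw => ⟨hc, h1, h2, hw⟩

lemma DeltaWorst_eq_zero (F : Measure ℝ) [IsProbabilityMeasure F]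
    (hreg : ∀ᵐ w ∂(lawOutside F I), Regular c I w) (hI : I.card = 0) :
    DeltaWorst (erm c) F I = 0 :=
  integral_eq_zero_of_ae (hreg.mono fun _ hw => hw.deltaWorst_eq_zero hI)

lemma cast_card_outside : (Fintype.card {j // j ∉ I} : ℝ) = N - I.card := by
  have : I.card ≤ N := by simpa using Finset.card_le_univ I
  rw [card_outside, Nat.cast_sub this]

lemma log_sq_div_sqrt_le {n N : ℝ} (hn1 : 1 ≤ n) (hnN : n ≤ N) (hN : N ≤ 4 * n) :
    Real.log n ^ 2 / √n ≤ 2 * (Real.log N ^ 2 / √N) := by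
  have hl : Real.log n ≤ Real.log N := Real.log_le_log (by linarith) hnN
  have hl0 : 0 ≤ Real.log n := Real.log_nonneg hn1
  have hs : √N ≤ 2 * √n := by
    rw [Real.sqrt_le_left (by positivity), mul_pow, Real.sq_sqrt (by linarith)]
    linarith
  have hs0 : 0 < √n := Real.sqrt_pos.2 (by linarith)
  have hS0 : 0 < √N := Real.sqrt_pos.2 (by linarith)
  rw [← mul_div_assoc, div_le_div_iff₀ hs0 hS0]
  have h1 := pow_le_pow_left₀ hl0 hl 2
  have h2 : 0 ≤ Real.log N ^ 2 := by positivity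
  calc Real.log n ^ 2 * √N ≤ Real.log N ^ 2 * (2 * √n) := mul_le_mul h1 hs hS0.le h2
    _ = _ := by ring

/-- The bound for monotone hazard rate distributions. -/
lemma mhr_bound (hN : 100 ≤ N) (hmN : (I.card : ℝ) ≤ 0.02 * √N) (F : Measure ℝ)
    [IsProbabilityMeasure F] (hF : IsMHR F) (hc1 : (I.card : ℝ) / N ≤ c)
    (hc2 : c ≤ 1 / (4 * Real.exp 1)) :
    Integrable (deltaWorst (erm c) I) (lawOutside F I) ∧
      DeltaWorst (erm c) F I ≤ 8000000 * ((I.card : ℝ) * (Real.log N ^ 3 / √N)) := by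
  have hNr : (100 : ℝ) ≤ N := by exact_mod_cast hN
  have hN0 : (0 : ℝ) < N := by linarith
  have hs2 : √(N : ℝ) * √N = N := Real.mul_self_sqrt hN0.le
  have hs10 : (10 : ℝ) ≤ √N := by
    refine Real.le_sqrt_of_sq_le ?_
    linarith
  have hmN' : (I.card : ℝ) ≤ 0.002 * N := by nlinarith
  have hcard := cast_card_outside (I := I)
  set n : ℝ := (Fintype.card {j // j ∉ I} : ℝ) with hn
  have hnlow : 0.99 * N ≤ n := by linarith
  have hnN : n ≤ N := by linarith [Nat.cast_nonneg (α := ℝ) I.card]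
  have hc0 : 0 ≤ c := le_trans (by positivity) hc1
  have hmc : (I.card : ℝ) ≤ c * N := (div_le_iff₀ hN0).1 hc1
  -- With D = 10 this holds since 10/(4e) < 0.92 while n ≥ 0.99 N.
  have hcn : c * N * 10 < n := by
    have he := Real.exp_one_gt_d9
    have h1 : c ≤ 0.092 := by
      refine hc2.trans ?_
      rw [div_le_iff₀ (by positivity)]
      linarith
    nlinarith
  obtain ⟨hz, v, hv, hcv, htail⟩ := hF.exists_scale
  have hpos : ∀ᵐ x ∂F, 0 < x := by
    have h1 : ∀ᵐ x ∂F, x ≠ 0 := by rw [ae_iff]; simpa using hz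
    filter_upwards [hF.nonneg, h1] with x hx hx1
    exact lt_of_le_of_ne hx (Ne.symm hx1)
  have hreg := ae_regular (I := I) F hpos hc0 hmc
    (by rw [← hn]; nlinarith [mul_nonneg hc0 hN0.le])
  refine ⟨integrable_deltaWorst F hreg, ?_⟩
  have hlogN : 1 ≤ Real.log N := by
    rw [Real.le_log_iff_exp_le hN0]
    linarith [Real.exp_one_lt_d9]
  rcases Nat.eq_zero_or_pos I.card with h0 | hm1
  · rw [DeltaWorst_eq_zero F hreg h0]; positivity
  have hmr : (1 : ℝ) ≤ I.card := by exact_mod_cast hm1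
  obtain ⟨V, hV0, hVa, hVp, hgal⟩ := exists_quantile F hF.nonneg
  have hlow : ∀ q ∈ Set.Ioo (0 : ℝ) 1, q < Real.exp (-1) → v ≤ V q := by
    intro q hq hqe
    by_contra hlt
    push Not at hlt
    have h1 := (hgal q hq (V q)).1 le_rfl
    have h2 := monotone_cdf F hlt.le
    rw [hcv] at h2
    linarith
  have hup : ∀ q ∈ Set.Ioo (0 : ℝ) 1, V q ≤ v * max 1 (-Real.log q) := by
    intro q hq
    rw [hgal q hq, mul_comm]
    have h1 := htail (max 1 (-Real.log q)) (le_max_left _ _)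
    have h2 : Real.exp (-(max 1 (-Real.log q))) ≤ q := by
      rw [← Real.le_log_iff_exp_le hq.1]
      linarith [le_max_right 1 (-Real.log q)]
    linarith
  have hn3 : 3 ≤ Fintype.card {j // j ∉ I} := by
    have : (3 : ℝ) ≤ n := by linarith
    rw [hn] at this
    exact_mod_cast this
  have hsn : 0.99 * √N ≤ √n := by
    refine Real.le_sqrt_of_sq_le ?_
    rw [mul_pow, Real.sq_sqrt hN0.le]
    linarith
  have hn0 : 0 < n := by linarith
  have hmain := DeltaWorst_le (D := 10) F hV0 hVa hVp hreg (v₀ := 0.3 * v) (by positivity)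
    (by norm_num) hn3 hm1 (by linarith) hcn
  have htyp := real_compl_typical_le (ι := {j // j ∉ I}) hV0 hv hlow hup (m := I.card) (by omega)
    (by rw [← hn]; linarith)
  rw [← hn] at hmain htyp
  have hlogn : 1 ≤ Real.log n := by
    rw [Real.le_log_iff_exp_le hn0]
    linarith [Real.exp_one_lt_d9]
  have hsn0 : 0 < √n := Real.sqrt_pos.2 hn0
  have h1 : 330000 / √n ≤ 330000 * (I.card * (Real.log n ^ 2 / √n)) := by
    have h2 : 1 ≤ I.card * Real.log n ^ 2 := by nlinarith
    calc 330000 / √n = 330000 * 1 / √n := by ring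
      _ ≤ 330000 * (I.card * Real.log n ^ 2) / √n := by gcongr
      _ = _ := by ring
  have h3 := log_sq_div_sqrt_le (n := n) (N := N) (by linarith) hnN (by linarith)
  have h4 : Real.log N ^ 2 / √N ≤ Real.log N ^ 3 / √N := by
    refine div_le_div_of_nonneg_right ?_ (by linarith)
    exact pow_le_pow_right₀ hlogN (by norm_num)
  have h5 : 33000 * (I.card * (10 : ℝ) ^ 2 * Real.log n ^ 2 / √n) =
      3300000 * (I.card * (Real.log n ^ 2 / √n)) := by ring
  rw [h5] at hmain
  have h6 : (I.card : ℝ) * (Real.log n ^ 2 / √n) ≤ I.card * (2 * (Real.log N ^ 3 / √N)) :=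
    mul_le_mul_of_nonneg_left (by linarith) (by linarith)
  have h7 : 0 ≤ (I.card : ℝ) * (Real.log N ^ 3 / √N) := by positivity
  linarith

/-- The bound for distributions supported in `[1, D]`. -/
lemma bounded_bound (hN : 100 ≤ N) (hmN : (I.card : ℝ) ≤ 0.02 * √N) {D : ℝ} (hD : 1 ≤ D)
    (F : Measure ℝ) [IsProbabilityMeasure F] (hF : IsBoundedDist D F)
    (hc1 : (I.card : ℝ) / N ≤ c) (hc2 : c ≤ 1 / (2 * D)) :
    Integrable (deltaWorst (erm c) I) (lawOutside F I) ∧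
      DeltaWorst (erm c) F I ≤ 66000 * (D ^ ((8 : ℝ) / 3) * (I.card : ℝ) ^ ((2 : ℝ) / 3) *
        (Real.log N ^ 2 / (N : ℝ) ^ ((1 : ℝ) / 3))) := by
  have hNr : (100 : ℝ) ≤ N := by exact_mod_cast hN
  have hN0 : (0 : ℝ) < N := by linarith
  have hs0 : 0 < √(N : ℝ) := Real.sqrt_pos.2 hN0
  have hs2 : √(N : ℝ) * √N = N := Real.mul_self_sqrt hN0.le
  have hs10 : (10 : ℝ) ≤ √N := by
    refine Real.le_sqrt_of_sq_le ?_
    linarith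
  have hmN' : (I.card : ℝ) ≤ 0.002 * N := by nlinarith
  have hcard := cast_card_outside (I := I)
  set n : ℝ := (Fintype.card {j // j ∉ I} : ℝ) with hn
  have hnlow : 0.99 * N ≤ n := by linarith
  have hnN : n ≤ N := by linarith [Nat.cast_nonneg (α := ℝ) I.card]
  have hc0 : 0 ≤ c := le_trans (by positivity) hc1
  have hmc : (I.card : ℝ) ≤ c * N := (div_le_iff₀ hN0).1 hc1
  have hcn : c * N * D < n := by
    rw [le_div_iff₀ (by linarith)] at hc2
    have := mul_le_mul_of_nonneg_right hc2 hN0.le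
    nlinarith
  have hpos : ∀ᵐ x ∂F, 0 < x := hF.mono fun x hx => by linarith [hx.1]
  have hreg := ae_regular (I := I) F hpos hc0 hmc
    (by rw [← hn]; nlinarith [mul_nonneg hc0 hN0.le])
  refine ⟨integrable_deltaWorst F hreg, ?_⟩
  have hlogN : 1 ≤ Real.log N := by
    rw [Real.le_log_iff_exp_le hN0]
    linarith [Real.exp_one_lt_d9]
  rcases Nat.eq_zero_or_pos I.card with h0 | hm1
  · rw [DeltaWorst_eq_zero F hreg h0]; positivity
  have hmr : (1 : ℝ) ≤ I.card := by exact_mod_cast hm1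
  set m : ℝ := (I.card : ℝ) with hmdef
  have hm0 : 0 < m := by linarith
  have hDpow : D ^ 2 ≤ D ^ ((8 : ℝ) / 3) := by
    rw [← Real.rpow_natCast]
    exact Real.rpow_le_rpow_of_exponent_le hD (by norm_num)
  have hroot : (N : ℝ) ^ ((1 : ℝ) / 3) * (N : ℝ) ^ ((1 : ℝ) / 6) = √N := by
    rw [← Real.rpow_add hN0, Real.sqrt_eq_rpow]; norm_num
  have hr3 : 0 < (N : ℝ) ^ ((1 : ℝ) / 3) := Real.rpow_pos_of_pos hN0 _
  -- The quotient of the two sides is (m/√N)^(1/3), and m ≤ √N.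
  have hmroot : m / √N ≤ m ^ ((2 : ℝ) / 3) / (N : ℝ) ^ ((1 : ℝ) / 3) := by
    rw [div_le_div_iff₀ hs0 hr3, ← hroot]
    have h1 : m = m ^ ((2 : ℝ) / 3) * m ^ ((1 : ℝ) / 3) := by
      rw [← Real.rpow_add hm0, show (2 : ℝ) / 3 + 1 / 3 = 1 by norm_num, Real.rpow_one]
    have h2 : m ^ ((1 : ℝ) / 3) ≤ (N : ℝ) ^ ((1 : ℝ) / 6) := by
      have h3 : m ≤ (N : ℝ) ^ ((1 : ℝ) / 2) := by
        rw [← Real.sqrt_eq_rpow]; linarith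
      have h4 := Real.rpow_le_rpow hm0.le h3 (by norm_num : (0 : ℝ) ≤ 1 / 3)
      rw [← Real.rpow_mul hN0.le] at h4
      norm_num at h4 ⊢
      exact h4
    have h5 : 0 ≤ m ^ ((2 : ℝ) / 3) * (N : ℝ) ^ ((1 : ℝ) / 3) :=
      mul_nonneg (Real.rpow_nonneg hm0.le _) hr3.le
    calc m * (N : ℝ) ^ ((1 : ℝ) / 3)
        = (m ^ ((2 : ℝ) / 3) * (N : ℝ) ^ ((1 : ℝ) / 3)) * m ^ ((1 : ℝ) / 3) := by
          rw [mul_right_comm, ← h1]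
      _ ≤ (m ^ ((2 : ℝ) / 3) * (N : ℝ) ^ ((1 : ℝ) / 3)) * (N : ℝ) ^ ((1 : ℝ) / 6) :=
          mul_le_mul_of_nonneg_left h2 h5
      _ = _ := by ring
  have htarget : D ^ 2 * (m / √N) * Real.log N ^ 2 ≤ D ^ ((8 : ℝ) / 3) * m ^ ((2 : ℝ) / 3) *
        (Real.log N ^ 2 / (N : ℝ) ^ ((1 : ℝ) / 3)) := by
    have h1 : D ^ 2 * (m / √N) * Real.log N ^ 2 ≤ D ^ ((8 : ℝ) / 3) *
        (m ^ ((2 : ℝ) / 3) / (N : ℝ) ^ ((1 : ℝ) / 3)) * Real.log N ^ 2 := by gcongr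
    refine h1.trans (le_of_eq ?_)
    ring
  have hlog2 : 1 ≤ Real.log N ^ 2 := one_le_pow₀ hlogN
  -- `DeltaWorst_le` needs mD ≤ n/2. When D is too large for that, the claimed bound exceeds 1.
  rcases lt_or_ge (N : ℝ) (8 * (m * D)) with hlarge | hsmall
  · refine (DeltaWorst_le_one F hreg).trans ?_
    have h1 : 1 ≤ 8 * (D ^ 2 * (m / √N) * Real.log N ^ 2) := by
      have h2 : √N ≤ 8 * (D ^ 2 * m) := by
        have h3 : √N * 1 ≤ N := by nlinarith
        nlinarith [mul_pos hm0 (by linarith : 0 < D)]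
      have h4 : 1 ≤ 8 * (D ^ 2 * (m / √N)) := by
        rw [← mul_div_assoc, ← mul_div_assoc, le_div_iff₀ hs0]; linarith
      nlinarith
    have h5 : 0 ≤ D ^ 2 * (m / √N) * Real.log N ^ 2 := by positivity
    linarith
  · obtain ⟨V, hV0, hVa, hVp, hgal⟩ := exists_quantile F (hpos.mono fun x hx => hx.le)
    have hn3 : 3 ≤ Fintype.card {j // j ∉ I} := by
      have : (3 : ℝ) ≤ n := by linarith
      rw [hn] at this
      exact_mod_cast this
    have hmain := DeltaWorst_le F hV0 hVa hVp hreg (v₀ := 1) one_pos hD hn3 hm1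
      (by linarith) hcn
    -- The lowest sample is at least 1 and sells to everyone, so the revenue is at least n, and no
    -- value exceeds D.
    have htyp : (Measure.pi fun _ : {j // j ∉ I} => unif).real (typical V I.card 1 D)ᶜ = 0 := by
      rw [measureReal_def, (measure_eq_zero_iff_ae_notMem).2, ENNReal.toReal_zero]
      have hV1 : ∀ᵐ q ∂unif, V q ∈ Set.Icc 1 D := hVp.quasiMeasurePreserving.ae hF
      have hall : ∀ᵐ Q ∂(Measure.pi fun _ : {j // j ∉ I} => unif), ∀ i, V (Q i) ∈ Set.Icc 1 D := by
        rw [ae_all_iff]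
        intro i
        exact (Measure.tendsto_eval_ae_ae
          (μ := fun _ : {j // j ∉ I} => unif) (i := i)).eventually hV1
      filter_upwards [hall] with Q hQ hQt
      refine hQt ⟨?_, fun i' _ => by rw [mul_one]; exact (hQ i').2⟩
      have hne : Nonempty {j // j ∉ I} := Fintype.card_pos_iff.1 (by omega)
      obtain ⟨i, hi⟩ := Finite.exists_max Q
      refine ⟨i, ?_⟩
      have hrk : rk Q i = Fintype.card {j // j ∉ I} := by
        rw [rk, Finset.filter_true_of_mem (fun x _ => hi x), Finset.card_univ]
      rw [rev, hrk]
      exact mul_le_mul_of_nonneg_right (hQ i).1 (Nat.cast_nonneg _)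
    rw [htyp, zero_add, ← hn] at hmain
    have h3 := log_sq_div_sqrt_le (n := n) (N := N) (by linarith) hnN (by linarith)
    have h4 : m * D ^ 2 * Real.log n ^ 2 / √n = m * D ^ 2 * (Real.log n ^ 2 / √n) := by ring
    rw [h4] at hmain
    have h5 := mul_le_mul_of_nonneg_left h3 (by positivity : 0 ≤ m * D ^ 2)
    have h6 : m * D ^ 2 * (2 * (Real.log N ^ 2 / √N)) =
        2 * (D ^ 2 * (m / √N) * Real.log N ^ 2) := by ring
    rw [h6] at h5
    linarith

lemma eventually_le_sqrt {m : ℕ → ℕ}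
    (hm : (fun N => (m N : ℝ)) =o[atTop] (fun N : ℕ => Real.sqrt (N : ℝ))) :
    ∀ᶠ N : ℕ in atTop, 100 ≤ N ∧ (m N : ℝ) ≤ 0.02 * √N := by
  filter_upwards [eventually_ge_atTop 100, hm.def (by norm_num : (0 : ℝ) < 0.02)] with N h1 h2
  refine ⟨h1, ?_⟩
  rwa [Real.norm_of_nonneg (Nat.cast_nonneg _), Real.norm_of_nonneg (Real.sqrt_nonneg _)] at h2

end final

end IncentiveAwareness

theorem theorem1 :
    (∃ C : ℝ, 0 < C ∧
      ∀ m : ℕ → ℕ, (fun N => (m N : ℝ)) =o[atTop] (fun N : ℕ => Real.sqrt (N : ℝ)) →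
        ∀ᶠ N : ℕ in atTop,
          ∀ (F : Measure ℝ) [IsProbabilityMeasure F], IncentiveAwareness.IsMHR F →
          ∀ c : ℝ, (m N : ℝ) / N ≤ c → c ≤ 1 / (4 * Real.exp 1) →
          ∀ I : Finset (Fin N), I.card = m N →
            Integrable (IncentiveAwareness.deltaWorst (IncentiveAwareness.erm c) I)
              (IncentiveAwareness.lawOutside F I) ∧
            IncentiveAwareness.DeltaWorst (IncentiveAwareness.erm c) F I
              ≤ C * ((m N : ℝ) * (Real.log N ^ 3 / Real.sqrt N))) ∧
    (∃ C : ℝ, 0 < C ∧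
      ∀ m : ℕ → ℕ, (fun N => (m N : ℝ)) =o[atTop] (fun N : ℕ => Real.sqrt (N : ℝ)) →
        ∀ᶠ N : ℕ in atTop,
          ∀ D : ℝ, 1 ≤ D →
          ∀ (F : Measure ℝ) [IsProbabilityMeasure F], IncentiveAwareness.IsBoundedDist D F →
          ∀ c : ℝ, (m N : ℝ) / N ≤ c → c ≤ 1 / (2 * D) →
          ∀ I : Finset (Fin N), I.card = m N →
            Integrable (IncentiveAwareness.deltaWorst (IncentiveAwareness.erm c) I)
              (IncentiveAwareness.lawOutside F I) ∧
            IncentiveAwareness.DeltaWorst (IncentiveAwareness.erm c) F I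
              ≤ C * (D ^ ((8 : ℝ) / 3) * (m N : ℝ) ^ ((2 : ℝ) / 3) *
                  (Real.log N ^ 2 / (N : ℝ) ^ ((1 : ℝ) / 3)))) := by
  refine ⟨⟨8000000, by norm_num, fun m hm => ?_⟩, 66000, by norm_num, fun m hm => ?_⟩
  · filter_upwards [IncentiveAwareness.eventually_le_sqrt hm] with N hN F _ hF c hc1 hc2 I hI
    rw [← hI] at hN hc1 ⊢
    exact IncentiveAwareness.mhr_bound hN.1 hN.2 F hF hc1 hc2
  · filter_upwards [IncentiveAwareness.eventually_le_sqrt hm] with N hN D hD F _ hF c hc1 hc2 I hI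
    rw [← hI] at hN hc1 ⊢
    exact IncentiveAwareness.bounded_bound hN.1 hN.2 hD F hF hc1 hc2
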